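/- Let $b>0$ with $b^2\notin\mathbb Q$, and put $Q=b+b^{-1}$, $\omega=e^{i\pi/3}$, $h_0=2\sin\frac{\pi(b-b^{-1})}{6Q}$, $Q_L=\frac1{\sqrt2 b}+\sqrt2 b$, $Q_L'=\frac{\sqrt2}b+\frac b{\sqrt2}$, $f(x)=1+\frac{h_0^2-1}{x+x^{-1}-1}$ and, for $a\in\mathbb C$, $p=p(a)=\frac{4\sqrt2a-b+b^{-1}}{6Q}-\frac12$. Let $\mathcal W$ be the group of affine maps of $\mathbb C$ generated by $a\mapsto Q_L-a$ and $a\mapsto -Q_L'-a$, and let $\mathcal A=\mathbb C[\alpha_{-1},\alpha_{-2},\dots]$. Stripped bosonization. For $n\ge1$ let $Y_n=\cos\frac{\pi(b-b^{-1})n}{3Q}-\cos\frac{\pi n}3$ and $A_n^{\pm}=4(\pm i)^n\cos\frac{\pi n}6\,Y_n$. Consider the Heisenberg algebra generated by $d^+_{\pm n}$ and $\alpha^{R}_{n},\alpha^{L}_{-n}$ $(n\ge1)$, whose only nonzero commutators (up to antisymmetry) are $$[\alpha^R_n,d^+_{-n}]=-n,\qquad [d^+_n,\alpha^L_{-n}]=-(-1)^n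 n,\qquad [\alpha^R_n,\alpha^L_{-n}]=-\frac{(-1)^n n\,(2\cos\frac{\pi n}3-1)}{2Y_n},$$ and put $d^-_n=d^+_n-A^+_n\alpha^R_n$, $d^-_{-n}=d^+_{-n}-A^+_n\alpha^L_{-n}$. Then $d^\pm_m$, $d^\pm_n$ commute, $[d^-_n,d^+_{-n}]=nA_n^+$, $[d^+_n,d^-_{-n}]=nA_n^-$, and if $A_n^+\ne0$ (that is, $n\not\equiv3$ mod $6$) then $\alpha^R_n=(d^+_n-d^-_n)/A^+_n$ and $\alpha^L_{-n}=(d^+_{-n}-d^-_{-n})/A^+_n$. Let $|1\rangle$ be annihilated by all modes with index $n>0$ and $\langle1|$ by all modes with index $-n<0$, with $\langle1|1\rangle=1$. Let $\pi_R,\pi_L$ be the homomorphisms on $\mathcal A$ with $\pi_R(\alpha_{-n})=\alpha^R_n$ and $\pi_L(\alpha_{-n})=\alpha^L_{-n}$. Put $\lambda^\pm(z)=\,:\!\exp\sum_{n\ne0}\frac{d^\pm_n}nz^{-n}\!:$, $\lambda^0(z)=\,:\!\lambda^+(z\omega^{-1})\lambda^-(z\omega)\!:$ and $$t(z)=e^{i\pi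 p}\lambda^+(z)+e^{-i\pi p}\lambda^-(z)+h_0\lambda^0(z).$$ Products of the $\lambda^\sigma$ are defined by normal ordering: $\lambda^\sigma(x)\lambda^\tau(y)=F_{\sigma\tau}(x,y):\!\lambda^\sigma(x)\lambda^\tau(y)\!:$ with $F_{\sigma\tau}(x,y)=F_{\tau\sigma}(y,x)$, $F_{++}=F_{--}=1$, $F_{+-}(x,y)=f(\frac xy\omega)f(\frac xy\omega^2)$, $F_{+0}(x,y)=f(\frac xy\omega)$, $F_{-0}(x,y)=f(\frac xy\omega^{-1})$, $F_{00}(x,y)=f(\frac xy)$, and with the product of these factors over all pairs for longer products. For $h,h'\in\mathcal A$ the stripped matrix element is the rational function $$\tilde J^{h\bar h'}_{N,a}(x_1,\dots,x_N)=\langle1|\pi_R(h)\,t(x_1)\cdots t(x_N)\,\pi_L(h')|1\rangle .$$ Theorem. For generic $a$, namely for all $a$ outside a countable $\mathcal W$-invariant set $S\subset\mathbb C$ (depending only on $b$), there are linear maps $r_a(w):\mathcal A\to\mathcal A$, $w\in\mathcal W$, forming a representation of $\mathcal W$ in the sense that $r_a(1)=\mathrm{id}$ and $r_a(w'w)=r_{wa}(w')\,r_a(w)$,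 such that for all $a\notin S$, $w\in\mathcal W$, $N\ge0$ and $h,h'\in\mathcal A$ $$\tilde J^{h\bar h'}_{N,a}(x_1,\dots,x_N)=\tilde J^{(r_a(w)h)\,\overline{(r_{Q_L-a}(w)h')}}_{N,wa}(x_1,\dots,x_N)$$ as rational functions of $x_1,\dots,x_N$ (at all nonzero $x_i$ with $x_i^6\ne x_j^6$ for $i\ne j$). -/

import Mathlib

noncomputable section

namespace BulloughDodd

open MvPolynomial

/-! ### Constants of the model (`b` is the coupling constant) -/

/-- `Q = b + 1/b`. -/
def Q (b : ℝ) : ℝ := b + b⁻¹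

/-- `ω = e^{iπ/3}`. -/
def omega : ℂ := Complex.exp (Real.pi * Complex.I / 3)

/-- The weight `h = 2 sin (π (b - 1/b) / (6 Q))` of `λ⁰` in the current. -/
def hConst (b : ℝ) : ℝ := 2 * Real.sin (Real.pi * (b - b⁻¹) / (6 * Q b))

/-- `p = (4 √2 a - b + 1/b) / (6 Q) - 1/2`. -/
def p (b : ℝ) (a : ℂ) : ℂ := (4 * (√2 : ℝ) * a - b + (b : ℂ)⁻¹) / (6 * (Q b : ℂ)) - 1 / 2

/-- `Q_L = 1/(√2 b) + √2 b`. -/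
def QL (b : ℝ) : ℝ := 1 / (√2 * b) + √2 * b

/-- `Q'_L = √2/b + b/√2`. -/
def QL' (b : ℝ) : ℝ := √2 / b + b / √2

/-- `f(x) = 1 + (h² - 1) / (x + 1/x - 1)`. -/
def f (b : ℝ) (x : ℂ) : ℂ := 1 + ((hConst b : ℂ) ^ 2 - 1) / (x + x⁻¹ - 1)

/-- The group `𝒲` of reflections of the parameter `a`: it is generated by `a ↦ Q_L - a` and
`a ↦ -Q'_L - a`. -/
def W (b : ℝ) : Subgroup (Equiv.Perm ℂ) :=
  Subgroup.closure {Equiv.subLeft (QL b : ℂ), Equiv.subLeft (-(QL' b : ℂ))}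

/-! ### The Heisenberg algebra

At each level `n > 0` there are two annihilation modes, `α_n = π_R(α_{-n})` and `d⁺_n`, and two
creation modes, `α_{-n} = π_L(α_{-n})` and `d⁺_{-n}`. The remaining modes are
`d⁻_{±n} = d⁺_{±n} - A⁺_n α_{±n}`. Hence `α_{±n} = (d⁺_{±n} - d⁻_{±n}) / A⁺_n` whenever `A⁺_n ≠ 0`;
the modes `α_{±n}` are taken as generators since `A⁺_n = 0` for `n ≡ 3 (mod 6)`. A mode is
stored as the pair of its coefficients with respect to `α_{±n}` and `d⁺_{±n}`. -/

/-- `cos (π (b - 1/b) n / (3 Q)) - cos (π n / 3)`. -/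
def Y (b : ℝ) (n : ℕ+) : ℝ :=
  Real.cos (Real.pi * (b - b⁻¹) * n / (3 * Q b)) - Real.cos (Real.pi * n / 3)

/-- `A⁺_n`; note that `ω^{3n/2} = i^n`. -/
def APlus (b : ℝ) (n : ℕ+) : ℂ :=
  4 * Complex.I ^ (n : ℕ) * Real.cos (Real.pi * n / 6) * Y b n

/-- `A⁻_n`; note that `ω^{-3n/2} = (-i)^n`. -/
def AMinus (b : ℝ) (n : ℕ+) : ℂ :=
  4 * (-Complex.I) ^ (n : ℕ) * Real.cos (Real.pi * n / 6) * Y b n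

/-- The commutator `[α_n, α_{-n}]`. It equals `-n (1 + (-1)^n) / A⁺_n` if `A⁺_n ≠ 0`, and if
`A⁺_n = 0` it is the limit of `-ν (A⁺_ν + A⁻_ν) / (A⁺_ν)²` for real `ν → n`. -/
def commAlpha (b : ℝ) (n : ℕ+) : ℂ :=
  -(n * (-1) ^ (n : ℕ) * (2 * Real.cos (Real.pi * n / 3) - 1)) / (2 * Y b n)

/-- The mode `α_{±n}`. -/
def alpha : ℂ × ℂ := (1, 0)

/-- The mode `d⁺_{±n}`. -/
def dPlus : ℂ × ℂ := (0, 1)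

/-- The mode `d⁻_{±n} = d⁺_{±n} - A⁺_n α_{±n}`. -/
def dMinus (b : ℝ) (n : ℕ+) : ℂ × ℂ := dPlus - APlus b n • alpha

/-- The commutator `[x_n, y_{-n}]` of an annihilation mode with a creation mode of the same level,
determined by `[α_n, d⁺_{-n}] = -n`, `[d⁺_n, α_{-n}] = -(-1)^n n`, `[d⁺_n, d⁺_{-n}] = 0`. All other
pairs of modes commute. -/
def modeComm (b : ℝ) (n : ℕ+) (x y : ℂ × ℂ) : ℂ :=
  x.1 * y.1 * commAlpha b n - n * x.1 * y.2 - n * (-1) ^ (n : ℕ) * x.2 * y.1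

theorem aPlus_mul_commAlpha (b : ℝ) (n : ℕ+) (hY : Y b n ≠ 0) :
    APlus b n * commAlpha b n = -(n * (1 + (-1) ^ (n : ℕ))) := by
  have hY' : (Y b n : ℂ) ≠ 0 := by exact_mod_cast hY
  have key : Complex.I ^ (n : ℕ) * (2 * (Real.cos (Real.pi * n / 6) : ℂ) *
      (2 * (Real.cos (Real.pi * n / 3) : ℂ) - 1)) = (-1) ^ (n : ℕ) + 1 := by
    have hI : Complex.I = Complex.exp (Real.pi / 2 * Complex.I) := Complex.exp_pi_div_two_mul_I.symm
    set e : ℂ := Complex.exp (Real.pi * n / 6 * Complex.I) with he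
    have he0 : e ≠ 0 := Complex.exp_ne_zero _
    have h1 : Complex.I ^ (n : ℕ) = e ^ 3 := by
      rw [hI, ← Complex.exp_nat_mul, he, ← Complex.exp_nat_mul]; congr 1; push_cast; ring
    have h2 : (-1 : ℂ) ^ (n : ℕ) = e ^ 6 := by
      rw [← Complex.I_sq, ← pow_mul, mul_comm, pow_mul, h1]; ring
    have h3 : 2 * (Real.cos (Real.pi * n / 6) : ℂ) = e + e⁻¹ := by
      rw [Complex.ofReal_cos, Complex.two_cos, he, ← Complex.exp_neg]
      push_cast; congr 2; ring
    have h4 : 2 * (Real.cos (Real.pi * n / 3) : ℂ) = e ^ 2 + (e ^ 2)⁻¹ := by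
      rw [Complex.ofReal_cos, Complex.two_cos, he, ← Complex.exp_nat_mul, ← Complex.exp_neg]
      push_cast; congr 2 <;> ring
    rw [h1, h2, h3, h4]
    field_simp
    ring
  have h5 : ((-1 : ℂ) ^ (n : ℕ)) * (-1) ^ (n : ℕ) = 1 := by
    rw [← mul_pow]; simp
  unfold APlus commAlpha
  field_simp
  linear_combination (-2 * (-1) ^ (n : ℕ)) * key - 2 * h5

/-- `[d⁺_n, d⁺_{-n}] = 0`. -/
theorem modeComm_dPlus_dPlus (b : ℝ) (n : ℕ+) : modeComm b n dPlus dPlus = 0 := by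
  simp [modeComm, dPlus]

/-- `[d⁻_n, d⁻_{-n}] = 0`. -/
theorem modeComm_dMinus_dMinus (b : ℝ) (n : ℕ+) (hY : Y b n ≠ 0) :
    modeComm b n (dMinus b n) (dMinus b n) = 0 := by
  have h := aPlus_mul_commAlpha b n hY
  simp only [modeComm, dMinus, dPlus, alpha, Prod.fst_sub, Prod.snd_sub, Prod.smul_fst, Prod.smul_snd,
    smul_eq_mul]
  linear_combination APlus b n * h

/-- `[d⁻_n, d⁺_{-n}] = n A⁺_n = n A⁻_{-n}`. -/
theorem modeComm_dMinus_dPlus (b : ℝ) (n : ℕ+) : modeComm b n (dMinus b n) dPlus = n * APlus b n := by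
  simp [modeComm, dMinus, dPlus, alpha]

/-- `[d⁺_n, d⁻_{-n}] = n A⁻_n = n A⁺_{-n}`. -/
theorem modeComm_dPlus_dMinus (b : ℝ) (n : ℕ+) : modeComm b n dPlus (dMinus b n) = n * AMinus b n := by
  have h : (-Complex.I) ^ (n : ℕ) = (-1) ^ (n : ℕ) * Complex.I ^ (n : ℕ) := neg_pow _ _
  simp [modeComm, dMinus, dPlus, alpha, APlus, AMinus, h]
  ring

/-! ### Fock modules -/

/-- The commutative algebra `𝒜`, freely generated by `α_{-n}`, `n > 0`. -/
abbrev A : Type := MvPolynomial ℕ+ ℂ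

/-- The Fock modules, as vector spaces. The left module `𝒟^L` consists of the polynomials in the
creation modes applied to the vacuum `|1⟩`, the right module `𝒟^R` of the polynomials in the
annihilation modes applied to `⟨1|`; `Sum.inl n` is the mode `α_{∓n}` and `Sum.inr n` is the mode
`d⁺_{∓n}`. -/
abbrev Fock : Type := MvPolynomial (ℕ+ ⊕ ℕ+) ℂ

/-- `h ↦ ⟨1| π_R(h)`, respectively `h ↦ π_L(h) |1⟩`. -/
def physical : A →ₐ[ℂ] Fock := rename Sum.inl

/-- The action of a right vector on the left module: the annihilation mode `x_n` acts as the
derivation `[x_n, α_{-n}] ∂/∂α_{-n} + [x_n, d⁺_{-n}] ∂/∂d⁺_{-n}`. The value is the symbol of this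
differential operator with constant coefficients, the variable `X i` standing for `∂/∂(X i)`. -/
def symbol (b : ℝ) : Fock →ₐ[ℂ] Fock :=
  bind₁ (Sum.elim
    (fun n => C (modeComm b n alpha alpha) * X (Sum.inl n) + C (modeComm b n alpha dPlus) * X (Sum.inr n))
    (fun n => C (modeComm b n dPlus alpha) * X (Sum.inl n) + C (modeComm b n dPlus dPlus) * X (Sum.inr n)))

/-- The bracket `(∏ X_i^{k_i}, ∏ X_i^{l_i}) = ∏ k_i! δ_{k_i, l_i}`: the constant term of `u(∂) v`. -/
def bracket (u v : Fock) : ℂ :=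
  ∑ m ∈ u.support, u.coeff m * v.coeff m * m.prod (fun _ k => (k.factorial : ℂ))

/-- The pairing `⟨u | v⟩` of the right and the left Fock module, with `⟨1 | 1⟩ = 1`. -/
def pairing (b : ℝ) (u v : Fock) : ℂ := bracket (symbol b u) v

/-! ### Normal ordered exponentials -/

/-- A normal ordered exponential `:exp ∑_{n > 0} (E.1_n + E.2_n):`, where `E.1 n` is an annihilation
mode and `E.2 n` is a creation mode of level `n`. The normal ordered product of two of them is given
by the sum of the exponents. -/
abbrev NormalExp : Type := (ℕ+ → ℂ × ℂ) × (ℕ+ → ℂ × ℂ)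

/-- The action of the annihilation part on the left module,
`exp(E.1) v |1⟩ = (exp(E.1) v exp(-E.1)) |1⟩`. -/
def NormalExp.actLeft (b : ℝ) (E : NormalExp) : Fock →ₐ[ℂ] Fock :=
  bind₁ (Sum.elim
    (fun n => X (Sum.inl n) + C (modeComm b n (E.1 n) alpha))
    (fun n => X (Sum.inr n) + C (modeComm b n (E.1 n) dPlus)))

/-- The action of the creation part on the right module,
`⟨1| u exp(E.2) = ⟨1| (exp(-E.2) u exp(E.2))`. -/
def NormalExp.actRight (b : ℝ) (E : NormalExp) : Fock →ₐ[ℂ] Fock :=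
  bind₁ (Sum.elim
    (fun n => X (Sum.inl n) + C (modeComm b n alpha (E.2 n)))
    (fun n => X (Sum.inr n) + C (modeComm b n dPlus (E.2 n))))

/-- The matrix element `⟨u| E |v⟩` of a normal ordered exponential. -/
def NormalExp.matrixElement (b : ℝ) (E : NormalExp) (u v : Fock) : ℂ :=
  pairing b (E.actRight b u) (E.actLeft b v)

/-- `λ⁺(z) = exp ∑_{n ≠ 0} d⁺_n z^{-n} / n`. -/
def lamPlus (z : ℂ) : NormalExp :=
  (fun n => (z⁻¹ ^ (n : ℕ) / (n : ℂ)) • dPlus, fun n => (-(z ^ (n : ℕ) / (n : ℂ))) • dPlus)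

/-- `λ⁻(z) = exp ∑_{n ≠ 0} d⁻_n z^{-n} / n`. -/
def lamMinus (b : ℝ) (z : ℂ) : NormalExp :=
  (fun n => (z⁻¹ ^ (n : ℕ) / (n : ℂ)) • dMinus b n,
    fun n => (-(z ^ (n : ℕ) / (n : ℂ))) • dMinus b n)

/-- The exponentials `λ^σ(z)`, `σ = +, -, 0`, with `λ⁰(z) = :λ⁺(z ω⁻¹) λ⁻(z ω):`. -/
def lam (b : ℝ) : SignType → ℂ → NormalExp
  | .pos, z => lamPlus z
  | .neg, z => lamMinus b z
  | .zero, z => lamPlus (z * omega⁻¹) + lamMinus b (z * omega)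

/-! ### The current and its matrix elements -/

/-- The functions which define the normal ordering,
`λ^σ(x) λ^τ(y) = contraction σ τ x y :λ^σ(x) λ^τ(y):`. -/
def contraction (b : ℝ) : SignType → SignType → ℂ → ℂ → ℂ
  | .pos, .pos, _, _ => 1
  | .neg, .neg, _, _ => 1
  | .pos, .neg, x, y => f b (x / y * omega) * f b (x / y * omega ^ 2)
  | .neg, .pos, x, y => f b (y / x * omega) * f b (y / x * omega ^ 2)
  | .pos, .zero, x, y => f b (x / y * omega)
  | .zero, .pos, x, y => f b (y / x * omega)
  | .neg, .zero, x, y => f b (x / y * omega⁻¹)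
  | .zero, .neg, x, y => f b (y / x * omega⁻¹)
  | .zero, .zero, x, y => f b (x / y)

/-- The coefficient of `λ^σ` in the current
`t(z) = e^{iπp} λ⁺(z) + e^{-iπp} λ⁻(z) + h λ⁰(z)`. -/
def weight (b : ℝ) (a : ℂ) : SignType → ℂ
  | .pos => Complex.exp (Complex.I * Real.pi * p b a)
  | .neg => Complex.exp (-(Complex.I * Real.pi * p b a))
  | .zero => hConst b

/-- The stripped matrix element
`J̃^{h h̄'}_{N,a}(x_1, …, x_N) = ⟨1| π_R(h) t(x_1) ⋯ t(x_N) π_L(h') |1⟩`, the product of the currents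
being expanded and normal ordered. -/
def Jtilde (b : ℝ) {N : ℕ} (a : ℂ) (x : Fin N → ℂ) (h h' : A) : ℂ :=
  ∑ σ : Fin N → SignType,
    (∏ i, weight b a (σ i)) *
    (∏ i, ∏ j ∈ Finset.Ioi i, contraction b (σ i) (σ j) (x i) (x j)) *
    NormalExp.matrixElement b (∑ i, lam b (σ i) (x i)) (physical h) (physical h')

end BulloughDodd

end

noncomputable section

namespace BulloughDodd

open MvPolynomial

/-! ### Roots of unity and the function `f` -/

/-! The parameter `a` enters only through `u = e^{iπp}`, in the weights `u`, `u⁻¹`, `h₀` of the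
current. The generators of `𝒲` act as `p ↦ -p` and `p ↦ -p - 2`, so each element of `𝒲` either fixes
`u` or inverts it. It is enough to construct one linear map for `u ↦ u⁻¹` and to let translations
act by the identity.

For the vacuum (`vac_inv`), multiply the matrix element by the product of the `z⁶ - x_j⁶` to get a
polynomial in `z` of degree at most `6N`. It is determined by its values at `0` and at the `6N`
points `ω^k x_j`. The value at `0` contains the symmetric factor `u + u⁻¹ + h₀`. The values at `ω^k
x_j`, which play the role of residues, vanish for `k = 0, 1, 5`. For `k = 3` (annihilation) and `k =
2, 4` (fusion of two currents into one) they are factors independent of `u` times smaller vacuum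
elements. Induction gives invariance.

Descendants are reached by adding currents. Expanding `L` extra currents at the points `c_j s` in
`s` gives vectors in which the unphysical modes `d⁺` occur. Against the remaining currents, however,
the contraction exponent is a multiple of the physical charge plus a term independent of all signs.
The first part is reproduced by an exponential in the `α_{-k}`, and the second is a common factor
free of `u`. The resulting vector `Word.vec b u w` has matrix elements read off from those with more
currents (`mel_vec`), so the vacuum symmetry passes to vectors on the right. Inversion of all
arguments passes it to the left, and both sides together give `mel_vec_vec`: right vectors at `u` go
to those at `u⁻¹`, left vectors at `u⁻¹` to those at `u`.

The rule `w.vec b u⁻¹ ↦ w.vec b u` is a well-defined linear map once the vectors span and the matrix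
elements separate descendants. As `u → ∞` only the term with all signs `+` survives. Both properties
then reduce to the fact that the first power sums of points in general position fill a neighbourhood
of `0`. Since everything is polynomial in `u⁻¹` up to powers of `u`, they fail for at most countably
many `u` (`exists_countable_generic`). -/

theorem omega_sq : omega ^ 2 = omega - 1 := by
  have h : omega = 1 / 2 + (√3 / 2 : ℝ) * Complex.I := by
    have : (Real.pi * Complex.I / 3 : ℂ) = ((Real.pi / 3 : ℝ) : ℂ) * Complex.I := by
      push_cast; ring
    rw [omega, this, Complex.exp_mul_I, ← Complex.ofReal_cos, ← Complex.ofReal_sin,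
      Real.cos_pi_div_three, Real.sin_pi_div_three]
    push_cast; ring
  have h3 : ((√3 : ℝ) : ℂ) ^ 2 = 3 := by
    rw [← Complex.ofReal_pow, Real.sq_sqrt (by norm_num)]; norm_num
  rw [h]
  push_cast
  linear_combination (1 / 4) * h3 * Complex.I ^ 2 + (3 / 4) * Complex.I_sq

theorem omega_cube : omega ^ 3 = -1 := by
  linear_combination (omega + 1) * omega_sq

theorem omega_pow_four : omega ^ 4 = -omega := by
  linear_combination omega * omega_cube

theorem omega_pow_five : omega ^ 5 = 1 - omega := by
  linear_combination omega ^ 2 * omega_cube - omega_sq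

theorem omega_pow_six : omega ^ 6 = 1 := by
  linear_combination (omega ^ 3 - 1) * omega_cube

theorem omega_ne_zero : omega ≠ 0 := Complex.exp_ne_zero _

theorem omega_inv : omega⁻¹ = omega ^ 5 :=
  inv_eq_of_mul_eq_one_right (by rw [← omega_pow_six]; ring)

theorem omega_pow_reduce (n : ℕ) : omega ^ (n + 6) = omega ^ n := by
  rw [pow_add, omega_pow_six, mul_one]

theorem f_inv (b : ℝ) (t : ℂ) : f b t⁻¹ = f b t := by
  simp [f, add_comm]

theorem f_congr (b : ℝ) {s t : ℂ} (h : s * t = 1) : f b s = f b t := by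
  rw [eq_inv_of_mul_eq_one_left h, f_inv]

/-- The coefficient `2 - h²` in `f(x) = (x² - (2 - h²) x + 1) / (x² - x + 1)`. -/
def kappa (b : ℝ) : ℂ := 2 - (hConst b : ℂ) ^ 2

section Quadratic

variable {R : Type*} [CommRing R] [Algebra ℂ R]

/-- The homogenized numerator of `f(z / x)`. -/
def quad (b : ℝ) (x z : R) : R := x ^ 2 - kappa b • (x * z) + z ^ 2

/-- The numerator of `f(z / x)` over the denominator `x⁶ - z⁶`. -/
def fNum (b : ℝ) (x z : R) : R := quad b x z * (x ^ 4 + x ^ 3 * z - x * z ^ 3 - z ^ 4)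

/-- The numerator of the contraction over the denominator `x⁶ - y⁶`. -/
def cNum (b : ℝ) : SignType → SignType → R → R → R
  | .pos, .pos, x, y => x ^ 6 - y ^ 6
  | .neg, .neg, x, y => x ^ 6 - y ^ 6
  | .pos, .neg, x, y => quad b x (omega ^ 5 • y) * quad b x (omega ^ 4 • y) *
      ((x - omega • y) * (x - omega ^ 2 • y))
  | .neg, .pos, x, y => quad b x (omega • y) * quad b x (omega ^ 2 • y) *
      ((x - omega ^ 5 • y) * (x - omega ^ 4 • y))
  | .pos, .zero, x, y => fNum b x (omega ^ 5 • y)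
  | .zero, .pos, x, y => fNum b x (omega • y)
  | .neg, .zero, x, y => fNum b x (omega • y)
  | .zero, .neg, x, y => fNum b x (omega ^ 5 • y)
  | .zero, .zero, x, y => fNum b x y

variable {S : Type*} [CommRing S] [Algebra ℂ S]

theorem map_quad (b : ℝ) (φ : R →ₐ[ℂ] S) (x z : R) : φ (quad b x z) = quad b (φ x) (φ z) := by
  simp [quad]

theorem map_cNum (b : ℝ) (φ : R →ₐ[ℂ] S) (s t : SignType) (x y : R) :
    φ (cNum b s t x y) = cNum b s t (φ x) (φ y) := by
  cases s <;> cases t <;> simp [cNum, fNum, map_quad]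

end Quadratic

/-- The quartic is the cofactor in `1 - t⁶ = (1 - t + t²)(1 + t - t³ - t⁴)`. Clearing with `1 - t⁶`
instead of `1 - t + t²` gives all rotated arguments `ω^k t` the same denominator. -/
theorem f_mul (b : ℝ) {t : ℂ} (ht : t ≠ 0) (h : t ^ 6 ≠ 1) :
    f b t * (1 - t ^ 6) = (1 - kappa b * t + t ^ 2) * (1 + t - t ^ 3 - t ^ 4) := by
  have hd : t ^ 2 - t + 1 ≠ 0 := fun h0 => h (by linear_combination (t ^ 4 + t ^ 3 - t - 1) * h0)
  have hd' : t + t⁻¹ - 1 ≠ 0 := fun h0 => hd (by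
    have := mul_inv_cancel₀ ht
    linear_combination t * h0 - this)
  have key : f b t * (t ^ 2 - t + 1) = 1 - kappa b * t + t ^ 2 := by
    have e : t ^ 2 - t + 1 = t * (t + t⁻¹ - 1) := by
      have := mul_inv_cancel₀ ht
      linear_combination -this
    rw [f, e, add_mul, one_mul, kappa]
    rw [div_mul_eq_mul_div, mul_comm t, ← mul_assoc, mul_div_right_comm, mul_div_cancel_right₀ _ hd']
    have := mul_inv_cancel₀ ht
    linear_combination this
  linear_combination (1 + t - t ^ 3 - t ^ 4) * key

theorem f_div_mul (b : ℝ) {x z : ℂ} (hx : x ≠ 0) (hz : z ≠ 0) (h : x ^ 6 ≠ z ^ 6) :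
    f b (z / x) * (x ^ 6 - z ^ 6) = fNum b x z := by
  have h' : (z / x) ^ 6 ≠ 1 := by
    rw [div_pow, Ne, div_eq_one_iff_eq (pow_ne_zero _ hx)]; exact h.symm
  have := f_mul b (div_ne_zero hz hx) h'
  have e : x ^ 6 - z ^ 6 = x ^ 6 * (1 - (z / x) ^ 6) := by field_simp
  rw [e, mul_left_comm, this]
  simp only [fNum, quad, smul_eq_mul]
  field_simp

/-- The contraction as a function of the ratio `r = y / x`. -/
def ratioContraction (b : ℝ) : SignType → SignType → ℂ → ℂ
  | .pos, .pos, _ => 1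
  | .neg, .neg, _ => 1
  | .pos, .neg, r => f b (omega ^ 5 * r) * f b (omega ^ 4 * r)
  | .neg, .pos, r => f b (omega * r) * f b (omega ^ 2 * r)
  | .pos, .zero, r => f b (omega ^ 5 * r)
  | .zero, .pos, r => f b (omega * r)
  | .neg, .zero, r => f b (omega * r)
  | .zero, .neg, r => f b (omega ^ 5 * r)
  | .zero, .zero, r => f b r

theorem contraction_eq (b : ℝ) (s t : SignType) {x y : ℂ} (hx : x ≠ 0) (hy : y ≠ 0) :
    contraction b s t x y = ratioContraction b s t (y / x) := by
  have h6 := omega_pow_six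
  have h0 := omega_ne_zero
  have e1 : f b (x / y * omega) = f b (omega ^ 5 * (y / x)) := f_congr b (by
    field_simp; linear_combination h6)
  have e2 : f b (x / y * omega ^ 2) = f b (omega ^ 4 * (y / x)) := f_congr b (by
    field_simp; linear_combination h6)
  have e3 : f b (x / y * omega⁻¹) = f b (omega * (y / x)) := f_congr b (by field_simp)
  have e4 : y / x * omega = omega * (y / x) := mul_comm _ _
  have e5 : y / x * omega ^ 2 = omega ^ 2 * (y / x) := mul_comm _ _
  have e6 : y / x * omega⁻¹ = omega ^ 5 * (y / x) := by rw [omega_inv, mul_comm]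
  have e7 : f b (x / y) = f b (y / x) := f_congr b (by field_simp)
  cases s <;> cases t <;> simp only [contraction, ratioContraction, e1, e2, e3, e4, e5, e6, e7]

theorem contraction_symm (b : ℝ) (s t : SignType) (x y : ℂ) :
    contraction b s t x y = contraction b t s y x := by
  cases s <;> cases t <;> simp only [contraction]
  rw [← f_inv, inv_div]

theorem contraction_mul (b : ℝ) (s t : SignType) {x y : ℂ} (hx : x ≠ 0) (hy : y ≠ 0)
    (h : x ^ 6 ≠ y ^ 6) : contraction b s t x y * (x ^ 6 - y ^ 6) = cNum b s t x y := by
  have h6 := omega_pow_six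
  have h3 := omega_cube
  have key : ∀ c : ℂ, c ^ 6 = 1 → f b (c * (y / x)) * (x ^ 6 - y ^ 6) = fNum b x (c * y) := by
    intro c hc
    have hc0 : c ≠ 0 := by rintro rfl; simp at hc
    have hz : (c * y) ^ 6 = y ^ 6 := by rw [mul_pow, hc, one_mul]
    have := f_div_mul b hx (mul_ne_zero hc0 hy) (by rwa [hz])
    rwa [hz, mul_div_assoc] at this
  have k1 := key omega h6
  have k2 := key (omega ^ 2) (by linear_combination (omega ^ 6 + 1) * h6)
  have k4 := key (omega ^ 4) (by
    linear_combination (omega ^ 18 + omega ^ 12 + omega ^ 6 + 1) * h6)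
  have k5 := key (omega ^ 5) (by
    linear_combination (omega ^ 24 + omega ^ 18 + omega ^ 12 + omega ^ 6 + 1) * h6)
  have k0 := key 1 (by simp)
  have hne : x ^ 6 - y ^ 6 ≠ 0 := sub_ne_zero.2 h
  rw [contraction_eq b s t hx hy]
  cases s <;> cases t <;> simp only [ratioContraction, cNum, one_mul, smul_eq_mul] at *
  · exact k0
  · exact k5
  · exact k1
  · exact k1
  · apply mul_right_cancel₀ hne
    rw [mul_assoc, mul_mul_mul_comm, k1, k2]
    -- The two cofactors contain `x³ + y³` and `x³ - y³`, so one of the two factors `x⁶ - y⁶` from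
    -- the product of two `f`s cancels. Hence mixed signs also need only the first power of the
    -- denominator.
    have e1 : x ^ 4 + x ^ 3 * (omega * y) - x * (omega * y) ^ 3 - (omega * y) ^ 4 =
        (x ^ 3 + y ^ 3) * (x - omega ^ 4 * y) := by
      rw [show (omega * y) ^ 3 = omega ^ 3 * y ^ 3 by ring,
        show (omega * y) ^ 4 = omega ^ 3 * omega * y ^ 4 by ring,
        show omega ^ 4 = omega ^ 3 * omega by ring, h3]
      ring
    have e2 : x ^ 4 + x ^ 3 * (omega ^ 2 * y) - x * (omega ^ 2 * y) ^ 3 - (omega ^ 2 * y) ^ 4 =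
        (x ^ 3 - y ^ 3) * (x - omega ^ 5 * y) := by
      rw [show (omega ^ 2 * y) ^ 3 = (omega ^ 3) ^ 2 * y ^ 3 by ring,
        show (omega ^ 2 * y) ^ 4 = (omega ^ 3) ^ 2 * omega ^ 2 * y ^ 4 by ring,
        show omega ^ 5 = omega ^ 3 * omega ^ 2 by ring, h3]
      ring
    rw [fNum, fNum, e1, e2]
    ring
  · exact k5
  · apply mul_right_cancel₀ hne
    rw [mul_assoc, mul_mul_mul_comm, k5, k4]
    have e1 : x ^ 4 + x ^ 3 * (omega ^ 5 * y) - x * (omega ^ 5 * y) ^ 3 - (omega ^ 5 * y) ^ 4 =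
        (x ^ 3 + y ^ 3) * (x - omega ^ 2 * y) := by
      rw [show (omega ^ 5 * y) ^ 3 = (omega ^ 3) ^ 5 * y ^ 3 by ring,
        show (omega ^ 5 * y) ^ 4 = (omega ^ 3) ^ 6 * omega ^ 2 * y ^ 4 by ring,
        show omega ^ 5 = omega ^ 3 * omega ^ 2 by ring, h3]
      ring
    have e2 : x ^ 4 + x ^ 3 * (omega ^ 4 * y) - x * (omega ^ 4 * y) ^ 3 - (omega ^ 4 * y) ^ 4 =
        (x ^ 3 - y ^ 3) * (x - omega * y) := by
      rw [show (omega ^ 4 * y) ^ 3 = (omega ^ 3) ^ 4 * y ^ 3 by ring,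
        show (omega ^ 4 * y) ^ 4 = (omega ^ 3) ^ 5 * omega * y ^ 4 by ring,
        show omega ^ 4 = omega ^ 3 * omega by ring, h3]
      ring
    rw [fNum, fNum, e1, e2]
    ring

/-! ### Vacuum matrix elements -/

/-- Points at which the matrix elements are regular. -/
def Regular {N : ℕ} (x : Fin N → ℂ) : Prop :=
  (∀ i, x i ≠ 0) ∧ ∀ i j, i ≠ j → x i ^ 6 ≠ x j ^ 6

theorem Regular.tail {N : ℕ} {z : ℂ} {x : Fin N → ℂ} (h : Regular (Fin.cons z x : Fin (N + 1) → ℂ)) :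
    Regular x :=
  ⟨fun i => by simpa using h.1 i.succ, fun i j hij => by
    simpa using h.2 i.succ j.succ (by simpa using hij)⟩

theorem regular_cons {N : ℕ} {z : ℂ} {x : Fin N → ℂ} :
    Regular (Fin.cons z x : Fin (N + 1) → ℂ) ↔
      z ≠ 0 ∧ (∀ j, z ^ 6 ≠ x j ^ 6) ∧ Regular x := by
  constructor
  · intro h
    refine ⟨by simpa using h.1 0, fun j => ?_, h.tail⟩
    simpa using h.2 0 j.succ (Fin.succ_ne_zero j).symm
  · rintro ⟨h0, h1, h2, h3⟩
    refine ⟨fun i => ?_, fun i j => ?_⟩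
    · cases i using Fin.cases with
      | zero => simpa using h0
      | succ i => simpa using h2 i
    · cases i using Fin.cases with
      | zero =>
        cases j using Fin.cases with
        | zero => simp
        | succ j => intro _; simpa using h1 j
      | succ i =>
        cases j using Fin.cases with
        | zero => intro _; simpa using (h1 i).symm
        | succ j => intro hij; simpa using h3 i j (by simpa using hij)

theorem Regular.comp {N M : ℕ} {x : Fin N → ℂ} (h : Regular x) {e : Fin M → Fin N}
    (he : Function.Injective e) : Regular (x ∘ e) :=
  ⟨fun _ => h.1 _, fun _ _ hij => h.2 _ _ (he.ne hij)⟩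

/-- The coefficients of the current with `u = e^{iπp}`. -/
def wt (b : ℝ) (u : ℂ) : SignType → ℂ
  | .pos => u
  | .neg => u⁻¹
  | .zero => hConst b

theorem weight_eq_wt (b : ℝ) (a : ℂ) (s : SignType) :
    weight b a s = wt b (Complex.exp (Complex.I * Real.pi * p b a)) s := by
  cases s <;> simp [weight, wt, Complex.exp_neg]

theorem sum_signType {M : Type*} [AddCommMonoid M] (g : SignType → M) :
    ∑ s, g s = g .zero + g .neg + g .pos := by
  have : (Finset.univ : Finset SignType) = {.zero, .neg, .pos} := by decide
  rw [this]
  simp [add_assoc]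

/-- The product of the contractions of all pairs. -/
def pairProd (b : ℝ) {N : ℕ} (σ : Fin N → SignType) (x : Fin N → ℂ) : ℂ :=
  ∏ i, ∏ j ∈ Finset.Ioi i, contraction b (σ i) (σ j) (x i) (x j)

/-- The vacuum matrix element. -/
def vac (b : ℝ) (u : ℂ) {N : ℕ} (x : Fin N → ℂ) : ℂ :=
  ∑ σ : Fin N → SignType, (∏ i, wt b u (σ i)) * pairProd b σ x

theorem pairProd_cons (b : ℝ) {N : ℕ} (s : SignType) (σ : Fin N → SignType) (z : ℂ)
    (x : Fin N → ℂ) :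
    pairProd b (Fin.cons s σ : Fin (N + 1) → SignType) (Fin.cons z x : Fin (N + 1) → ℂ) =
      (∏ j, contraction b s (σ j) z (x j)) * pairProd b σ x := by
  simp only [pairProd, Fin.prod_univ_succ, Fin.prod_Ioi_zero, Fin.prod_Ioi_succ, Fin.cons_zero,
    Fin.cons_succ]

theorem sum_cons {M : Type*} [AddCommMonoid M] {N : ℕ} (g : (Fin (N + 1) → SignType) → M) :
    ∑ σ, g σ = ∑ s, ∑ σ : Fin N → SignType, g (Fin.cons s σ) := by
  rw [← Fintype.sum_prod_type', ← (Fin.consEquiv fun _ : Fin (N + 1) => SignType).sum_comp]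
  rfl

theorem vac_cons (b : ℝ) (u : ℂ) {N : ℕ} (z : ℂ) (x : Fin N → ℂ) :
    vac b u (Fin.cons z x : Fin (N + 1) → ℂ) =
      ∑ s, ∑ σ : Fin N → SignType, wt b u s * (∏ i, wt b u (σ i)) *
        (∏ j, contraction b s (σ j) z (x j)) * pairProd b σ x := by
  rw [vac, sum_cons]
  refine Finset.sum_congr rfl fun s _ => Finset.sum_congr rfl fun σ _ => ?_
  rw [pairProd_cons, Fin.prod_univ_succ]
  simp only [Fin.cons_zero, Fin.cons_succ]
  ring

/-- A product over all pairs of a symmetric function does not depend on the order. -/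
theorem prod_Ioi_comp_perm {R : Type*} [CommRing R] [IsDomain R] {N : ℕ} (π : Equiv.Perm (Fin N))
    (g : Fin N → Fin N → R) (hg : ∀ i j, g i j = g j i) :
    ∏ i, ∏ j ∈ Finset.Ioi i, g (π i) (π j) = ∏ i, ∏ j ∈ Finset.Ioi i, g i j := by
  -- The permutation rule for products over pairs concerns antisymmetric functions. It is applied to
  -- the antisymmetric `e` and to `g * e`; the sign of the permutation then cancels.
  let e : Fin N → Fin N → R := fun i j => if i < j then 1 else if j < i then -1 else 0
  have he : ∀ i j, e i j = -e j i := by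
    intro i j
    rcases lt_trichotomy i j with h | h | h
    · simp [e, h, h.not_gt]
    · simp [e, h]
    · simp [e, h, h.not_gt]
  have h1 := π.prod_Ioi_comp_eq_sign_mul_prod he
  have h2 := π.prod_Ioi_comp_eq_sign_mul_prod (f := fun i j => g i j * e i j) (fun i j => by
    rw [he i j, hg i j, mul_neg])
  have h3 : ∏ i, ∏ j ∈ Finset.Ioi i, e i j = 1 :=
    Finset.prod_eq_one fun i _ => Finset.prod_eq_one fun j hj => by
      simp [e, Finset.mem_Ioi.1 hj]
  simp only [Finset.prod_mul_distrib] at h2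
  rw [h1, h3, mul_one, mul_one, mul_comm] at h2
  refine mul_left_cancel₀ ?_ h2
  rcases Int.units_eq_one_or (Equiv.Perm.sign π) with h | h <;> simp [h]

theorem pairProd_comp_perm (b : ℝ) {N : ℕ} (π : Equiv.Perm (Fin N)) (σ : Fin N → SignType)
    (x : Fin N → ℂ) : pairProd b (σ ∘ π) (x ∘ π) = pairProd b σ x :=
  prod_Ioi_comp_perm π (fun i j => contraction b (σ i) (σ j) (x i) (x j))
    fun _ _ => contraction_symm _ _ _ _ _

/-! ### The vacuum element as a polynomial in one argument -/

/-- The numerator of the vacuum matrix element as a function of the first argument. -/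
def vacNum (b : ℝ) (u : ℂ) {R : Type*} [CommRing R] [Algebra ℂ R] {N : ℕ} (z : R)
    (x : Fin N → ℂ) : R :=
  ∑ s, ∑ σ : Fin N → SignType, (wt b u s * (∏ i, wt b u (σ i)) * pairProd b σ x) •
    ∏ j, cNum b s (σ j) z (algebraMap ℂ R (x j))

theorem map_vacNum (b : ℝ) (u : ℂ) {R S : Type*} [CommRing R] [Algebra ℂ R] [CommRing S]
    [Algebra ℂ S] (φ : R →ₐ[ℂ] S) {N : ℕ} (z : R) (x : Fin N → ℂ) :
    φ (vacNum b u z x) = vacNum b u (φ z) x := by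
  simp [vacNum, map_prod, map_cNum]

theorem vac_cons_mul (b : ℝ) (u : ℂ) {N : ℕ} {z : ℂ} {x : Fin N → ℂ}
    (h : Regular (Fin.cons z x : Fin (N + 1) → ℂ)) :
    vac b u (Fin.cons z x : Fin (N + 1) → ℂ) * ∏ j, (z ^ 6 - x j ^ 6) = vacNum b u z x := by
  obtain ⟨hz, hzx, hx⟩ := regular_cons.1 h
  rw [vac_cons, vacNum, Finset.sum_mul]
  refine Finset.sum_congr rfl fun s _ => ?_
  rw [Finset.sum_mul]
  refine Finset.sum_congr rfl fun σ _ => ?_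
  have : ∏ j, cNum b s (σ j) z (algebraMap ℂ ℂ (x j)) =
      (∏ j, contraction b s (σ j) z (x j)) * ∏ j, (z ^ 6 - x j ^ 6) := by
    rw [← Finset.prod_mul_distrib]
    exact Finset.prod_congr rfl fun j _ => (contraction_mul b s (σ j) hz (hx.1 j) (hzx j)).symm
  rw [this, smul_eq_mul]
  ring

/-- This lets any `x_j` be moved to the first place, so that values at `ω^k x_j` need only be
computed for the first point. -/
theorem vacNum_comp_perm (b : ℝ) (u : ℂ) {N : ℕ} (z : ℂ) (x : Fin N → ℂ)
    (π : Equiv.Perm (Fin N)) : vacNum b u z (x ∘ π) = vacNum b u z x := by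
  unfold vacNum
  refine Finset.sum_congr rfl fun s _ => ?_
  rw [← (Equiv.arrowCongr π (Equiv.refl SignType)).symm.sum_comp]
  refine Finset.sum_congr rfl fun σ _ => ?_
  have e : (Equiv.arrowCongr π (Equiv.refl SignType)).symm σ = σ ∘ π := rfl
  rw [e, pairProd_comp_perm]
  have e1 : ∏ i, wt b u ((σ ∘ π) i) = ∏ i, wt b u (σ i) :=
    Equiv.prod_comp π fun i => wt b u (σ i)
  rw [e1]
  congr 1
  exact Equiv.prod_comp π fun j => cNum b s (σ j) z (algebraMap ℂ ℂ (x j))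

/-- All contractions tend to `1` as `z → 0`, so the current at `z` decouples and contributes the sum
of its weights. This supplies the node needed beyond the `6N` points `ω^k x_j`. -/
theorem vacNum_zero (b : ℝ) (u : ℂ) {N : ℕ} (x : Fin N → ℂ) :
    vacNum b u (0 : ℂ) x = (∏ j, -x j ^ 6) * (u + u⁻¹ + hConst b) * vac b u x := by
  have h : ∀ (s t : SignType) (y : ℂ), cNum b s t 0 y = -y ^ 6 := by
    intro s t y
    have h3 := omega_cube
    cases s <;> cases t <;> simp [cNum, fNum, quad] <;> grind
  simp only [vacNum, h, sum_signType]
  rw [vac]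
  simp only [Finset.mul_sum, wt, ← Finset.sum_add_distrib, smul_eq_mul, Algebra.algebraMap_self,
    RingHom.id_apply]
  refine Finset.sum_congr rfl fun σ _ => ?_
  ring

open Polynomial in
theorem natDegree_cNum_le (b : ℝ) (s t : SignType) (y : ℂ) :
    (cNum b s t (Polynomial.X : ℂ[X]) (Polynomial.C y)).natDegree ≤ 6 := by
  cases s <;> cases t <;> simp only [cNum, fNum, quad, Polynomial.smul_eq_C_mul] <;> compute_degree

theorem cNum_one (b : ℝ) (s t : SignType) (y : ℂ) : cNum b s t y y + cNum b t s y y = 0 := by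
  have h2 := omega_sq
  have h4 := omega_pow_four
  have h5 := omega_pow_five
  cases s <;> cases t <;> simp only [cNum, fNum, quad, h4, h5, smul_eq_mul] <;> grind

/-- A numerator vanishes at each sixth root of unity where its contraction has no pole. In this and
the next four tables the surviving entries are the residues of pairs of currents. Here the entries
`-+` and `00` are in the ratio `-h₀²`, exactly opposite to what their weights `1` and `h₀²` can
cancel. -/
theorem cNum_omega (b : ℝ) (y : ℂ) :
    cNum b .pos .pos (omega * y) y = 0 ∧ cNum b .neg .neg (omega * y) y = 0 ∧
    cNum b .pos .neg (omega * y) y = 0 ∧ cNum b .pos .zero (omega * y) y = 0 ∧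
    cNum b .zero .pos (omega * y) y = 0 ∧ cNum b .neg .zero (omega * y) y = 0 ∧
    cNum b .zero .neg (omega * y) y = 0 ∧
    cNum b .neg .pos (omega * y) y = - hConst b ^ 2 * cNum b .zero .zero (omega * y) y := by
  have h2 := omega_sq
  have h4 := omega_pow_four
  have h5 := omega_pow_five
  refine ⟨?_, ?_, ?_, ?_, ?_, ?_, ?_, ?_⟩ <;>
    simp only [cNum, fNum, quad, kappa, h4, h5, smul_eq_mul] <;> grind

theorem cNum_omega_five (b : ℝ) (y : ℂ) :
    cNum b .pos .pos (omega ^ 5 * y) y = 0 ∧ cNum b .neg .neg (omega ^ 5 * y) y = 0 ∧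
    cNum b .neg .pos (omega ^ 5 * y) y = 0 ∧ cNum b .pos .zero (omega ^ 5 * y) y = 0 ∧
    cNum b .zero .pos (omega ^ 5 * y) y = 0 ∧ cNum b .neg .zero (omega ^ 5 * y) y = 0 ∧
    cNum b .zero .neg (omega ^ 5 * y) y = 0 ∧
    cNum b .pos .neg (omega ^ 5 * y) y = - hConst b ^ 2 * cNum b .zero .zero (omega ^ 5 * y) y := by
  have h2 := omega_sq
  have h4 := omega_pow_four
  have h5 := omega_pow_five
  refine ⟨?_, ?_, ?_, ?_, ?_, ?_, ?_, ?_⟩ <;>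
    simp only [cNum, fNum, quad, kappa, h4, h5, smul_eq_mul] <;> grind

theorem cNum_neg_one (b : ℝ) (y : ℂ) :
    cNum b .pos .pos (-y) y = 0 ∧ cNum b .neg .neg (-y) y = 0 ∧
    cNum b .zero .zero (-y) y = 0 ∧ cNum b .pos .zero (-y) y = 0 ∧
    cNum b .zero .pos (-y) y = 0 ∧ cNum b .neg .zero (-y) y = 0 ∧
    cNum b .zero .neg (-y) y = 0 := by
  have h2 := omega_sq
  have h4 := omega_pow_four
  have h5 := omega_pow_five
  refine ⟨?_, ?_, ?_, ?_, ?_, ?_, ?_⟩ <;>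
    simp only [cNum, fNum, quad, kappa, h5, smul_eq_mul] <;> grind

/-- The surviving pairs `-0`, `0+`, `-+` have weights `u⁻¹h₀`, `h₀u`, `1`. With the extra `h₀²` in
the last entry they are in the proportion `u⁻¹ : u : h₀`, the weights of a single current. -/
theorem cNum_omega_sq (b : ℝ) (y : ℂ) :
    cNum b .pos .pos (omega ^ 2 * y) y = 0 ∧ cNum b .neg .neg (omega ^ 2 * y) y = 0 ∧
    cNum b .zero .zero (omega ^ 2 * y) y = 0 ∧ cNum b .pos .zero (omega ^ 2 * y) y = 0 ∧
    cNum b .pos .neg (omega ^ 2 * y) y = 0 ∧ cNum b .zero .neg (omega ^ 2 * y) y = 0 ∧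
    cNum b .neg .zero (omega ^ 2 * y) y = cNum b .zero .pos (omega ^ 2 * y) y ∧
    cNum b .neg .pos (omega ^ 2 * y) y =
      hConst b ^ 2 * cNum b .zero .pos (omega ^ 2 * y) y := by
  have h2 := omega_sq
  have h4 := omega_pow_four
  have h5 := omega_pow_five
  refine ⟨?_, ?_, ?_, ?_, ?_, ?_, ?_, ?_⟩ <;>
    simp only [cNum, fNum, quad, kappa, h4, h5, smul_eq_mul] <;> grind

theorem cNum_omega_four (b : ℝ) (y : ℂ) :
    cNum b .pos .pos (omega ^ 4 * y) y = 0 ∧ cNum b .neg .neg (omega ^ 4 * y) y = 0 ∧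
    cNum b .zero .zero (omega ^ 4 * y) y = 0 ∧ cNum b .neg .zero (omega ^ 4 * y) y = 0 ∧
    cNum b .neg .pos (omega ^ 4 * y) y = 0 ∧ cNum b .zero .pos (omega ^ 4 * y) y = 0 ∧
    cNum b .pos .zero (omega ^ 4 * y) y = cNum b .zero .neg (omega ^ 4 * y) y ∧
    cNum b .pos .neg (omega ^ 4 * y) y =
      hConst b ^ 2 * cNum b .zero .neg (omega ^ 4 * y) y := by
  have h2 := omega_sq
  have h4 := omega_pow_four
  have h5 := omega_pow_five
  refine ⟨?_, ?_, ?_, ?_, ?_, ?_, ?_, ?_⟩ <;>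
    simp only [cNum, fNum, quad, kappa, h4, h5, smul_eq_mul] <;> grind

/-! ### Residues of the vacuum element -/

/-- The sum over the remaining particles in the residue of a vacuum matrix element. -/
def spectator (b : ℝ) (u : ℂ) {N : ℕ} (g : SignType → ℂ → ℂ) (x : Fin N → ℂ) : ℂ :=
  ∑ σ : Fin N → SignType, (∏ i, wt b u (σ i)) * (∏ i, g (σ i) (x i)) * pairProd b σ x

theorem vac_cons_eq_spectator (b : ℝ) (u : ℂ) {N : ℕ} (z : ℂ) (x : Fin N → ℂ) :
    vac b u (Fin.cons z x : Fin (N + 1) → ℂ) =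
      ∑ s, wt b u s * spectator b u (fun t y => contraction b s t z y) x := by
  rw [vac_cons]
  simp only [spectator, Finset.mul_sum]
  exact Finset.sum_congr rfl fun s _ => Finset.sum_congr rfl fun σ _ => by ring

theorem spectator_mul (b : ℝ) (u : ℂ) {N : ℕ} (g : SignType → ℂ → ℂ) (φ : ℂ → ℂ) (x : Fin N → ℂ) :
    spectator b u (fun t y => φ y * g t y) x = (∏ i, φ (x i)) * spectator b u g x := by
  simp only [spectator, Finset.prod_mul_distrib, Finset.mul_sum]
  exact Finset.sum_congr rfl fun σ _ => by ring

theorem spectator_const (b : ℝ) (u : ℂ) {N : ℕ} (φ : ℂ → ℂ) (x : Fin N → ℂ) :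
    spectator b u (fun _ y => φ y) x = (∏ i, φ (x i)) * vac b u x := by
  simp only [spectator, vac, Finset.mul_sum]
  exact Finset.sum_congr rfl fun σ _ => by ring

theorem spectator_congr (b : ℝ) (u : ℂ) {N : ℕ} {g g' : SignType → ℂ → ℂ} {x : Fin N → ℂ}
    (h : ∀ t i, g t (x i) = g' t (x i)) : spectator b u g x = spectator b u g' x := by
  simp only [spectator, h]

/-- Since `(ζy)⁶ = y⁶`, the contractions of the first current with the spectators stay regular. Only
the numerator for the pair at `ζy` and `y` remains as a residue. -/
theorem vacNum_root (b : ℝ) (u : ℂ) {N : ℕ} {ζ y : ℂ} (hζ : ζ ^ 6 = 1) {x : Fin N → ℂ}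
    (h : Regular (Fin.cons y x : Fin (N + 1) → ℂ)) :
    vacNum b u (ζ * y) (Fin.cons y x : Fin (N + 1) → ℂ) =
      (∏ j, (y ^ 6 - x j ^ 6)) * ∑ s, ∑ t, wt b u s * wt b u t * cNum b s t (ζ * y) y *
        spectator b u (fun r w => contraction b s r (ζ * y) w * contraction b t r y w) x := by
  obtain ⟨hy, hyx, hx⟩ := regular_cons.1 h
  have hζ0 : ζ ≠ 0 := by rintro rfl; simp at hζ
  have hz : (ζ * y) ^ 6 = y ^ 6 := by rw [mul_pow, hζ, one_mul]
  rw [vacNum, Finset.mul_sum]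
  refine Finset.sum_congr rfl fun s _ => ?_
  rw [sum_cons, Finset.mul_sum]
  refine Finset.sum_congr rfl fun t _ => ?_
  simp only [spectator, Finset.mul_sum]
  refine Finset.sum_congr rfl fun σ _ => ?_
  have e : ∏ j, cNum b s (σ j) (ζ * y) (x j) =
      (∏ j, contraction b s (σ j) (ζ * y) (x j)) * ∏ j, (y ^ 6 - x j ^ 6) := by
    rw [← Finset.prod_mul_distrib]
    refine Finset.prod_congr rfl fun j _ => ?_
    rw [← contraction_mul b s (σ j) (mul_ne_zero hζ0 hy) (hx.1 j) (by rw [hz]; exact hyx j), hz]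
  simp only [pairProd_cons, Fin.prod_univ_succ, Fin.cons_zero, Fin.cons_succ, smul_eq_mul,
    Algebra.algebraMap_self, RingHom.id_apply, e, Finset.prod_mul_distrib]
  ring

/-- Contractions are symmetric while `x⁶ - y⁶` is antisymmetric, so at coinciding points the summand
is antisymmetric in the two signs. -/
theorem vacNum_root_one (b : ℝ) (u : ℂ) {N : ℕ} {y : ℂ} {x : Fin N → ℂ}
    (h : Regular (Fin.cons y x : Fin (N + 1) → ℂ)) :
    vacNum b u y (Fin.cons y x : Fin (N + 1) → ℂ) = 0 := by
  have h0 := vacNum_root b u (one_pow 6) h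
  simp only [one_mul] at h0
  rw [h0, mul_eq_zero]
  right
  set G : SignType → SignType → ℂ := fun s t => wt b u s * wt b u t * cNum b s t y y *
    spectator b u (fun r w => contraction b s r y w * contraction b t r y w) x with hG
  have hs : ∀ s t, G s t = -G t s := by
    intro s t
    have h1 := cNum_one b s t y
    have h2 : spectator b u (fun r w => contraction b s r y w * contraction b t r y w) x =
        spectator b u (fun r w => contraction b t r y w * contraction b s r y w) x :=
      spectator_congr b u fun _ _ => mul_comm _ _
    simp only [hG]
    rw [h2]
    linear_combination (wt b u s * wt b u t *
      spectator b u (fun r w => contraction b t r y w * contraction b s r y w) x) * h1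
  have h2 : ∑ s, ∑ t, G s t = -∑ s, ∑ t, G s t := by
    conv_lhs => rw [Finset.sum_comm]
    simp only [← Finset.sum_neg_distrib]
    exact Finset.sum_congr rfl fun s _ => Finset.sum_congr rfl fun t _ => hs t s
  exact self_eq_neg.1 h2

/-- Reduction of the powers of `omega` in the arguments of contractions. -/
theorem ratioContraction_mul (b : ℝ) (s t : SignType) (k : ℕ) (r : ℂ) :
    ratioContraction b s t (omega ^ k * r) = match s, t with
      | .pos, .pos => 1
      | .neg, .neg => 1
      | .pos, .neg => f b (omega ^ (5 + k) * r) * f b (omega ^ (4 + k) * r)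
      | .neg, .pos => f b (omega ^ (1 + k) * r) * f b (omega ^ (2 + k) * r)
      | .pos, .zero => f b (omega ^ (5 + k) * r)
      | .zero, .pos => f b (omega ^ (1 + k) * r)
      | .neg, .zero => f b (omega ^ (1 + k) * r)
      | .zero, .neg => f b (omega ^ (5 + k) * r)
      | .zero, .zero => f b (omega ^ k * r) := by
  cases s <;> cases t <;> simp only [ratioContraction, ← mul_assoc, ← pow_add, ← pow_succ', add_comm]

theorem contraction_omega_mul (b : ℝ) (s t : SignType) {k l : ℕ} (hkl : k + l = 6) {y w : ℂ}
    (hy : y ≠ 0) (hw : w ≠ 0) :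
    contraction b s t (omega ^ k * y) w = ratioContraction b s t (omega ^ l * (w / y)) := by
  rw [contraction_eq b s t (mul_ne_zero (pow_ne_zero _ omega_ne_zero) hy) hw]
  congr 1
  have h1 : omega ^ k * omega ^ l = 1 := by rw [← pow_add, hkl, omega_pow_six]
  have := pow_ne_zero k omega_ne_zero
  field_simp
  linear_combination -h1

theorem contraction_eq_zero_pow (b : ℝ) (s t : SignType) {y w : ℂ} (hy : y ≠ 0) (hw : w ≠ 0) :
    contraction b s t y w = ratioContraction b s t (omega ^ 0 * (w / y)) := by
  rw [contraction_eq b s t hy hw, pow_zero, one_mul]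

/-- The pairs `-+` and `00` have the same contractions with every spectator. Their weighted
residues, `-h₀²` and `h₀²` times a common factor, therefore cancel. -/
theorem vacNum_root_omega (b : ℝ) {u : ℂ} (hu : u ≠ 0) {N : ℕ} {y : ℂ} {x : Fin N → ℂ}
    (h : Regular (Fin.cons y x : Fin (N + 1) → ℂ)) :
    vacNum b u (omega * y) (Fin.cons y x : Fin (N + 1) → ℂ) = 0 := by
  obtain ⟨hy, hyx, hx⟩ := regular_cons.1 h
  obtain ⟨c1, c2, c3, c4, c5, c6, c7, c8⟩ := cNum_omega b y
  have hs : spectator b u (fun r w => contraction b .neg r (omega * y) w *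
      contraction b .pos r y w) x = spectator b u (fun r w =>
      contraction b .zero r (omega * y) w * contraction b .zero r y w) x := by
    refine spectator_congr b u fun r i => ?_
    have e := fun s => contraction_omega_mul b s r (k := 1) (l := 5) rfl hy (hx.1 i)
    simp only [pow_one] at e
    simp only [e, contraction_eq_zero_pow b _ _ hy (hx.1 i), ratioContraction_mul]
    cases r <;> simp [omega_pow_reduce] <;> ring
  rw [vacNum_root b u omega_pow_six h]
  simp only [sum_signType, c1, c2, c3, c4, c5, c6, c7, c8, hs, wt]
  field_simp
  ring

theorem vacNum_root_omega_five (b : ℝ) {u : ℂ} (hu : u ≠ 0) {N : ℕ} {y : ℂ} {x : Fin N → ℂ}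
    (h : Regular (Fin.cons y x : Fin (N + 1) → ℂ)) :
    vacNum b u (omega ^ 5 * y) (Fin.cons y x : Fin (N + 1) → ℂ) = 0 := by
  obtain ⟨hy, hyx, hx⟩ := regular_cons.1 h
  obtain ⟨c1, c2, c3, c4, c5, c6, c7, c8⟩ := cNum_omega_five b y
  have hs : spectator b u (fun r w => contraction b .pos r (omega ^ 5 * y) w *
      contraction b .neg r y w) x = spectator b u (fun r w =>
      contraction b .zero r (omega ^ 5 * y) w * contraction b .zero r y w) x := by
    refine spectator_congr b u fun r i => ?_
    have e := fun s => contraction_omega_mul b s r (k := 5) (l := 1) rfl hy (hx.1 i)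
    simp only [e, contraction_eq_zero_pow b _ _ hy (hx.1 i), ratioContraction_mul]
    cases r <;> simp [omega_pow_reduce] <;> ring
  rw [vacNum_root b u (by rw [← pow_mul, mul_comm, pow_mul, omega_pow_six, one_pow]) h]
  simp only [sum_signType, c1, c2, c3, c4, c5, c6, c7, c8, hs, wt]
  field_simp
  ring

/-- Annihilation: the surviving pairs `+-` and `-+` have weight `u u⁻¹ = 1`, and their contractions
with a spectator do not depend on its sign. Hence they factor out of the spectator sum. -/
theorem vacNum_root_neg_one (b : ℝ) {u : ℂ} (hu : u ≠ 0) {N : ℕ} {y : ℂ} {x : Fin N → ℂ}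
    (h : Regular (Fin.cons y x : Fin (N + 1) → ℂ)) :
    vacNum b u (-y) (Fin.cons y x : Fin (N + 1) → ℂ) =
      (∏ j, (y ^ 6 - x j ^ 6)) *
        (cNum b .pos .neg (-y) y * ∏ i, f b (omega * (x i / y)) * f b (omega ^ 2 * (x i / y)) +
        cNum b .neg .pos (-y) y * ∏ i, f b (omega ^ 4 * (x i / y)) * f b (omega ^ 5 * (x i / y))) *
        vac b u x := by
  obtain ⟨hy, hyx, hx⟩ := regular_cons.1 h
  obtain ⟨c1, c2, c3, c4, c5, c6, c7⟩ := cNum_neg_one b y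
  have hs1 : spectator b u (fun r w => contraction b .pos r (omega ^ 3 * y) w *
      contraction b .neg r y w) x =
      spectator b u (fun _ w => f b (omega * (w / y)) * f b (omega ^ 2 * (w / y))) x := by
    refine spectator_congr b u fun r i => ?_
    have e := fun s => contraction_omega_mul b s r (k := 3) (l := 3) rfl hy (hx.1 i)
    simp only [e, contraction_eq_zero_pow b _ _ hy (hx.1 i), ratioContraction_mul]
    cases r <;> simp [omega_pow_reduce] <;> ring
  have hs2 : spectator b u (fun r w => contraction b .neg r (omega ^ 3 * y) w *
      contraction b .pos r y w) x =
      spectator b u (fun _ w => f b (omega ^ 4 * (w / y)) * f b (omega ^ 5 * (w / y))) x := by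
    refine spectator_congr b u fun r i => ?_
    have e := fun s => contraction_omega_mul b s r (k := 3) (l := 3) rfl hy (hx.1 i)
    simp only [e, contraction_eq_zero_pow b _ _ hy (hx.1 i), ratioContraction_mul]
    cases r <;> simp <;> ring
  have hr := vacNum_root b u (ζ := omega ^ 3) (by rw [omega_cube]; norm_num) h
  rw [spectator_const] at hs1 hs2
  simp only [sum_signType, omega_cube, neg_one_mul] at hr hs1 hs2
  simp only [c1, c2, c3, c4, c5, c6, c7, hs1, hs2, wt] at hr
  rw [hr]
  field_simp
  ring

/-- Fusion: up to the common factor `f(ω⁵ x_i / y)`, the surviving pairs contract with a spectator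
as `λ⁻`, `λ⁺`, `λ⁰` at `ωy`. The pair is thereby replaced by one current at `ωy`. -/
theorem vacNum_root_omega_sq (b : ℝ) {u : ℂ} (hu : u ≠ 0) {N : ℕ} {y : ℂ} {x : Fin N → ℂ}
    (h : Regular (Fin.cons y x : Fin (N + 1) → ℂ)) :
    vacNum b u (omega ^ 2 * y) (Fin.cons y x : Fin (N + 1) → ℂ) =
      (∏ j, (y ^ 6 - x j ^ 6)) * (hConst b * cNum b .zero .pos (omega ^ 2 * y) y) *
        (∏ i, f b (omega ^ 5 * (x i / y))) *
        vac b u (Fin.cons (omega * y) x : Fin (N + 1) → ℂ) := by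
  obtain ⟨hy, hyx, hx⟩ := regular_cons.1 h
  obtain ⟨c1, c2, c3, c4, c5, c6, c7, c8⟩ := cNum_omega_sq b y
  have hs1 : spectator b u (fun r w => contraction b .neg r (omega ^ 2 * y) w *
      contraction b .pos r y w) x = spectator b u (fun r w => f b (omega ^ 5 * (w / y)) *
      contraction b .zero r (omega * y) w) x := by
    refine spectator_congr b u fun r i => ?_
    have e := fun s => contraction_omega_mul b s r (k := 2) (l := 4) rfl hy (hx.1 i)
    have e' := fun s => contraction_omega_mul b s r (k := 1) (l := 5) rfl hy (hx.1 i)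
    simp only [pow_one] at e'
    simp only [e, e', contraction_eq_zero_pow b _ _ hy (hx.1 i), ratioContraction_mul]
    cases r <;> simp [omega_pow_reduce]
  have hs2 : spectator b u (fun r w => contraction b .neg r (omega ^ 2 * y) w *
      contraction b .zero r y w) x = spectator b u (fun r w => f b (omega ^ 5 * (w / y)) *
      contraction b .neg r (omega * y) w) x := by
    refine spectator_congr b u fun r i => ?_
    have e := fun s => contraction_omega_mul b s r (k := 2) (l := 4) rfl hy (hx.1 i)
    have e' := fun s => contraction_omega_mul b s r (k := 1) (l := 5) rfl hy (hx.1 i)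
    simp only [pow_one] at e'
    simp only [e, e', contraction_eq_zero_pow b _ _ hy (hx.1 i), ratioContraction_mul]
    cases r <;> simp [omega_pow_reduce] <;> ring
  have hs3 : spectator b u (fun r w => contraction b .zero r (omega ^ 2 * y) w *
      contraction b .pos r y w) x = spectator b u (fun r w => f b (omega ^ 5 * (w / y)) *
      contraction b .pos r (omega * y) w) x := by
    refine spectator_congr b u fun r i => ?_
    have e := fun s => contraction_omega_mul b s r (k := 2) (l := 4) rfl hy (hx.1 i)
    have e' := fun s => contraction_omega_mul b s r (k := 1) (l := 5) rfl hy (hx.1 i)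
    simp only [pow_one] at e'
    simp only [e, e', contraction_eq_zero_pow b _ _ hy (hx.1 i), ratioContraction_mul]
    cases r <;> simp [omega_pow_reduce] <;> ring
  rw [vacNum_root b u (by rw [← pow_mul, mul_comm, pow_mul, omega_pow_six, one_pow]) h,
    vac_cons_eq_spectator]
  rw [spectator_mul] at hs1 hs2 hs3
  simp only [sum_signType, c1, c2, c3, c4, c5, c6, c7, c8, hs1, hs2, hs3, wt]
  field_simp
  ring

theorem vacNum_root_omega_four (b : ℝ) {u : ℂ} (hu : u ≠ 0) {N : ℕ} {y : ℂ} {x : Fin N → ℂ}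
    (h : Regular (Fin.cons y x : Fin (N + 1) → ℂ)) :
    vacNum b u (omega ^ 4 * y) (Fin.cons y x : Fin (N + 1) → ℂ) =
      (∏ j, (y ^ 6 - x j ^ 6)) * (hConst b * cNum b .zero .neg (omega ^ 4 * y) y) *
        (∏ i, f b (omega ^ 1 * (x i / y))) *
        vac b u (Fin.cons (omega ^ 5 * y) x : Fin (N + 1) → ℂ) := by
  obtain ⟨hy, hyx, hx⟩ := regular_cons.1 h
  obtain ⟨c1, c2, c3, c4, c5, c6, c7, c8⟩ := cNum_omega_four b y
  have hs1 : spectator b u (fun r w => contraction b .pos r (omega ^ 4 * y) w *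
      contraction b .neg r y w) x = spectator b u (fun r w => f b (omega ^ 1 * (w / y)) *
      contraction b .zero r (omega ^ 5 * y) w) x := by
    refine spectator_congr b u fun r i => ?_
    have e := fun s => contraction_omega_mul b s r (k := 4) (l := 2) rfl hy (hx.1 i)
    have e' := fun s => contraction_omega_mul b s r (k := 5) (l := 1) rfl hy (hx.1 i)
    simp only [e, e', contraction_eq_zero_pow b _ _ hy (hx.1 i), ratioContraction_mul]
    cases r <;> simp [omega_pow_reduce]
  have hs2 : spectator b u (fun r w => contraction b .pos r (omega ^ 4 * y) w *
      contraction b .zero r y w) x = spectator b u (fun r w => f b (omega ^ 1 * (w / y)) *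
      contraction b .pos r (omega ^ 5 * y) w) x := by
    refine spectator_congr b u fun r i => ?_
    have e := fun s => contraction_omega_mul b s r (k := 4) (l := 2) rfl hy (hx.1 i)
    have e' := fun s => contraction_omega_mul b s r (k := 5) (l := 1) rfl hy (hx.1 i)
    simp only [e, e', contraction_eq_zero_pow b _ _ hy (hx.1 i), ratioContraction_mul]
    cases r <;> simp [omega_pow_reduce] <;> ring
  have hs3 : spectator b u (fun r w => contraction b .zero r (omega ^ 4 * y) w *
      contraction b .neg r y w) x = spectator b u (fun r w => f b (omega ^ 1 * (w / y)) *
      contraction b .neg r (omega ^ 5 * y) w) x := by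
    refine spectator_congr b u fun r i => ?_
    have e := fun s => contraction_omega_mul b s r (k := 4) (l := 2) rfl hy (hx.1 i)
    have e' := fun s => contraction_omega_mul b s r (k := 5) (l := 1) rfl hy (hx.1 i)
    simp only [e, e', contraction_eq_zero_pow b _ _ hy (hx.1 i), ratioContraction_mul]
    cases r <;> simp [omega_pow_reduce] <;> ring
  rw [vacNum_root b u (by rw [← pow_mul, mul_comm, pow_mul, omega_pow_six, one_pow]) h,
    vac_cons_eq_spectator]
  rw [spectator_mul] at hs1 hs2 hs3
  simp only [sum_signType, c1, c2, c3, c4, c5, c6, c7, c8, hs1, hs2, hs3, wt]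
  field_simp
  ring

/-- The numerator with first argument at a node belongs to an element with `N + 1` currents, but its
value involves at most `N` of them. The induction hypothesis therefore covers fusion as well as
annihilation. -/
theorem vacNum_root_eq (b : ℝ) {u : ℂ} (hu : u ≠ 0) {N : ℕ} {x : Fin N → ℂ} (h : Regular x)
    (ih : ∀ M ≤ N, ∀ y : Fin M → ℂ, Regular y → vac b u y = vac b u⁻¹ y) (j : Fin N) (k : Fin 6) :
    vacNum b u (omega ^ (k : ℕ) * x j) x = vacNum b u⁻¹ (omega ^ (k : ℕ) * x j) x := by
  cases N with
  | zero => exact j.elim0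
  | succ N =>
    set π : Equiv.Perm (Fin (N + 1)) := Equiv.swap 0 j
    rw [← vacNum_comp_perm b u _ x π, ← vacNum_comp_perm b u⁻¹ _ x π]
    have hr : Regular (x ∘ π) := h.comp π.injective
    have hx : x j = (x ∘ π) 0 := by simp [π]
    rw [hx]
    generalize x ∘ π = w at hr
    obtain ⟨y, v, rfl⟩ : ∃ y v, w = (Fin.cons y v : Fin (N + 1) → ℂ) :=
      ⟨w 0, Fin.tail w, (Fin.cons_self_tail w).symm⟩
    rw [Fin.cons_zero]
    have hu' := inv_ne_zero hu
    obtain ⟨hy, hyv, hv⟩ := regular_cons.1 hr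
    have hrot : ∀ l : ℕ, Regular (Fin.cons (omega ^ l * y) v : Fin (N + 1) → ℂ) := by
      intro l
      refine regular_cons.2 ⟨mul_ne_zero (pow_ne_zero _ omega_ne_zero) hy, fun i => ?_, hv⟩
      rw [mul_pow, ← pow_mul, mul_comm l, pow_mul, omega_pow_six, one_pow, one_mul]
      exact hyv i
    fin_cases k
    · simp [vacNum_root_one b u hr, vacNum_root_one b u⁻¹ hr]
    · simp [vacNum_root_omega b hu hr, vacNum_root_omega b hu' hr]
    · have := ih _ le_rfl _ (hrot 1)
      rw [pow_one] at this
      simp [vacNum_root_omega_sq b hu hr, vacNum_root_omega_sq b hu' hr, this]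
    · simp [omega_cube, vacNum_root_neg_one b hu hr, vacNum_root_neg_one b hu' hr,
        ih N (Nat.le_succ N) v hv]
    · simp [vacNum_root_omega_four b hu hr, vacNum_root_omega_four b hu' hr,
        ih _ le_rfl _ (hrot 5)]
    · simp [vacNum_root_omega_five b hu hr, vacNum_root_omega_five b hu' hr]

theorem omega_pow_injective {k l : ℕ} (hk : k < 6) (hl : l < 6) (h : omega ^ k = omega ^ l) :
    k = l := by
  have hp : IsPrimitiveRoot omega 6 := by
    have := Complex.isPrimitiveRoot_exp 6 (by norm_num)
    convert this using 1
    rw [omega]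
    congr 1
    push_cast
    ring
  exact hp.pow_inj hk hl h

theorem omega_pow_pow_six (k : ℕ) : (omega ^ k) ^ 6 = 1 := by
  rw [← pow_mul, mul_comm, pow_mul, omega_pow_six, one_pow]

/-- Reflection invariance of the vacuum matrix elements. -/
theorem vac_inv (b : ℝ) {u : ℂ} (hu : u ≠ 0) {N : ℕ} (x : Fin N → ℂ) (h : Regular x) :
    vac b u x = vac b u⁻¹ x := by
  induction N using Nat.strong_induction_on with
  | _ N ih =>
    cases N with
    | zero => simp [vac]
    | succ N =>
      obtain ⟨z, x, rfl⟩ : ∃ z v, x = (Fin.cons z v : Fin (N + 1) → ℂ) :=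
        ⟨x 0, Fin.tail x, (Fin.cons_self_tail x).symm⟩
      obtain ⟨hz, hzx, hx⟩ := regular_cons.1 h
      -- The difference of the two numerators has degree at most `6N` and vanishes at `6N + 1`
      -- distinct points, indexed by `Option (Fin N × Fin 6)` with `none` standing for the point
      -- `0`.
      set P : Polynomial ℂ := vacNum b u Polynomial.X x - vacNum b u⁻¹ Polynomial.X x with hP
      have hev : ∀ w : ℂ, P.eval w = vacNum b u w x - vacNum b u⁻¹ w x := by
        intro w
        have e := fun v => map_vacNum b v (Polynomial.aeval (R := ℂ) w) Polynomial.X x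
        simp only [Polynomial.aeval_X, Polynomial.coe_aeval_eq_eval] at e
        rw [hP, Polynomial.eval_sub, e, e]
      have hdeg : ∀ v, (vacNum b v (Polynomial.X : Polynomial ℂ) x).natDegree ≤ 6 * N := by
        intro v
        refine Polynomial.natDegree_sum_le_of_forall_le _ _ fun s _ =>
          Polynomial.natDegree_sum_le_of_forall_le _ _ fun σ _ =>
          (Polynomial.natDegree_smul_le _ _).trans ((Polynomial.natDegree_prod_le _ _).trans ?_)
        refine (Finset.sum_le_card_nsmul _ _ 6 fun j _ => natDegree_cNum_le b s (σ j) (x j)).trans ?_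
        simp [mul_comm]
      have hP0 : P = 0 := by
        refine Polynomial.eq_zero_of_natDegree_lt_card_of_eval_eq_zero P
          (f := fun o : Option (Fin N × Fin 6) =>
            o.elim 0 fun jk => omega ^ (jk.2 : ℕ) * x jk.1) ?_ ?_ ?_
        · have hne : ∀ jk : Fin N × Fin 6, omega ^ (jk.2 : ℕ) * x jk.1 ≠ 0 := fun jk =>
            mul_ne_zero (pow_ne_zero _ omega_ne_zero) (hx.1 _)
          rintro (_ | ⟨j, k⟩) (_ | ⟨j', k'⟩) hjk
          · rfl
          · exact absurd hjk.symm (hne (j', k'))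
          · exact absurd hjk (hne (j, k))
          · simp only [Option.elim_some] at hjk
            have hj : j = j' := by
              by_contra hj
              apply hx.2 j j' hj
              have := congrArg (· ^ 6) hjk
              simpa only [mul_pow, omega_pow_pow_six, one_mul] using this
            subst hj
            have hk := omega_pow_injective k.2 k'.2 (mul_right_cancel₀ (hx.1 j) hjk)
            rw [Fin.ext hk]
        · rintro (_ | ⟨j, k⟩)
          · rw [hev, Option.elim_none, vacNum_zero, vacNum_zero, ih N (Nat.lt_succ_self N) x hx,
              inv_inv]
            ring
          · rw [hev, Option.elim_some, sub_eq_zero]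
            exact vacNum_root_eq b hu hx (fun M hM y hy => ih M (Nat.lt_succ_of_le hM) y hy) j k
        · refine ((Polynomial.natDegree_sub_le _ _).trans (max_le (hdeg u) (hdeg u⁻¹))).trans_lt ?_
          simp [mul_comm]
      have hne : ∏ j, (z ^ 6 - x j ^ 6) ≠ 0 :=
        Finset.prod_ne_zero_iff.2 fun j _ => sub_ne_zero.2 (hzx j)
      apply mul_right_cancel₀ hne
      rw [vac_cons_mul b u h, vac_cons_mul b u⁻¹ h, ← sub_eq_zero, ← hev, hP0, Polynomial.eval_zero]

/-! ### Exponentials of formal power series -/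

section Exponential

variable {R : Type*} [CommRing R] [Algebra ℂ R]

/-- The coefficients of `exp (∑ ℓ_k s^k)`. -/
def pexpCoeff (ℓ : ℕ+ → R) : ℕ → R
  | 0 => 1
  | n + 1 => ((n + 1 : ℂ)⁻¹) •
      ∑ i : Fin (n + 1), ((i : ℕ) + 1 : R) * ℓ (i : ℕ).succPNat * pexpCoeff ℓ (n - i)

/-- The power series `exp (∑ ℓ_k s^k)`. -/
def pexp (ℓ : ℕ+ → R) : PowerSeries R := PowerSeries.mk (pexpCoeff ℓ)

/-- The derivative of `∑ ℓ_k s^k`. -/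
def dlog (ℓ : ℕ+ → R) : PowerSeries R := PowerSeries.mk fun i => (i + 1 : R) * ℓ i.succPNat

theorem coeff_zero_pexp (ℓ : ℕ+ → R) : PowerSeries.coeff 0 (pexp ℓ) = 1 := by
  simp [pexp, pexpCoeff]

theorem coeff_succ_pexp (ℓ : ℕ+ → R) (n : ℕ) :
    PowerSeries.coeff (n + 1) (pexp ℓ) = ((n + 1 : ℂ)⁻¹) •
      PowerSeries.coeff n (dlog ℓ * pexp ℓ) := by
  rw [PowerSeries.coeff_mul, Finset.Nat.sum_antidiagonal_eq_sum_range_succ_mk]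
  simp only [pexp, dlog, PowerSeries.coeff_mk]
  rw [pexpCoeff, Finset.sum_range fun i => (i + 1 : R) * ℓ i.succPNat * pexpCoeff ℓ (n - i)]

/-- The equation `G' = ℓ' G` with `G(0) = 1` is a recursion for the coefficients, solvable because
`n + 1` is invertible. All identities between exponentials below come from this uniqueness. -/
theorem pexp_unique (ℓ : ℕ+ → R) {G : PowerSeries R} (h0 : PowerSeries.coeff 0 G = 1)
    (h1 : ∀ n : ℕ, (n + 1 : ℂ) • PowerSeries.coeff (n + 1) G = PowerSeries.coeff n (dlog ℓ * G)) :
    G = pexp ℓ := by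
  ext n
  induction n using Nat.strong_induction_on with
  | _ n ih =>
    cases n with
    | zero => rw [h0, coeff_zero_pexp]
    | succ n =>
      have hn : (n + 1 : ℂ) ≠ 0 := Nat.cast_add_one_ne_zero n
      rw [coeff_succ_pexp, ← inv_smul_smul₀ hn (PowerSeries.coeff (n + 1) G), h1]
      congr 1
      rw [PowerSeries.coeff_mul, PowerSeries.coeff_mul]
      refine Finset.sum_congr rfl fun p hp => ?_
      rw [ih p.2 (by have := Finset.HasAntidiagonal.mem_antidiagonal.1 hp; omega)]

theorem derivative_pexp (ℓ : ℕ+ → R) :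
    PowerSeries.derivative R (pexp ℓ) = dlog ℓ * pexp ℓ := by
  ext n
  have hn : (n + 1 : ℂ) ≠ 0 := Nat.cast_add_one_ne_zero n
  rw [PowerSeries.coeff_derivative, coeff_succ_pexp]
  have : ((n : R) + 1) = algebraMap ℂ R (n + 1) := by simp
  rw [this, mul_comm, ← Algebra.smul_def, smul_inv_smul₀ hn]

theorem pexp_unique' (ℓ : ℕ+ → R) {G : PowerSeries R} (h0 : PowerSeries.coeff 0 G = 1)
    (h1 : PowerSeries.derivative R G = dlog ℓ * G) : G = pexp ℓ := by
  refine pexp_unique ℓ h0 fun n => ?_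
  rw [← h1, PowerSeries.coeff_derivative, Algebra.smul_def, mul_comm]
  simp

theorem pexp_add (ℓ ℓ' : ℕ+ → R) : pexp (ℓ + ℓ') = pexp ℓ * pexp ℓ' := by
  symm
  apply pexp_unique'
  · simp [PowerSeries.coeff_mul, coeff_zero_pexp]
  · have : dlog (ℓ + ℓ') = dlog ℓ + dlog ℓ' := by
      ext n; simp [dlog, mul_add]
    rw [Derivation.leibniz, derivative_pexp, derivative_pexp, this, smul_eq_mul, smul_eq_mul]
    ring

theorem pexp_zero : pexp (0 : ℕ+ → R) = 1 := by
  symm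
  apply pexp_unique'
  · simp
  · have : dlog (0 : ℕ+ → R) = 0 := by ext n; simp [dlog]
    rw [this, PowerSeries.derivative_one, zero_mul]

theorem pexp_sum {ι : Type*} (s : Finset ι) (ℓ : ι → ℕ+ → R) :
    pexp (∑ i ∈ s, ℓ i) = ∏ i ∈ s, pexp (ℓ i) := by
  classical
  induction s using Finset.induction_on with
  | empty => simp [pexp_zero]
  | insert i s hi ih => rw [Finset.sum_insert hi, Finset.prod_insert hi, pexp_add, ih]

theorem map_coeff_pexp {S : Type*} [CommRing S] [Algebra ℂ S] (φ : R →ₐ[ℂ] S) (ℓ : ℕ+ → R) (n : ℕ) :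
    φ (PowerSeries.coeff n (pexp ℓ)) = PowerSeries.coeff n (pexp fun k => φ (ℓ k)) := by
  induction n using Nat.strong_induction_on with
  | _ n ih =>
    cases n with
    | zero => simp [coeff_zero_pexp]
    | succ n =>
      rw [coeff_succ_pexp, coeff_succ_pexp, map_smul, PowerSeries.coeff_mul, PowerSeries.coeff_mul,
        map_sum]
      congr 1
      refine Finset.sum_congr rfl fun p hp => ?_
      rw [map_mul, ih p.2 (by have := Finset.HasAntidiagonal.mem_antidiagonal.1 hp; omega)]
      simp [dlog]

theorem coeff_pexp_congr {ℓ ℓ' : ℕ+ → R} {n : ℕ} (h : ∀ k : ℕ+, (k : ℕ) ≤ n → ℓ k = ℓ' k) :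
    PowerSeries.coeff n (pexp ℓ) = PowerSeries.coeff n (pexp ℓ') := by
  induction n using Nat.strong_induction_on with
  | _ n ih =>
    cases n with
    | zero => simp [coeff_zero_pexp]
    | succ n =>
      rw [coeff_succ_pexp, coeff_succ_pexp, PowerSeries.coeff_mul, PowerSeries.coeff_mul]
      congr 1
      refine Finset.sum_congr rfl fun p hp => ?_
      have hp' := Finset.HasAntidiagonal.mem_antidiagonal.1 hp
      rw [ih p.2 (by omega) fun k hk => h k (by omega)]
      congr 1
      simp only [dlog, PowerSeries.coeff_mk]
      rw [h _ (by simp; omega)]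

/-- `1 - a s = exp (-∑ a^k s^k / k)`. -/
theorem one_sub_eq_pexp (a : R) :
    (1 - PowerSeries.C a * PowerSeries.X : PowerSeries R) =
      pexp fun k => -((k : ℂ)⁻¹ • a ^ (k : ℕ)) := by
  apply pexp_unique'
  · simp
  · have hd : dlog (fun k : ℕ+ => -((k : ℂ)⁻¹ • a ^ (k : ℕ))) =
        PowerSeries.mk fun i => -a ^ (i + 1) := by
      ext n
      have hn : (n + 1 : ℂ) ≠ 0 := Nat.cast_add_one_ne_zero n
      have e : ((n : R) + 1) = algebraMap ℂ R (n + 1) := by simp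
      simp only [dlog, PowerSeries.coeff_mk, Nat.succPNat_coe, Nat.succ_eq_add_one]
      rw [e, ← Algebra.smul_def, smul_neg]
      push_cast
      rw [smul_inv_smul₀ hn]
    rw [hd, map_sub, PowerSeries.derivative_one, Derivation.leibniz, PowerSeries.derivative_X,
      PowerSeries.derivative_C]
    ext n
    rw [mul_sub, mul_one, ← mul_assoc, mul_comm _ (PowerSeries.C a), mul_assoc]
    cases n with
    | zero => simp
    | succ n => simp [PowerSeries.coeff_succ_mul_X, pow_succ']

end Exponential

/-! ### Derivations of exponentials -/

section Derivation

variable {R : Type*} [CommRing R] [Algebra ℂ R]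

/-- The series `∑ ℓ_k s^k`. -/
def linSeries (ℓ : ℕ+ → R) : PowerSeries R :=
  PowerSeries.X * PowerSeries.mk fun i => ℓ i.succPNat

theorem derivation_coeff_pexp (D : Derivation ℂ R R) (ℓ : ℕ+ → R) (n : ℕ) :
    D (PowerSeries.coeff n (pexp ℓ)) =
      PowerSeries.coeff n (linSeries (fun k => D (ℓ k)) * pexp ℓ) := by
  induction n using Nat.strong_induction_on with
  | _ n ih =>
    cases n with
    | zero =>
      rw [coeff_zero_pexp]
      simp [linSeries, PowerSeries.coeff_mul]
    | succ n =>
      have hn : (n + 1 : ℂ) ≠ 0 := Nat.cast_add_one_ne_zero n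
      set L := linSeries fun k => D (ℓ k)
      have hL : PowerSeries.derivative R L = dlog fun k => D (ℓ k) := by
        ext m
        rw [PowerSeries.coeff_derivative]
        simp only [L, linSeries, dlog, PowerSeries.coeff_mk, PowerSeries.coeff_succ_X_mul]
        rw [mul_comm]
      have key : PowerSeries.coeff n (PowerSeries.derivative R (L * pexp ℓ)) =
          (n + 1 : ℂ) • PowerSeries.coeff (n + 1) (L * pexp ℓ) := by
        rw [PowerSeries.coeff_derivative, Algebra.smul_def, mul_comm]
        simp
      rw [coeff_succ_pexp, Derivation.map_smul, ← inv_smul_smul₀ hn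
        (PowerSeries.coeff (n + 1) (L * pexp ℓ)), ← key]
      congr 1
      rw [Derivation.leibniz, derivative_pexp, hL, smul_eq_mul, smul_eq_mul, mul_left_comm,
        mul_comm (pexp ℓ), map_add,
        PowerSeries.coeff_mul, map_sum, PowerSeries.coeff_mul, PowerSeries.coeff_mul,
        ← Finset.sum_add_distrib]
      refine Finset.sum_congr rfl fun q hq => ?_
      rw [Derivation.leibniz, ih q.2 (by
        have := Finset.HasAntidiagonal.mem_antidiagonal.1 hq; omega)]
      have : D (PowerSeries.coeff q.1 (dlog ℓ)) =
          PowerSeries.coeff q.1 (dlog fun k => D (ℓ k)) := by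
        simp only [dlog, PowerSeries.coeff_mk]
        have e : ((q.1 : R) + 1) = algebraMap ℂ R (q.1 + 1) := by simp
        rw [e, ← Algebra.smul_def, ← Algebra.smul_def, D.map_smul]
      rw [this, smul_eq_mul, smul_eq_mul, mul_comm (PowerSeries.coeff q.2 (pexp ℓ))]

end Derivation

/-! ### The bracket -/

theorem bracket_eq_sum {u v : Fock} {s : Finset (ℕ+ ⊕ ℕ+ →₀ ℕ)} (hs : u.support ⊆ s) :
    bracket u v = ∑ m ∈ s, u.coeff m * v.coeff m * m.prod (fun _ k => (k.factorial : ℂ)) :=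
  Finset.sum_subset hs fun m _ hm => by simp [notMem_support_iff.1 hm]

theorem bracket_add_left (u u' v : Fock) : bracket (u + u') v = bracket u v + bracket u' v := by
  classical
  rw [bracket_eq_sum (support_add (p := u) (q := u')),
    bracket_eq_sum (Finset.subset_union_left (s₁ := u.support) (s₂ := u'.support)),
    bracket_eq_sum (Finset.subset_union_right (s₁ := u.support) (s₂ := u'.support)),
    ← Finset.sum_add_distrib]
  exact Finset.sum_congr rfl fun m _ => by rw [coeff_add]; ring

theorem bracket_add_right (u v v' : Fock) : bracket u (v + v') = bracket u v + bracket u v' := by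
  simp only [bracket, coeff_add, ← Finset.sum_add_distrib]
  exact Finset.sum_congr rfl fun m _ => by ring

theorem bracket_smul_right (u v : Fock) (c : ℂ) : bracket u (c • v) = c * bracket u v := by
  simp only [bracket, coeff_smul, Finset.mul_sum, smul_eq_mul]
  exact Finset.sum_congr rfl fun m _ => by ring

theorem bracket_zero_right (u : Fock) : bracket u 0 = 0 := by simp [bracket]

theorem bracket_sum_right {ι : Type*} (u : Fock) (s : Finset ι) (v : ι → Fock) :
    bracket u (∑ i ∈ s, v i) = ∑ i ∈ s, bracket u (v i) :=
  map_sum (AddMonoidHom.mk' (bracket u) (bracket_add_right u)) v s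

theorem bracket_monomial (m : ℕ+ ⊕ ℕ+ →₀ ℕ) (c : ℂ) (v : Fock) :
    bracket (monomial m c) v = c * v.coeff m * m.prod (fun _ k => (k.factorial : ℂ)) := by
  rw [bracket_eq_sum (s := {m}) support_monomial_subset, Finset.sum_singleton, coeff_monomial,
    if_pos rfl]

theorem bracket_C (c : ℂ) (v : Fock) : bracket (C c) v = c * v.coeff 0 := by
  rw [C_apply, bracket_monomial, Finsupp.prod_zero_index, mul_one]

theorem prod_factorial_add_single (m : ℕ+ ⊕ ℕ+ →₀ ℕ) (i : ℕ+ ⊕ ℕ+) :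
    (m + Finsupp.single i 1).prod (fun _ k => (k.factorial : ℂ)) =
      (m i + 1) * m.prod (fun _ k => (k.factorial : ℂ)) := by
  classical
  have h0 : ∀ j ∈ insert i m.support, j ∉ m.support → ((m j).factorial : ℂ) = 1 := by
    intro j _ hj; simp [Finsupp.notMem_support_iff.1 hj]
  have h1 : (m + Finsupp.single i 1).support ⊆ insert i m.support := by
    refine Finsupp.support_add.trans ?_
    rw [Finset.union_comm]
    exact Finset.union_subset_union Finsupp.support_single_subset le_rfl
  rw [Finsupp.prod_of_support_subset _ h1 _ (by simp),
    Finsupp.prod_of_support_subset m (Finset.subset_insert i m.support) _ (by simp),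
    ← Finset.mul_prod_erase _ _ (Finset.mem_insert_self i _),
    ← Finset.mul_prod_erase _ (fun j => ((m j).factorial : ℂ)) (Finset.mem_insert_self i _)]
  have h2 : ∀ j ∈ (insert i m.support).erase i,
      (((m + Finsupp.single i 1 : ℕ+ ⊕ ℕ+ →₀ ℕ) j).factorial : ℂ) = ((m j).factorial : ℂ) := by
    intro j hj
    rw [Finsupp.add_apply, Finsupp.single_eq_of_ne (Finset.ne_of_mem_erase hj), add_zero]
  rw [Finset.prod_congr rfl h2]
  simp [Nat.factorial_succ]
  ring

theorem bracket_mul_X (u v : Fock) (i : ℕ+ ⊕ ℕ+) : bracket (u * X i) v = bracket u (pderiv i v) := by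
  induction u using MvPolynomial.induction_on' with
  | monomial m c =>
    rw [X, monomial_mul, mul_one, bracket_monomial, bracket_monomial, coeff_pderiv,
      prod_factorial_add_single]
    ring
  | add p q hp hq => rw [add_mul, bracket_add_left, bracket_add_left, hp, hq]

/-- The generating function of the creation parts of normal ordered exponentials. -/
def expVec (β : ℕ+ → ℂ) (n : ℕ) : A := PowerSeries.coeff n (pexp fun k => C (β k) * X k)

theorem linSeries_single {R : Type*} [CommRing R] [Algebra ℂ R] (k : ℕ+) (r : R) :
    linSeries (fun j => if j = k then r else 0) = PowerSeries.C r * PowerSeries.X ^ (k : ℕ) := by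
  ext n
  rw [PowerSeries.coeff_C_mul, PowerSeries.coeff_X_pow, linSeries]
  cases n with
  | zero => simp [k.ne_zero.symm]
  | succ n =>
    rw [PowerSeries.coeff_succ_X_mul, PowerSeries.coeff_mk]
    by_cases hn : n.succPNat = k
    · rw [if_pos hn, if_pos (by rw [← hn]; rfl), mul_one]
    · rw [if_neg hn, if_neg fun e : n + 1 = (k : ℕ) => hn (PNat.eq e), mul_zero]

/-- The exponential `exp ∑ β_k α_{-k} s^k` is a joint eigenvector of the derivations, with
eigenvalue `β_k s^k` for `∂/∂α_{-k}` and `0` for `∂/∂d⁺_{-k}`. Since `bracket u` applies `u(∂)` and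
takes the constant term, it evaluates `u` at these eigenvalues. -/
theorem bracket_expVec (u : Fock) (β : ℕ+ → ℂ) (n : ℕ) :
    bracket u (physical (expVec β n)) = PowerSeries.coeff n
      (aeval (R := ℂ) (Sum.elim (fun k : ℕ+ => PowerSeries.C (β k) * PowerSeries.X ^ (k : ℕ))
        (fun _ => (0 : PowerSeries ℂ))) u) := by
  set G : PowerSeries Fock := pexp fun k => C (β k) * X (Sum.inl k) with hG
  have hph : ∀ n, physical (expVec β n) = PowerSeries.coeff n G := by
    intro n
    rw [expVec, map_coeff_pexp]
    simp [physical, hG]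
  induction u using MvPolynomial.induction_on generalizing n with
  | C c =>
    have h0 : ∀ n, (PowerSeries.coeff n G).coeff 0 = if n = 0 then 1 else 0 := by
      intro n
      have := map_coeff_pexp (aeval (R := ℂ) (fun _ : ℕ+ ⊕ ℕ+ => (0 : ℂ)))
        (fun k => C (β k) * X (Sum.inl k)) n
      rw [aeval_zero', ← hG] at this
      simp only [map_mul, aeval_X, mul_zero] at this
      have e : pexp (fun _ : ℕ+ => (0 : ℂ)) = 1 := pexp_zero
      rw [e, PowerSeries.coeff_one] at this
      rw [← constantCoeff_eq]
      simpa using this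
    rw [bracket_C, hph, h0, aeval_C, PowerSeries.algebraMap_apply, PowerSeries.coeff_C]
    simp
  | add p q hp hq => rw [bracket_add_left, hp, hq, map_add, map_add]
  | mul_X p i hp =>
    rw [bracket_mul_X, hph, derivation_coeff_pexp]
    rcases i with k | k
    · have e : (fun j : ℕ+ => pderiv (Sum.inl k) (C (β j) * X (Sum.inl j) : Fock)) =
          fun j => if j = k then C (β k) else 0 := by
        ext1 j
        rw [pderiv_C_mul, pderiv_X]
        by_cases h : j = k
        · subst h; simp
        · simp [h]
      rw [map_mul (aeval _), aeval_X, Sum.elim_inl, e, linSeries_single, mul_assoc,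
        PowerSeries.coeff_C_mul, mul_comm (PowerSeries.C (β k)), ← mul_assoc, PowerSeries.coeff_mul_C,
        PowerSeries.coeff_X_pow_mul', PowerSeries.coeff_mul_X_pow']
      split_ifs with h
      · rw [← hp, hph, C_mul', bracket_smul_right, mul_comm]
      · simp [bracket_zero_right]
    · have e : (fun j : ℕ+ => pderiv (Sum.inr k) (C (β j) * X (Sum.inl j) : Fock)) = 0 := by
        ext1 j
        rw [pderiv_C_mul, pderiv_X]
        simp
      have e0 : linSeries (0 : ℕ+ → Fock) = 0 := by
        have : (fun i : ℕ => (0 : ℕ+ → Fock) i.succPNat) = 0 := rfl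
        rw [linSeries, this, show PowerSeries.mk (0 : ℕ → Fock) = 0 from rfl, mul_zero]
      rw [map_mul (aeval _), aeval_X, Sum.elim_inr, mul_zero, map_zero, e, e0, zero_mul, map_zero,
        bracket_zero_right]

/-! ### Matrix elements between physical vectors -/

theorem actLeft_physical (b : ℝ) (E : NormalExp) (h : A) :
    E.actLeft b (physical h) =
      physical (aeval (R := ℂ) (fun k => (X k + C (modeComm b k (E.1 k) alpha) : A)) h) := by
  have : ((E.actLeft b).comp physical) =
      physical.comp (aeval (R := ℂ) (fun k => (X k + C (modeComm b k (E.1 k) alpha) : A))) := by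
    apply algHom_ext
    intro k
    simp [NormalExp.actLeft, physical]
  exact DFunLike.congr_fun this h

/-- On an exponential vector the annihilation part of `E` produces a scalar factor. Each `α_k` of
the left vector becomes its shift by the creation part of `E` plus its eigenvalue `β_k [α_k, α_{-k}]
s^k`. -/
theorem matrixElement_expVec (b : ℝ) (E : NormalExp) (h : A) (β : ℕ+ → ℂ) (n : ℕ) :
    E.matrixElement b (physical h) (physical (expVec β n)) = PowerSeries.coeff n
      (pexp (fun k => β k * modeComm b k (E.1 k) alpha) *
        aeval (R := ℂ) (fun k : ℕ+ => (PowerSeries.C (modeComm b k alpha (E.2 k)) +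
          PowerSeries.C (β k * commAlpha b k) * PowerSeries.X ^ (k : ℕ) : PowerSeries ℂ)) h) := by
  rw [NormalExp.matrixElement, pairing, actLeft_physical]
  have h1 : aeval (R := ℂ) (fun k => (X k + C (modeComm b k (E.1 k) alpha) : A)) (expVec β n) =
      ∑ q ∈ Finset.HasAntidiagonal.antidiagonal n, PowerSeries.coeff q.1
        (pexp fun k => β k * modeComm b k (E.1 k) alpha) • expVec β q.2 := by
    rw [expVec, map_coeff_pexp]
    have e : (fun k => aeval (R := ℂ) (fun k => (X k + C (modeComm b k (E.1 k) alpha) : A))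
        (C (β k) * X k)) = (fun k => C (β k * modeComm b k (E.1 k) alpha)) +
        fun k => C (β k) * X k := by
      ext1 k
      simp [mul_add, add_comm]
    rw [e, pexp_add, PowerSeries.coeff_mul]
    refine Finset.sum_congr rfl fun q _ => ?_
    have := map_coeff_pexp (Algebra.ofId ℂ A) (fun k => β k * modeComm b k (E.1 k) alpha) q.1
    rw [expVec, ← C_mul']
    congr 1
    exact this.symm
  rw [h1, map_sum, bracket_sum_right, PowerSeries.coeff_mul]
  refine Finset.sum_congr rfl fun q _ => ?_
  rw [map_smul, bracket_smul_right, bracket_expVec]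
  congr 2
  have h2 : (((aeval (R := ℂ) (Sum.elim (fun k : ℕ+ =>
      PowerSeries.C (β k) * PowerSeries.X ^ (k : ℕ)) (fun _ => (0 : PowerSeries ℂ)))).comp
      (symbol b)).comp (E.actRight b)).comp physical =
      aeval (R := ℂ) (fun k : ℕ+ => (PowerSeries.C (modeComm b k alpha (E.2 k)) +
          PowerSeries.C (β k * commAlpha b k) * PowerSeries.X ^ (k : ℕ) : PowerSeries ℂ)) := by
    apply algHom_ext
    intro k
    have e : modeComm b k alpha alpha = commAlpha b k := by simp [modeComm, alpha]
    simp [NormalExp.actRight, symbol, physical, e]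
    ring
  exact DFunLike.congr_fun h2 h

theorem matrixElement_one_right (b : ℝ) (E : NormalExp) (h : A) :
    E.matrixElement b (physical h) (physical 1) =
      eval (fun k => modeComm b k alpha (E.2 k)) h := by
  have e : expVec 0 0 = 1 := by rw [expVec, coeff_zero_pexp]
  rw [← e, matrixElement_expVec]
  have : (fun k => (0 : ℕ+ → ℂ) k * modeComm b k (E.1 k) alpha) = 0 := by ext1 k; simp
  rw [this, pexp_zero, one_mul, PowerSeries.coeff_zero_eq_constantCoeff_apply]
  have h2 : (PowerSeries.constantCoeff (R := ℂ)).comp (aeval (R := ℂ) (fun k : ℕ+ =>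
      (PowerSeries.C (modeComm b k alpha (E.2 k)) +
        PowerSeries.C ((0 : ℕ+ → ℂ) k * commAlpha b k) * PowerSeries.X ^ (k : ℕ) :
        PowerSeries ℂ))).toRingHom = eval (fun k => modeComm b k alpha (E.2 k)) := by
    apply ringHom_ext
    · intro c
      simp
    · intro k
      simp
  exact DFunLike.congr_fun h2 h

theorem matrixElement_one_left (b : ℝ) (E : NormalExp) (h : A) :
    E.matrixElement b (physical 1) (physical h) =
      eval (fun k => modeComm b k (E.1 k) alpha) h := by
  rw [NormalExp.matrixElement, pairing, actLeft_physical, map_one, map_one, map_one, ← C_1,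
    bracket_C, one_mul, ← constantCoeff_eq]
  have h2 : ((constantCoeff (R := ℂ) (σ := ℕ+ ⊕ ℕ+)).comp physical.toRingHom).comp
      (aeval (R := ℂ) (fun k => (X k + C (modeComm b k (E.1 k) alpha) : A))).toRingHom =
      eval (fun k => modeComm b k (E.1 k) alpha) := by
    apply ringHom_ext
    · intro c
      simp [physical]
    · intro k
      simp [physical]
  exact DFunLike.congr_fun h2 h

/-! ### Charges of the exponentials with respect to the physical modes -/

/-- The shift of `α_n` by `λ^σ(1)`. -/
def chargeR (n : ℕ+) : SignType → ℂ
  | .pos => 1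
  | .neg => -(omega ^ (n : ℕ)) ^ 3
  | .zero => (omega ^ (n : ℕ)) ^ 5 - (omega ^ (n : ℕ)) ^ 4

/-- The shift of `α_{-n}` by `λ^σ(1)`. -/
def chargeL (n : ℕ+) : SignType → ℂ
  | .pos => -(omega ^ (n : ℕ)) ^ 3
  | .neg => 1
  | .zero => (omega ^ (n : ℕ)) ^ 5 - (omega ^ (n : ℕ)) ^ 4

theorem neg_one_pow_eq (n : ℕ) : (-1 : ℂ) ^ n = (omega ^ n) ^ 3 := by
  rw [← omega_cube, ← pow_mul, ← pow_mul, mul_comm]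

/-- For `λ⁻` the product `A⁺_n [α_n, α_{-n}] = -n(1 + (-1)^n)` removes all dependence on `b`, and
`λ⁰` follows by adding its two constituents. The charges are thus polynomials in `ω^n`. -/
theorem modeComm_alpha_lam (b : ℝ) (hY : ∀ n, Y b n ≠ 0) (n : ℕ+) (s : SignType) (z : ℂ) :
    modeComm b n alpha ((lam b s z).2 n) = chargeR n s * z ^ (n : ℕ) := by
  have h := aPlus_mul_commAlpha b n (hY n)
  have hn : (n : ℂ) ≠ 0 := by exact_mod_cast n.ne_zero
  have h6 := omega_pow_pow_six n
  have key : ∀ w : ℂ, modeComm b n alpha ((lamPlus w).2 n) = w ^ (n : ℕ) := by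
    intro w
    simp [modeComm, alpha, lamPlus, dPlus]
    field_simp
  have key' : ∀ w : ℂ, modeComm b n alpha ((lamMinus b w).2 n) =
      -(omega ^ (n : ℕ)) ^ 3 * w ^ (n : ℕ) := by
    intro w
    simp only [modeComm, alpha, lamMinus, dMinus, dPlus, Prod.smul_fst, Prod.smul_snd,
      Prod.fst_sub, Prod.snd_sub, smul_eq_mul]
    rw [← neg_one_pow_eq]
    field_simp
    linear_combination w ^ (n : ℕ) * h
  cases s
  · have : modeComm b n alpha ((lam b .zero z).2 n) =
        modeComm b n alpha ((lamPlus (z * omega⁻¹)).2 n) +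
        modeComm b n alpha ((lamMinus b (z * omega)).2 n) := by
      simp [modeComm, alpha, lam]; ring
    have e5 : (omega ^ 5) ^ (n : ℕ) = (omega ^ (n : ℕ)) ^ 5 := by rw [← pow_mul, ← pow_mul, mul_comm]
    rw [this, key, key', chargeR, mul_pow, mul_pow, omega_inv, e5]
    ring
  · exact key' z
  · rw [chargeR, one_mul]
    exact key z

theorem modeComm_lam_alpha (b : ℝ) (hY : ∀ n, Y b n ≠ 0) (n : ℕ+) (s : SignType) (z : ℂ) :
    modeComm b n ((lam b s z).1 n) alpha = chargeL n s * z⁻¹ ^ (n : ℕ) := by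
  have h := aPlus_mul_commAlpha b n (hY n)
  have hn : (n : ℂ) ≠ 0 := by exact_mod_cast n.ne_zero
  have h6 := omega_pow_pow_six n
  have hs : ((omega ^ (n : ℕ)) ^ 3) ^ 2 = 1 := by rw [← h6]; ring
  have key : ∀ w : ℂ, modeComm b n ((lamPlus w).1 n) alpha =
      -(omega ^ (n : ℕ)) ^ 3 * w⁻¹ ^ (n : ℕ) := by
    intro w
    rw [← neg_one_pow_eq]
    simp only [modeComm, alpha, lamPlus, dPlus, Prod.smul_fst, Prod.smul_snd, smul_eq_mul]
    field_simp
    ring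
  have key' : ∀ w : ℂ, modeComm b n ((lamMinus b w).1 n) alpha = w⁻¹ ^ (n : ℕ) := by
    intro w
    simp only [modeComm, alpha, lamMinus, dMinus, dPlus, Prod.smul_fst, Prod.smul_snd,
      Prod.fst_sub, Prod.snd_sub, smul_eq_mul]
    generalize w⁻¹ ^ (n : ℕ) = v
    field_simp
    linear_combination -v * h
  cases s
  · have : modeComm b n ((lam b .zero z).1 n) alpha =
        modeComm b n ((lamPlus (z * omega⁻¹)).1 n) alpha +
        modeComm b n ((lamMinus b (z * omega)).1 n) alpha := by
      simp [modeComm, alpha, lam]; ring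
    have e5 : (omega ^ 5) ^ (n : ℕ) = (omega ^ (n : ℕ)) ^ 5 := by rw [← pow_mul, ← pow_mul, mul_comm]
    rw [this, key, key', chargeL, mul_inv, mul_inv, inv_inv, mul_pow, mul_pow, omega_inv, e5]
    ring
  · rw [chargeL, one_mul]
    exact key' z
  · exact key z

/-- The total shift of `α_n`. -/
def powR {N : ℕ} (σ : Fin N → SignType) (x : Fin N → ℂ) (n : ℕ+) : ℂ :=
  ∑ i, chargeR n (σ i) * x i ^ (n : ℕ)

/-- The total shift of `α_{-n}`. -/
def powL {N : ℕ} (σ : Fin N → SignType) (x : Fin N → ℂ) (n : ℕ+) : ℂ :=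
  ∑ i, chargeL n (σ i) * (x i)⁻¹ ^ (n : ℕ)

theorem modeComm_alpha_sum (b : ℝ) (hY : ∀ n, Y b n ≠ 0) (n : ℕ+) {N : ℕ}
    (σ : Fin N → SignType) (x : Fin N → ℂ) :
    modeComm b n alpha ((∑ i, lam b (σ i) (x i)).2 n) = powR σ x n := by
  simp only [powR, ← modeComm_alpha_lam b hY]
  simp [modeComm, alpha, Prod.snd_sum, Prod.fst_sum, Finset.sum_apply, Finset.sum_sub_distrib,
    Finset.sum_mul, Finset.mul_sum]

theorem modeComm_sum_alpha (b : ℝ) (hY : ∀ n, Y b n ≠ 0) (n : ℕ+) {N : ℕ}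
    (σ : Fin N → SignType) (x : Fin N → ℂ) :
    modeComm b n ((∑ i, lam b (σ i) (x i)).1 n) alpha = powL σ x n := by
  simp only [powL, ← modeComm_lam_alpha b hY]
  simp [modeComm, alpha, Prod.snd_sum, Prod.fst_sum, Finset.sum_apply, Finset.sum_sub_distrib,
    Finset.sum_mul, Finset.mul_sum]

/-- The matrix element as a function of `u = e^{iπp}`. -/
def mel (b : ℝ) (u : ℂ) {N : ℕ} (x : Fin N → ℂ) (h h' : A) : ℂ :=
  ∑ σ : Fin N → SignType, (∏ i, wt b u (σ i)) * pairProd b σ x *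
    NormalExp.matrixElement b (∑ i, lam b (σ i) (x i)) (physical h) (physical h')

theorem Jtilde_eq_mel (b : ℝ) {N : ℕ} (a : ℂ) (x : Fin N → ℂ) (h h' : A) :
    Jtilde b a x h h' = mel b (Complex.exp (Complex.I * Real.pi * p b a)) x h h' := by
  simp only [Jtilde, mel, weight_eq_wt, pairProd]

theorem mel_one_right (b : ℝ) (hY : ∀ n, Y b n ≠ 0) (u : ℂ) {N : ℕ} (x : Fin N → ℂ) (h : A) :
    mel b u x h 1 =
      ∑ σ : Fin N → SignType, (∏ i, wt b u (σ i)) * pairProd b σ x * eval (powR σ x) h := by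
  simp only [mel, matrixElement_one_right, modeComm_alpha_sum b hY]

theorem mel_one_left (b : ℝ) (hY : ∀ n, Y b n ≠ 0) (u : ℂ) {N : ℕ} (x : Fin N → ℂ) (h : A) :
    mel b u x 1 h =
      ∑ σ : Fin N → SignType, (∏ i, wt b u (σ i)) * pairProd b σ x * eval (powL σ x) h := by
  simp only [mel, matrixElement_one_left, modeComm_sum_alpha b hY]

theorem mel_one_one (b : ℝ) (hY : ∀ n, Y b n ≠ 0) (u : ℂ) {N : ℕ} (x : Fin N → ℂ) :
    mel b u x 1 1 = vac b u x := by
  simp [mel_one_right b hY, vac]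

theorem mel_expVec (b : ℝ) (hY : ∀ n, Y b n ≠ 0) (u : ℂ) {N : ℕ} (x : Fin N → ℂ) (h : A)
    (β : ℕ+ → ℂ) (n : ℕ) :
    mel b u x h (expVec β n) =
      ∑ σ : Fin N → SignType, (∏ i, wt b u (σ i)) * pairProd b σ x * PowerSeries.coeff n
        (pexp (fun k => β k * powL σ x k) *
          aeval (R := ℂ) (fun k : ℕ+ => (PowerSeries.C (powR σ x k) +
            PowerSeries.C (β k * commAlpha b k) * PowerSeries.X ^ (k : ℕ) : PowerSeries ℂ)) h) := by
  simp only [mel, matrixElement_expVec, modeComm_sum_alpha b hY, modeComm_alpha_sum b hY]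

theorem mel_add_right (b : ℝ) (u : ℂ) {N : ℕ} (x : Fin N → ℂ) (h h₁ h₂ : A) :
    mel b u x h (h₁ + h₂) = mel b u x h h₁ + mel b u x h h₂ := by
  simp only [mel, NormalExp.matrixElement, pairing, map_add, bracket_add_right, mul_add,
    Finset.sum_add_distrib]

theorem mel_smul_right (b : ℝ) (u : ℂ) {N : ℕ} (x : Fin N → ℂ) (h h₁ : A) (c : ℂ) :
    mel b u x h (c • h₁) = c * mel b u x h h₁ := by
  simp only [mel, NormalExp.matrixElement, pairing, map_smul, bracket_smul_right, Finset.mul_sum]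
  exact Finset.sum_congr rfl fun σ _ => by ring

/-- The matrix elements as linear functions of the right descendant. -/
def melRight (b : ℝ) (u : ℂ) {N : ℕ} (x : Fin N → ℂ) (h : A) : A →ₗ[ℂ] ℂ where
  toFun := mel b u x h
  map_add' := mel_add_right b u x h
  map_smul' c h₁ := mel_smul_right b u x h h₁ c

/-! ### Inversion of the arguments -/

theorem wt_neg (b : ℝ) (u : ℂ) (s : SignType) : wt b u⁻¹ s = wt b u (-s) := by
  cases s <;> simp [wt]

theorem ratioContraction_inv (b : ℝ) (s t : SignType) {r : ℂ} (hr : r ≠ 0) :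
    ratioContraction b (-s) (-t) r⁻¹ = ratioContraction b s t r := by
  have e1 : f b (omega * r⁻¹) = f b (omega ^ 5 * r) := f_congr b (by
    field_simp; exact omega_pow_six)
  have e2 : f b (omega ^ 2 * r⁻¹) = f b (omega ^ 4 * r) := f_congr b (by
    field_simp; exact omega_pow_six)
  have e4 : f b (omega ^ 4 * r⁻¹) = f b (omega ^ 2 * r) := f_congr b (by
    field_simp; exact omega_pow_six)
  have e5 : f b (omega ^ 5 * r⁻¹) = f b (omega * r) := f_congr b (by
    field_simp; exact omega_pow_six)
  cases s <;> cases t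
  · exact f_inv b r
  · exact e1
  · exact e5
  · exact e5
  · rfl
  · exact congrArg₂ (· * ·) e5 e4
  · exact e1
  · exact congrArg₂ (· * ·) e1 e2
  · rfl

theorem contraction_inv (b : ℝ) (s t : SignType) {x y : ℂ} (hx : x ≠ 0) (hy : y ≠ 0) :
    contraction b (-s) (-t) x⁻¹ y⁻¹ = contraction b s t x y := by
  rw [contraction_eq b _ _ (inv_ne_zero hx) (inv_ne_zero hy), contraction_eq b s t hx hy,
    inv_div_inv, ← inv_div, ratioContraction_inv b s t (div_ne_zero hy hx)]

theorem chargeL_neg (n : ℕ+) (s : SignType) : chargeL n (-s) = chargeR n s := by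
  cases s <;> rfl

/-- Inversion of the arguments exchanges the two chiralities. -/
theorem mel_inversion (b : ℝ) (hY : ∀ n, Y b n ≠ 0) (u : ℂ) {N : ℕ} {x : Fin N → ℂ}
    (hx : ∀ i, x i ≠ 0) (h : A) :
    mel b u x h 1 = mel b u⁻¹ (fun i => (x i)⁻¹) 1 h := by
  rw [mel_one_right b hY, mel_one_left b hY]
  -- Negating all signs exchanges the weights `u` and `u⁻¹` and the charges of `α_n` and `α_{-n}`.
  -- Contractions are invariant when the arguments are inverted at the same time.
  refine Fintype.sum_equiv (Equiv.neg (Fin N → SignType)) _ _ fun σ => ?_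
  simp only [Equiv.neg_apply, Pi.neg_apply, wt_neg, neg_neg]
  congr 1
  · congr 1
    exact Finset.prod_congr rfl fun i _ => Finset.prod_congr rfl fun j _ =>
      (contraction_inv b _ _ (hx i) (hx j)).symm
  · congr 2
    ext1 n
    simp only [powR, powL, Pi.neg_apply, chargeL_neg, inv_inv]

/-! ### Contractions as exponentials -/

/-- The coefficients of `log f`: `f(x) = exp (∑ logf_k x^k)`. -/
def logf (b : ℝ) (k : ℕ+) : ℂ := -2 * Y b k / k

/-- The coefficients of the logarithm of the contraction in units of those of `log f`. -/
def pairCharge (k : ℕ+) : SignType → SignType → ℂ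
  | .pos, .pos => 0
  | .neg, .neg => 0
  | .pos, .neg => (omega ^ (k : ℕ)) ^ 5 + (omega ^ (k : ℕ)) ^ 4
  | .neg, .pos => omega ^ (k : ℕ) + (omega ^ (k : ℕ)) ^ 2
  | .pos, .zero => (omega ^ (k : ℕ)) ^ 5
  | .zero, .pos => omega ^ (k : ℕ)
  | .neg, .zero => omega ^ (k : ℕ)
  | .zero, .neg => (omega ^ (k : ℕ)) ^ 5
  | .zero, .zero => 1

theorem exp_pow_add (n : ℕ) (θ : ℝ) :
    Complex.exp (θ * Complex.I) ^ n + Complex.exp (-(θ * Complex.I)) ^ n =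
      2 * Real.cos (θ * n) := by
  rw [← Complex.exp_nat_mul, ← Complex.exp_nat_mul, Complex.ofReal_cos, Complex.two_cos]
  congr 2 <;> push_cast <;> ring

theorem omega_eq_exp : omega = Complex.exp ((Real.pi / 3 : ℝ) * Complex.I) := by
  rw [omega]; congr 1; push_cast; ring

theorem omega_five_eq_exp : omega ^ 5 = Complex.exp (-((Real.pi / 3 : ℝ) * Complex.I)) := by
  rw [Complex.exp_neg, ← omega_eq_exp, omega_inv]

theorem two_cos_eq (n : ℕ) :
    2 * (Real.cos (Real.pi * n / 3) : ℂ) = omega ^ n + (omega ^ n) ^ 5 := by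
  have := exp_pow_add n (Real.pi / 3)
  rw [← omega_eq_exp, ← omega_five_eq_exp, ← pow_mul, mul_comm 5, pow_mul] at this
  rw [this]
  congr 3
  ring

theorem kappa_eq (b : ℝ) : kappa b = 2 * Real.cos (Real.pi * (b - b⁻¹) / (3 * Q b)) := by
  have h : Real.pi * (b - b⁻¹) / (3 * Q b) = 2 * (Real.pi * (b - b⁻¹) / (6 * Q b)) := by
    ring
  rw [kappa, hConst, h, Real.cos_two_mul']
  have := Real.sin_sq_add_cos_sq (Real.pi * (b - b⁻¹) / (6 * Q b))
  have h' : (2 - (2 * Real.sin (Real.pi * (b - b⁻¹) / (6 * Q b))) ^ 2 : ℝ) =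
      2 * (Real.cos (Real.pi * (b - b⁻¹) / (6 * Q b)) ^ 2 -
        Real.sin (Real.pi * (b - b⁻¹) / (6 * Q b)) ^ 2) := by
    linarith
  exact_mod_cast h'

theorem pexp_ne_zero (ℓ : ℕ+ → ℂ) : pexp ℓ ≠ 0 := by
  intro h
  have := coeff_zero_pexp ℓ
  rw [h, map_zero] at this
  exact zero_ne_one this

-- With `κ = 2 cos θ`, the numerator of `f` factors into `1 - e^{±iθ}t` and its denominator into `1
-- - ω^{±1}t`. The logarithms of these linear factors add up to the coefficients `-2Y_k/k`.
open PowerSeries in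
theorem fNum_series (b : ℝ) {x : ℂ} (hx : x ≠ 0) (a : ℂ) :
    fNum b (PowerSeries.C x) (PowerSeries.C (x * a) * PowerSeries.X) =
      (PowerSeries.C x ^ 6 - (PowerSeries.C (x * a) * PowerSeries.X) ^ 6) *
        pexp fun k => logf b k * a ^ (k : ℕ) := by
  set θ : ℝ := Real.pi * (b - b⁻¹) / (3 * Q b) with hθ
  set v := Complex.exp (θ * Complex.I) with hv
  set v' := Complex.exp (-(θ * Complex.I)) with hv'
  have hvv : v * v' = 1 := by rw [hv, hv', ← Complex.exp_add]; simp
  have hk : kappa b = v + v' := by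
    rw [kappa_eq, ← hθ]
    have := exp_pow_add 1 θ
    simpa using this.symm
  set z : PowerSeries ℂ := PowerSeries.C (x * a) * PowerSeries.X with hz
  have hz' : z = PowerSeries.C x * (PowerSeries.C a * PowerSeries.X) := by
    rw [hz, map_mul, mul_assoc]
  have hquad : quad b (PowerSeries.C x) z = PowerSeries.C x ^ 2 *
      ((1 - PowerSeries.C (v * a) * PowerSeries.X) *
        (1 - PowerSeries.C (v' * a) * PowerSeries.X)) := by
    have h1 : (PowerSeries.C v * PowerSeries.C v' : PowerSeries ℂ) = 1 := by
      rw [← map_mul, hvv, map_one]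
    rw [quad, hk, hz', PowerSeries.smul_eq_C_mul, map_mul, map_mul, map_add]
    linear_combination (-(PowerSeries.C x ^ 2 * (PowerSeries.C a * PowerSeries.X) ^ 2)) * h1
  have hden : PowerSeries.C x ^ 2 - PowerSeries.C x * z + z ^ 2 = PowerSeries.C x ^ 2 *
      ((1 - PowerSeries.C (omega * a) * PowerSeries.X) *
        (1 - PowerSeries.C (omega ^ 5 * a) * PowerSeries.X)) := by
    have h1 : (PowerSeries.C omega * PowerSeries.C (omega ^ 5) : PowerSeries ℂ) = 1 := by
      rw [← map_mul, ← pow_succ', omega_pow_six, map_one]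
    have h2 : (PowerSeries.C omega + PowerSeries.C (omega ^ 5) : PowerSeries ℂ) = 1 := by
      rw [← map_add, omega_pow_five, add_sub_cancel, map_one]
    rw [hz', map_mul, map_mul]
    linear_combination (-(PowerSeries.C x ^ 2 * (PowerSeries.C a * PowerSeries.X) ^ 2)) * h1 +
      PowerSeries.C x ^ 2 * (PowerSeries.C a * PowerSeries.X) * h2
  have hlog : (fun k : ℕ+ => -((k : ℂ)⁻¹ • (v * a) ^ (k : ℕ))) +
      (fun k : ℕ+ => -((k : ℂ)⁻¹ • (v' * a) ^ (k : ℕ))) =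
      ((fun k : ℕ+ => -((k : ℂ)⁻¹ • (omega * a) ^ (k : ℕ))) +
      fun k : ℕ+ => -((k : ℂ)⁻¹ • (omega ^ 5 * a) ^ (k : ℕ))) +
      fun k => logf b k * a ^ (k : ℕ) := by
    ext1 k
    have h1 := exp_pow_add k θ
    have h2 := two_cos_eq k
    rw [← hv, ← hv'] at h1
    have h3 : Real.cos (θ * k) = Real.cos (Real.pi * (b - b⁻¹) * k / (3 * Q b)) := by
      congr 1; rw [hθ]; ring
    rw [h3] at h1
    have h5 : (omega ^ 5) ^ (k : ℕ) = (omega ^ (k : ℕ)) ^ 5 := by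
      rw [← pow_mul, ← pow_mul, mul_comm]
    simp only [Pi.add_apply, smul_eq_mul, mul_pow, logf, Y, Complex.ofReal_sub, h5]
    linear_combination (-(k : ℂ)⁻¹ * a ^ (k : ℕ)) * h1 - ((k : ℂ)⁻¹ * a ^ (k : ℕ)) * h2
  have hx0 : (PowerSeries.C x : PowerSeries ℂ) ≠ 0 := by
    rw [Ne, map_eq_zero_iff _ PowerSeries.C_injective]; exact hx
  have hd0 : PowerSeries.C x ^ 2 - PowerSeries.C x * z + z ^ 2 ≠ 0 := by
    rw [hden, one_sub_eq_pexp, one_sub_eq_pexp]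
    exact mul_ne_zero (pow_ne_zero _ hx0) (mul_ne_zero (pexp_ne_zero _) (pexp_ne_zero _))
  apply mul_right_cancel₀ hd0
  have h1 : fNum b (PowerSeries.C x) z * (PowerSeries.C x ^ 2 - PowerSeries.C x * z + z ^ 2) =
      quad b (PowerSeries.C x) z * (PowerSeries.C x ^ 6 - z ^ 6) := by
    rw [fNum]; ring
  rw [h1, hden, hquad, one_sub_eq_pexp, one_sub_eq_pexp, one_sub_eq_pexp, one_sub_eq_pexp,
    ← pexp_add, ← pexp_add, hlog, pexp_add]
  ring

theorem cNum_pos_neg_mul (b : ℝ) {R : Type*} [CommRing R] [Algebra ℂ R] (x y : R) :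
    cNum b .pos .neg x y * (x ^ 6 - y ^ 6) =
      fNum b x (omega ^ 5 • y) * fNum b x (omega ^ 4 • y) := by
  set w := algebraMap ℂ R omega with hw
  have h2 : w ^ 2 = w - 1 := by rw [hw, ← map_pow, omega_sq]; simp
  simp only [cNum, fNum, Algebra.smul_def, map_pow, ← hw]
  generalize quad b x (w ^ 5 * y) = q1
  generalize quad b x (w ^ 4 * y) = q2
  grind

theorem cNum_neg_pos_mul (b : ℝ) {R : Type*} [CommRing R] [Algebra ℂ R] (x y : R) :
    cNum b .neg .pos x y * (x ^ 6 - y ^ 6) =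
      fNum b x (omega • y) * fNum b x (omega ^ 2 • y) := by
  set w := algebraMap ℂ R omega with hw
  have h2 : w ^ 2 = w - 1 := by rw [hw, ← map_pow, omega_sq]; simp
  simp only [cNum, fNum, Algebra.smul_def, map_pow, ← hw]
  generalize quad b x (w * y) = q1
  generalize quad b x (w ^ 2 * y) = q2
  grind

theorem cNum_series (b : ℝ) {x : ℂ} (hx : x ≠ 0) (c : ℂ) (s t : SignType) :
    cNum b s t (PowerSeries.C x) (PowerSeries.C c * PowerSeries.X) =
      (PowerSeries.C x ^ 6 - (PowerSeries.C c * PowerSeries.X) ^ 6) *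
        pexp fun k => logf b k * pairCharge k s t * (c / x) ^ (k : ℕ) := by
  have key : ∀ m : ℕ, fNum b (PowerSeries.C x) (omega ^ m • (PowerSeries.C c * PowerSeries.X)) =
      (PowerSeries.C x ^ 6 - (PowerSeries.C c * PowerSeries.X) ^ 6) *
        pexp fun k => logf b k * (omega ^ (k : ℕ)) ^ m * (c / x) ^ (k : ℕ) := by
    intro m
    have e1 : omega ^ m • (PowerSeries.C c * PowerSeries.X : PowerSeries ℂ) =
        PowerSeries.C (x * (omega ^ m * (c / x))) * PowerSeries.X := by
      rw [PowerSeries.smul_eq_C_mul, ← mul_assoc, ← map_mul]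
      congr 2
      field_simp
    have e2 : (PowerSeries.C (x * (omega ^ m * (c / x))) * PowerSeries.X : PowerSeries ℂ) ^ 6 =
        (PowerSeries.C c * PowerSeries.X) ^ 6 := by
      rw [← e1, smul_pow, omega_pow_pow_six, one_smul]
    rw [e1, fNum_series b hx, e2]
    congr 2
    ext1 k
    rw [mul_pow, ← pow_mul, mul_comm m, pow_mul, mul_assoc]
  have k0 := key 0
  have k1 := key 1
  simp only [pow_zero, one_smul, pow_one] at k0 k1
  have hne : (PowerSeries.C x ^ 6 - (PowerSeries.C c * PowerSeries.X) ^ 6 : PowerSeries ℂ) ≠ 0 := by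
    intro h
    have := congrArg PowerSeries.constantCoeff h
    simp [hx] at this
  have hp0 : (pexp fun _ : ℕ+ => (0 : ℂ)) = 1 := pexp_zero
  cases s <;> cases t <;> simp only [pairCharge, mul_zero, zero_mul, hp0, mul_one] at *
  · exact k0
  · exact key 5
  · exact k1
  · exact k1
  · rfl
  · apply mul_right_cancel₀ hne
    rw [cNum_neg_pos_mul, k1, key 2]
    have : (fun k : ℕ+ => logf b k * (omega ^ (k : ℕ) + (omega ^ (k : ℕ)) ^ 2) *
        (c / x) ^ (k : ℕ)) = (fun k : ℕ+ => logf b k * omega ^ (k : ℕ) * (c / x) ^ (k : ℕ)) +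
        fun k : ℕ+ => logf b k * (omega ^ (k : ℕ)) ^ 2 * (c / x) ^ (k : ℕ) := by
      ext1 k; simp only [Pi.add_apply]; ring
    rw [this, pexp_add]
    ring
  · exact key 5
  · apply mul_right_cancel₀ hne
    rw [cNum_pos_neg_mul, key 5, key 4]
    have : (fun k : ℕ+ => logf b k * ((omega ^ (k : ℕ)) ^ 5 + (omega ^ (k : ℕ)) ^ 4) *
        (c / x) ^ (k : ℕ)) = (fun k : ℕ+ => logf b k * (omega ^ (k : ℕ)) ^ 5 * (c / x) ^ (k : ℕ)) +
        fun k : ℕ+ => logf b k * (omega ^ (k : ℕ)) ^ 4 * (c / x) ^ (k : ℕ) := by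
      ext1 k; simp only [Pi.add_apply]; ring
    rw [this, pexp_add]
    ring
  · rfl

/-! ### Vectors obtained by acting with currents on the vacuum -/

/-- The factor `2 cos (πk/3) - 1`. -/
def dFac (k : ℕ+) : ℂ := omega ^ (k : ℕ) + (omega ^ (k : ℕ)) ^ 5 - 1

/-- The coefficient of `log f` in the creation part of an exponential, relative to `λ⁺`. -/
def relCharge (k : ℕ+) : SignType → ℂ
  | .pos => 0
  | .neg => omega ^ (k : ℕ) + (omega ^ (k : ℕ)) ^ 2
  | .zero => (omega ^ (k : ℕ)) ^ 2

/-- An identity in the sixth root of unity `ω^k`. Changing the sign of an added current from `+` to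
`t` alters its contractions by a multiple of `chargeL k s`, and a physical mode `α_{-k}` produces
exactly that. -/
theorem pairCharge_eq (k : ℕ+) (s t : SignType) :
    pairCharge k s t = pairCharge k s .pos - relCharge k t * chargeL k s := by
  have h6 := omega_pow_pow_six k
  generalize hE : omega ^ (k : ℕ) = E at h6
  cases s <;> cases t <;> simp only [pairCharge, relCharge, chargeL, hE] <;> grind

/-- When `dFac k ≠ 0`, the contraction with an added `λ⁺` splits into a physical part proportional
to `chargeL k s` and the constant `1 / dFac k`. The constant does not see the sign `s` and is
absorbed in `Word.gauge`. -/
theorem dFac_mul_pairCharge (k : ℕ+) (s : SignType) :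
    dFac k * pairCharge k s .pos = (omega ^ (k : ℕ)) ^ 3 * chargeL k s + 1 := by
  have h6 := omega_pow_pow_six k
  generalize hE : omega ^ (k : ℕ) = E at h6
  cases s <;> simp only [pairCharge, chargeL, dFac, hE] <;> grind

theorem chargeR_eq (k : ℕ+) (s : SignType) :
    chargeR k s = 1 - (omega ^ (k : ℕ)) ^ 3 * dFac k * relCharge k s := by
  have h6 := omega_pow_pow_six k
  generalize hE : omega ^ (k : ℕ) = E at h6
  cases s <;> simp only [chargeR, relCharge, dFac, hE] <;> grind

/-- The exceptional levels are `k ≡ ±1` mod `6`. There `α_{-k}` is shifted by the same amount for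
every sign, as by a conserved charge, so its coefficient in a vector can be chosen freely. -/
theorem chargeL_of_dFac_eq_zero {k : ℕ+} (h : dFac k = 0) (s : SignType) : chargeL k s = 1 := by
  have := dFac_mul_pairCharge k s
  have h6 := omega_pow_pow_six k
  simp only [dFac] at h
  generalize hE : omega ^ (k : ℕ) = E at h6 h
  cases s <;> simp only [chargeL, hE] <;> grind

theorem logf_mul_commAlpha (b : ℝ) (hY : ∀ n, Y b n ≠ 0) (k : ℕ+) :
    logf b k * commAlpha b k = (omega ^ (k : ℕ)) ^ 3 * dFac k := by
  have h1 : (Y b k : ℂ) ≠ 0 := by exact_mod_cast hY k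
  have h2 : (k : ℂ) ≠ 0 := by exact_mod_cast k.ne_zero
  rw [dFac, ← two_cos_eq, ← neg_one_pow_eq, logf, commAlpha]
  field_simp

/-- Data of a vector: the coefficient at level `n` of a product of currents at the points `c_j s`,
with a normalization and, at the exceptional levels, a free parameter `γ`. -/
structure Word where
  /-- The number of currents. -/
  L : ℕ
  /-- The arguments of the currents. -/
  c : Fin L → ℂ
  /-- The free parameters. -/
  γ : ℕ+ → ℂ
  /-- The level. -/
  n : ℕ
  /-- The arguments are in general position. -/
  regular : Regular c
  /-- The power sums vanish at the exceptional levels. -/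
  sum_eq_zero : ∀ k : ℕ+, (k : ℕ) ≤ n → dFac k = 0 → ∑ j, c j ^ (k : ℕ) = 0

namespace Word

/-- The power sums of the arguments. -/
def psum (w : Word) (k : ℕ+) : ℂ := ∑ j, w.c j ^ (k : ℕ)

/-- The exponents of the creation part. -/
def expo (b : ℝ) (w : Word) (τ : Fin w.L → SignType) (k : ℕ+) : ℂ :=
  logf b k * (w.psum k * (omega ^ (k : ℕ)) ^ 3 / dFac k - ∑ j, relCharge k (τ j) * w.c j ^ (k : ℕ)) +
    if dFac k = 0 then w.γ k else 0

/-- The exponents of the normalization. -/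
def gauge (b : ℝ) (w : Word) (k : ℕ+) : ℂ :=
  -(logf b k * w.psum k / dFac k) + if dFac k = 0 then w.γ k else 0

/-- The vector of a word. -/
def vec (b : ℝ) (u : ℂ) (w : Word) : A :=
  ∑ τ : Fin w.L → SignType, ((∏ j, wt b u (τ j)) * pairProd b τ w.c) • expVec (w.expo b τ) w.n

/-- Together with `expo_mul_commAlpha` this justifies the choice of `Word.expo`. The physical
exponential imitates the currents at `c_j s`, both in its contractions with other currents and in
its shifts of the `α_k`, up to a factor common to all signs. -/
theorem expo_mul_chargeL (b : ℝ) (w : Word) (τ : Fin w.L → SignType) {k : ℕ+} (hk : (k : ℕ) ≤ w.n)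
    (s : SignType) :
    w.expo b τ k * chargeL k s =
      logf b k * ∑ j, pairCharge k s (τ j) * w.c j ^ (k : ℕ) + w.gauge b k := by
  have h1 : ∑ j, pairCharge k s (τ j) * w.c j ^ (k : ℕ) = pairCharge k s .pos * w.psum k -
      chargeL k s * ∑ j, relCharge k (τ j) * w.c j ^ (k : ℕ) := by
    rw [psum, Finset.mul_sum, Finset.mul_sum, ← Finset.sum_sub_distrib]
    refine Finset.sum_congr rfl fun j _ => ?_
    rw [pairCharge_eq]
    ring
  rw [h1, expo, gauge]
  by_cases h : dFac k = 0
  · have h0 : w.psum k = 0 := w.sum_eq_zero k hk h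
    rw [chargeL_of_dFac_eq_zero h, h0, if_pos h]
    ring
  · have h2 := dFac_mul_pairCharge k s
    rw [if_neg h]
    field_simp
    linear_combination (-(logf b k * w.psum k)) * h2

/-- Away from the exceptional levels this follows from `logf_mul_commAlpha` and `chargeR_eq`. At
those levels `[α_k, α_{-k}] = 0`, and the right side vanishes because the power sum does. -/
theorem expo_mul_commAlpha (b : ℝ) (hY : ∀ n, Y b n ≠ 0) (w : Word) (τ : Fin w.L → SignType)
    {k : ℕ+} (hk : (k : ℕ) ≤ w.n) : w.expo b τ k * commAlpha b k = powR τ w.c k := by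
  have h1 : powR τ w.c k = w.psum k - (omega ^ (k : ℕ)) ^ 3 * dFac k *
      ∑ j, relCharge k (τ j) * w.c j ^ (k : ℕ) := by
    rw [psum, powR, Finset.mul_sum, ← Finset.sum_sub_distrib]
    refine Finset.sum_congr rfl fun j _ => ?_
    rw [chargeR_eq]
    ring
  have h2 := logf_mul_commAlpha b hY k
  rw [h1, expo]
  by_cases h : dFac k = 0
  · have h0 : w.psum k = 0 := w.sum_eq_zero k hk h
    have h3 : commAlpha b k = 0 := by
      have h4 : logf b k ≠ 0 := by
        have h1 : (Y b k : ℂ) ≠ 0 := by exact_mod_cast hY k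
        have h2 : (k : ℂ) ≠ 0 := by exact_mod_cast k.ne_zero
        exact div_ne_zero (mul_ne_zero (by norm_num) h1) h2
      rw [h, mul_zero] at h2
      exact (mul_eq_zero.1 h2).resolve_left h4
    rw [h0, h3, h]
    ring
  · have h6 := omega_pow_pow_six k
    have h7 : dFac k / dFac k = 1 := div_self h
    rw [if_neg h, add_zero]
    have : w.psum k * (omega ^ (k : ℕ)) ^ 3 / dFac k = w.psum k * (omega ^ (k : ℕ)) ^ 3 * (dFac k)⁻¹ := rfl
    rw [this]
    have h8 := mul_inv_cancel₀ h
    linear_combination (w.psum k * (omega ^ (k : ℕ)) ^ 3 * (dFac k)⁻¹ -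
      ∑ j, relCharge k (τ j) * w.c j ^ (k : ℕ)) * h2 +
      w.psum k * (omega ^ (k : ℕ)) ^ 6 * h8 + w.psum k * h6

end Word

/-! ### Equality of power series up to a given order -/

/-- The coefficients of two power series agree up to order `n`. -/
def EqUpTo (n : ℕ) (F G : PowerSeries ℂ) : Prop :=
  ∀ m ≤ n, PowerSeries.coeff m F = PowerSeries.coeff m G

theorem EqUpTo.mul {n : ℕ} {F F' G G' : PowerSeries ℂ} (h : EqUpTo n F F') (h' : EqUpTo n G G') :
    EqUpTo n (F * G) (F' * G') := by
  intro m hm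
  rw [PowerSeries.coeff_mul, PowerSeries.coeff_mul]
  refine Finset.sum_congr rfl fun q hq => ?_
  have := Finset.HasAntidiagonal.mem_antidiagonal.1 hq
  rw [h q.1 (by omega), h' q.2 (by omega)]

theorem EqUpTo.add {n : ℕ} {F F' G G' : PowerSeries ℂ} (h : EqUpTo n F F') (h' : EqUpTo n G G') :
    EqUpTo n (F + G) (F' + G') := by
  intro m hm
  rw [map_add, map_add, h m hm, h' m hm]

theorem EqUpTo.aeval {n : ℕ} {F G : ℕ+ → PowerSeries ℂ} (h : ∀ k, EqUpTo n (F k) (G k)) (q : A) :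
    EqUpTo n (aeval (R := ℂ) F q) (aeval (R := ℂ) G q) := by
  induction q using MvPolynomial.induction_on with
  | C c => intro m _; simp
  | add p q hp hq => rw [map_add, map_add]; exact hp.add hq
  | mul_X p i hp => rw [map_mul, map_mul, aeval_X, aeval_X]; exact hp.mul (h i)

theorem eqUpTo_pexp {n : ℕ} {ℓ ℓ' : ℕ+ → ℂ} (h : ∀ k : ℕ+, (k : ℕ) ≤ n → ℓ k = ℓ' k) :
    EqUpTo n (pexp ℓ) (pexp ℓ') :=
  fun _ hm => coeff_pexp_congr fun k hk => h k (hk.trans hm)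

/-! ### Adding currents -/

/-- The matrix elements with additional currents at the points `c_j s`, up to a common
denominator. -/
def melNum (b : ℝ) (u : ℂ) {R : Type*} [CommRing R] [Algebra ℂ R] {N L : ℕ} (x : Fin N → ℂ)
    (c : Fin L → ℂ) (h : A) (s : R) : R :=
  ∑ σ : Fin N → SignType, ∑ τ : Fin L → SignType,
    ((∏ i, wt b u (σ i)) * pairProd b σ x * ((∏ j, wt b u (τ j)) * pairProd b τ c)) •
      ((∏ i, ∏ j, cNum b (σ i) (τ j) (algebraMap ℂ R (x i)) (algebraMap ℂ R (c j) * s)) *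
        aeval (fun k : ℕ+ => algebraMap ℂ R (powR σ x k) +
          algebraMap ℂ R (powR τ c k) * s ^ (k : ℕ)) h)

theorem map_melNum (b : ℝ) (u : ℂ) {R S : Type*} [CommRing R] [Algebra ℂ R] [CommRing S]
    [Algebra ℂ S] (φ : R →ₐ[ℂ] S) {N L : ℕ} (x : Fin N → ℂ) (c : Fin L → ℂ) (h : A) (s : R) :
    φ (melNum b u x c h s) = melNum b u x c h (φ s) := by
  have key : ∀ g : ℕ+ → R, φ (aeval g h) = aeval (fun k => φ (g k)) h := fun g =>
    DFunLike.congr_fun (comp_aeval g φ) h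
  simp [melNum, map_prod, map_cNum, key]

theorem prod_Ioi_append {M : Type*} [CommMonoid M] {N L : ℕ} (g : Fin (N + L) → Fin (N + L) → M) :
    ∏ i, ∏ j ∈ Finset.Ioi i, g i j =
      (∏ i : Fin N, ∏ j ∈ Finset.Ioi i, g (Fin.castAdd L i) (Fin.castAdd L j)) *
      (∏ i : Fin N, ∏ j : Fin L, g (Fin.castAdd L i) (Fin.natAdd N j)) *
      ∏ i : Fin L, ∏ j ∈ Finset.Ioi i, g (Fin.natAdd N i) (Fin.natAdd N j) := by
  have key : ∀ {m : ℕ} (i : Fin m) (F : Fin m → M),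
      ∏ j ∈ Finset.Ioi i, F j = ∏ j, if i < j then F j else 1 := by
    intro m i F
    rw [← Finset.prod_filter]
    congr 1
    ext j
    simp
  have h1 : ∀ (i : Fin N) (j : Fin L), Fin.castAdd L i < Fin.natAdd N j := by
    intro i j
    rw [Fin.lt_def, Fin.val_castAdd, Fin.val_natAdd]
    omega
  have h2 : ∀ (i : Fin N) (j : Fin N), Fin.castAdd L i < Fin.castAdd L j ↔ i < j := by
    intro i j; rfl
  have h3 : ∀ (i : Fin L) (j : Fin L), Fin.natAdd N i < Fin.natAdd N j ↔ i < j := by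
    intro i j
    rw [Fin.lt_def, Fin.lt_def, Fin.val_natAdd, Fin.val_natAdd]
    omega
  simp only [key, Fin.prod_univ_add, h1, h2, h3, (h1 _ _).not_gt, if_true, if_false,
    Finset.prod_const_one, Finset.prod_mul_distrib, mul_one, mul_assoc]

theorem pairProd_append (b : ℝ) {N L : ℕ} (σ : Fin N → SignType) (τ : Fin L → SignType)
    (x : Fin N → ℂ) (y : Fin L → ℂ) :
    pairProd b (Fin.append σ τ) (Fin.append x y) =
      pairProd b σ x * (∏ i, ∏ j, contraction b (σ i) (τ j) (x i) (y j)) * pairProd b τ y := by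
  rw [pairProd, prod_Ioi_append]
  simp only [Fin.append_left, Fin.append_right, pairProd]

/-- Contractions depend only on ratios of arguments, so the added currents contribute no
`s`-dependence among themselves. -/
theorem pairProd_smul (b : ℝ) {L : ℕ} (τ : Fin L → SignType) {c : Fin L → ℂ} (hc : ∀ j, c j ≠ 0)
    {s : ℂ} (hs : s ≠ 0) : pairProd b τ (fun j => c j * s) = pairProd b τ c := by
  refine Finset.prod_congr rfl fun i _ => Finset.prod_congr rfl fun j _ => ?_
  rw [contraction_eq b _ _ (mul_ne_zero (hc i) hs) (mul_ne_zero (hc j) hs),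
    contraction_eq b _ _ (hc i) (hc j), mul_div_mul_right _ _ hs]

theorem regular_append_smul {N L : ℕ} {x : Fin N → ℂ} {c : Fin L → ℂ} (hx : Regular x)
    (hc : Regular c) {s : ℂ} (hs : s ≠ 0) (h : ∀ i j, x i ^ 6 ≠ (c j * s) ^ 6) :
    Regular (Fin.append x fun j => c j * s) := by
  refine ⟨fun i => ?_, fun i j => ?_⟩
  · refine Fin.addCases (fun i => ?_) (fun i => ?_) i
    · simpa using hx.1 i
    · simpa using ⟨hc.1 i, hs⟩
  · refine Fin.addCases (fun i => ?_) (fun i => ?_) i <;>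
      refine Fin.addCases (fun j => ?_) (fun j => ?_) j <;>
      simp only [Fin.append_left, Fin.append_right]
    · intro hij
      exact hx.2 i j fun e => hij (e ▸ rfl)
    · intro _
      exact h i j
    · intro _
      exact (h j i).symm
    · intro hij
      rw [mul_pow, mul_pow]
      exact fun e => hc.2 i j (fun e => hij (e ▸ rfl)) (mul_right_cancel₀ (pow_ne_zero 6 hs) e)

theorem mel_append (b : ℝ) (hY : ∀ n, Y b n ≠ 0) (u : ℂ) {N L : ℕ} {x : Fin N → ℂ}
    {c : Fin L → ℂ} (hx : Regular x) (hc : Regular c) (h : A) {s : ℂ} (hs : s ≠ 0)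
    (hxc : ∀ i j, x i ^ 6 ≠ (c j * s) ^ 6) :
    mel b u (Fin.append x fun j => c j * s) h 1 * ∏ i, ∏ j, (x i ^ 6 - (c j * s) ^ 6) =
      melNum b u x c h s := by
  rw [mel_one_right b hY, ← (Fin.appendEquiv N L).sum_comp, Fintype.sum_prod_type, melNum,
    Finset.sum_mul]
  refine Finset.sum_congr rfl fun σ _ => ?_
  rw [Finset.sum_mul]
  refine Finset.sum_congr rfl fun τ _ => ?_
  have e1 : (Fin.appendEquiv N L) (σ, τ) = Fin.append σ τ := rfl
  have e2 : ∏ i, ∏ j, cNum b (σ i) (τ j) (algebraMap ℂ ℂ (x i)) (algebraMap ℂ ℂ (c j) * s) =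
      (∏ i, ∏ j, contraction b (σ i) (τ j) (x i) (c j * s)) *
        ∏ i, ∏ j, (x i ^ 6 - (c j * s) ^ 6) := by
    simp only [← Finset.prod_mul_distrib]
    exact Finset.prod_congr rfl fun i _ => Finset.prod_congr rfl fun j _ =>
      (contraction_mul b _ _ (hx.1 i) (mul_ne_zero (hc.1 j) hs) (hxc i j)).symm
  have e3 : powR (Fin.append σ τ) (Fin.append x fun j => c j * s) =
      fun k : ℕ+ => algebraMap ℂ ℂ (powR σ x k) + algebraMap ℂ ℂ (powR τ c k) * s ^ (k : ℕ) := by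
    ext1 k
    simp [powR, Fin.sum_univ_add, mul_pow, Finset.sum_mul, mul_assoc]
  rw [e1, e2, pairProd_append, pairProd_smul b τ hc.1 hs, Fin.prod_univ_add, e3]
  simp only [Fin.append_left, Fin.append_right, smul_eq_mul]
  rw [aeval_eq_eval]
  ring

/-- The factor relating matrix elements with the vector of a word to those with currents. -/
def gaugeSeries (b : ℝ) {N : ℕ} (x : Fin N → ℂ) (w : Word) : PowerSeries ℂ :=
  (∏ i, ∏ j, (PowerSeries.C (x i) ^ 6 - (PowerSeries.C (w.c j) * PowerSeries.X) ^ 6))⁻¹ *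
    pexp fun k => w.gauge b k * ∑ i, (x i)⁻¹ ^ (k : ℕ)

theorem prod_cNum_series (b : ℝ) {N L : ℕ} {x : Fin N → ℂ} (hx : ∀ i, x i ≠ 0) (c : Fin L → ℂ)
    (σ : Fin N → SignType) (τ : Fin L → SignType) :
    ∏ i, ∏ j, cNum b (σ i) (τ j) (PowerSeries.C (x i)) (PowerSeries.C (c j) * PowerSeries.X) =
      (∏ i, ∏ j, (PowerSeries.C (x i) ^ 6 - (PowerSeries.C (c j) * PowerSeries.X) ^ 6)) *
        pexp fun k => logf b k * ∑ i, ∑ j, pairCharge k (σ i) (τ j) * (c j / x i) ^ (k : ℕ) := by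
  have : (fun k : ℕ+ => logf b k * ∑ i, ∑ j, pairCharge k (σ i) (τ j) * (c j / x i) ^ (k : ℕ)) =
      ∑ i, ∑ j, fun k : ℕ+ => logf b k * pairCharge k (σ i) (τ j) * (c j / x i) ^ (k : ℕ) := by
    ext1 k
    simp only [Finset.sum_apply, Finset.mul_sum, mul_assoc]
  rw [this, pexp_sum]
  simp only [pexp_sum, ← Finset.prod_mul_distrib]
  exact Finset.prod_congr rfl fun i _ => Finset.prod_congr rfl fun j _ =>
    cNum_series b (hx i) (c j) (σ i) (τ j)

/-- Term by term in the signs, the vector has the contractions and charges of the added currents,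
times a gauge factor. That factor depends neither on `u` nor on the left descendant, so any identity
between matrix elements with more currents carries over. -/
theorem mel_vec (b : ℝ) (hY : ∀ n, Y b n ≠ 0) (u : ℂ) {N : ℕ} {x : Fin N → ℂ}
    (hx : ∀ i, x i ≠ 0) (h : A) (w : Word) :
    mel b u x h (w.vec b u) = PowerSeries.coeff w.n
      (melNum b u x w.c h (PowerSeries.X : PowerSeries ℂ) * gaugeSeries b x w) := by
  set P : PowerSeries ℂ :=
    ∏ i, ∏ j, (PowerSeries.C (x i) ^ 6 - (PowerSeries.C (w.c j) * PowerSeries.X) ^ 6) with hP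
  have hPP : P * P⁻¹ = 1 := by
    refine PowerSeries.mul_inv_cancel _ ?_
    simp [hP, map_prod, Finset.prod_eq_zero_iff, hx]
  have h1 : mel b u x h (w.vec b u) = ∑ τ : Fin w.L → SignType,
      ((∏ j, wt b u (τ j)) * pairProd b τ w.c) * mel b u x h (expVec (w.expo b τ) w.n) := by
    change melRight b u x h _ = _
    rw [Word.vec, map_sum]
    exact Finset.sum_congr rfl fun τ _ => mel_smul_right b u x h _ _
  rw [h1, melNum, Finset.sum_mul, map_sum]
  simp only [Finset.sum_mul, map_sum, mel_expVec b hY, Finset.mul_sum]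
  rw [Finset.sum_comm]
  refine Finset.sum_congr rfl fun σ _ => Finset.sum_congr rfl fun τ _ => ?_
  have h2 : (∏ i, ∏ j, cNum b (σ i) (τ j) (algebraMap ℂ (PowerSeries ℂ) (x i))
      (algebraMap ℂ (PowerSeries ℂ) (w.c j) * PowerSeries.X)) = P *
        pexp fun k => logf b k * ∑ i, ∑ j, pairCharge k (σ i) (τ j) * (w.c j / x i) ^ (k : ℕ) :=
    prod_cNum_series b hx w.c σ τ
  rw [h2, smul_mul_assoc, PowerSeries.coeff_smul, smul_eq_mul]
  have h3 : EqUpTo w.n (pexp fun k => w.expo b τ k * powL σ x k)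
      (pexp ((fun k => logf b k * ∑ i, ∑ j, pairCharge k (σ i) (τ j) * (w.c j / x i) ^ (k : ℕ)) +
        fun k => w.gauge b k * ∑ i, (x i)⁻¹ ^ (k : ℕ))) := by
    refine eqUpTo_pexp fun k hk => ?_
    simp only [powL, Pi.add_apply, Finset.mul_sum, ← Finset.sum_add_distrib]
    refine Finset.sum_congr rfl fun i _ => ?_
    rw [← mul_assoc, w.expo_mul_chargeL b τ hk, add_mul, Finset.mul_sum, Finset.sum_mul]
    congr 1
    refine Finset.sum_congr rfl fun j _ => ?_
    rw [div_eq_mul_inv, mul_pow]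
    ring
  have h4 : EqUpTo w.n
      (aeval (R := ℂ) (fun k : ℕ+ => (PowerSeries.C (powR σ x k) +
        PowerSeries.C (w.expo b τ k * commAlpha b k) * PowerSeries.X ^ (k : ℕ) : PowerSeries ℂ)) h)
      (aeval (R := ℂ) (fun k : ℕ+ => algebraMap ℂ (PowerSeries ℂ) (powR σ x k) +
        algebraMap ℂ (PowerSeries ℂ) (powR τ w.c k) * PowerSeries.X ^ (k : ℕ)) h) := by
    refine EqUpTo.aeval (fun k => ?_) h
    by_cases hk : (k : ℕ) ≤ w.n
    · rw [w.expo_mul_commAlpha b hY τ hk]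
      exact fun _ _ => rfl
    · intro m hm
      -- The identities for the exponents hold only up to level `w.n`. Higher levels do not affect
      -- the coefficients compared here.
      have hkm : m ≠ k := by omega
      change PowerSeries.coeff m _ = PowerSeries.coeff m (PowerSeries.C (powR σ x k) +
        PowerSeries.C (powR τ w.c k) * PowerSeries.X ^ (k : ℕ))
      simp only [map_add, PowerSeries.coeff_C_mul, PowerSeries.coeff_X_pow, if_neg hkm, mul_zero]
  rw [(h3.mul h4) w.n le_rfl, pexp_add, gaugeSeries, ← hP]
  set F := pexp fun k => logf b k * ∑ i, ∑ j, pairCharge k (σ i) (τ j) * (w.c j / x i) ^ (k : ℕ)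
  set G := pexp fun k => w.gauge b k * ∑ i, (x i)⁻¹ ^ (k : ℕ)
  set H := aeval (R := ℂ) (fun k : ℕ+ => algebraMap ℂ (PowerSeries ℂ) (powR σ x k) +
        algebraMap ℂ (PowerSeries ℂ) (powR τ w.c k) * PowerSeries.X ^ (k : ℕ)) h
  have h5 : P * F * H * (P⁻¹ * G) = F * G * H := by
    linear_combination (F * G * H) * hPP
  rw [h5]
  ring

open Polynomial in
/-- Two chiral descendants with the same matrix elements have the same matrix elements with the
vectors of words. -/
theorem mel_vec_congr (b : ℝ) (hY : ∀ n, Y b n ≠ 0) {u u' : ℂ} {h h' : A}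
    (H : ∀ (M : ℕ) (x : Fin M → ℂ), Regular x → mel b u x h 1 = mel b u' x h' 1)
    {N : ℕ} {x : Fin N → ℂ} (hx : Regular x) (w : Word) :
    mel b u x h (w.vec b u) = mel b u' x h' (w.vec b u') := by
  rw [mel_vec b hY u hx.1, mel_vec b hY u' hx.1]
  -- The numerators are polynomials in `s`, so equality at almost all numerical `s` gives equality
  -- as power series.
  suffices e : melNum b u x w.c h (Polynomial.X : ℂ[X]) = melNum b u' x w.c h' (Polynomial.X : ℂ[X]) by
    have := congrArg (Polynomial.aeval (PowerSeries.X : PowerSeries ℂ)) e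
    rw [map_melNum, map_melNum, Polynomial.aeval_X] at this
    rw [this]
  -- The zeros of `D` are the values of `s` at which the enlarged configuration is not regular.
  -- Elsewhere `H` applies to `N + w.L` currents.
  set D : ℂ[X] := Polynomial.X * ∏ i, ∏ j,
    (Polynomial.C (x i) ^ 6 - (Polynomial.C (w.c j) * Polynomial.X) ^ 6) with hD
  have hD0 : D ≠ 0 := by
    refine mul_ne_zero Polynomial.X_ne_zero (Finset.prod_ne_zero_iff.2 fun i _ =>
      Finset.prod_ne_zero_iff.2 fun j _ => fun e => ?_)
    have := congrArg (Polynomial.eval 0) e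
    simp [hx.1 i] at this
  refine mul_right_cancel₀ hD0 (Polynomial.funext fun s => ?_)
  rw [Polynomial.eval_mul (q := D), Polynomial.eval_mul (q := D)]
  by_cases hs : D.eval s = 0
  · rw [hs, mul_zero, mul_zero]
  · have hs' : s ≠ 0 ∧ ∀ i j, x i ^ 6 ≠ (w.c j * s) ^ 6 := by
      simpa [hD, Polynomial.eval_prod, Finset.prod_eq_zero_iff, sub_eq_zero] using hs
    have hev : ∀ (v : ℂ) (q : A), (melNum b v x w.c q (Polynomial.X : ℂ[X])).eval s =
        melNum b v x w.c q s := by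
      intro v q
      rw [← Polynomial.coe_aeval_eq_eval, map_melNum, Polynomial.aeval_X]
    rw [hev, hev, ← mel_append b hY u hx w.regular h hs'.1 hs'.2,
      ← mel_append b hY u' hx w.regular h' hs'.1 hs'.2,
      H _ _ (regular_append_smul hx w.regular hs'.1 hs'.2)]

theorem Regular.inv {N : ℕ} {x : Fin N → ℂ} (h : Regular x) : Regular fun i => (x i)⁻¹ :=
  ⟨fun i => inv_ne_zero (h.1 i), fun i j hij => by
    rw [inv_pow, inv_pow, Ne, inv_inj]; exact h.2 i j hij⟩

theorem mel_one_vec (b : ℝ) (hY : ∀ n, Y b n ≠ 0) {u : ℂ} (hu : u ≠ 0) {N : ℕ} {x : Fin N → ℂ}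
    (hx : Regular x) (w : Word) : mel b u x 1 (w.vec b u) = mel b u⁻¹ x 1 (w.vec b u⁻¹) :=
  mel_vec_congr b hY (fun M x hx => by
    rw [mel_one_one b hY, mel_one_one b hY, vac_inv b hu x hx]) hx w

/-- Inversion of the arguments carries left vectors to right ones and `u` to `u⁻¹`. This is why left
and right vectors carry opposite parameters. -/
theorem mel_vec_one (b : ℝ) (hY : ∀ n, Y b n ≠ 0) {u : ℂ} (hu : u ≠ 0) {N : ℕ} {x : Fin N → ℂ}
    (hx : Regular x) (w : Word) : mel b u x (w.vec b u⁻¹) 1 = mel b u⁻¹ x (w.vec b u) 1 := by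
  rw [mel_inversion b hY u hx.1, mel_inversion b hY u⁻¹ hx.1, inv_inv,
    mel_one_vec b hY hu hx.inv]

/-- The reflection of the matrix elements on the vectors of words. -/
theorem mel_vec_vec (b : ℝ) (hY : ∀ n, Y b n ≠ 0) {u : ℂ} (hu : u ≠ 0) {N : ℕ} {x : Fin N → ℂ}
    (hx : Regular x) (w w' : Word) :
    mel b u x (w.vec b u⁻¹) (w'.vec b u) = mel b u⁻¹ x (w.vec b u) (w'.vec b u⁻¹) :=
  mel_vec_congr b hY (fun _ _ hx => mel_vec_one b hY hu hx w) hx w'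

/-! ### Small power sums -/

section PowerSums

open Topology Filter

theorem regular_mem_nhds {L : ℕ} {c : Fin L → ℂ} (hc : Regular c) : {x | Regular x} ∈ 𝓝 c := by
  have h1 : ∀ᶠ x : Fin L → ℂ in 𝓝 c, ∀ i, x i ≠ 0 :=
    Filter.eventually_all.2 fun i => (continuous_apply i).continuousAt.eventually_ne (hc.1 i)
  have h2 : ∀ᶠ x : Fin L → ℂ in 𝓝 c, ∀ i j, i ≠ j → x i ^ 6 ≠ x j ^ 6 := by
    refine Filter.eventually_all.2 fun i => Filter.eventually_all.2 fun j => ?_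
    by_cases hij : i = j
    · exact Filter.Eventually.of_forall fun _ h => absurd hij h
    · have hc' : Continuous fun x : Fin L → ℂ => x i ^ 6 - x j ^ 6 := by fun_prop
      filter_upwards [hc'.continuousAt.eventually_ne (sub_ne_zero.2 (hc.2 i j hij))] with x hx _
      exact sub_ne_zero.1 hx
  filter_upwards [h1, h2] with x hx hx'
  exact ⟨hx, hx'⟩

theorem sum_pow_primitiveRoot {L : ℕ} {ζ : ℂ} (hζ : IsPrimitiveRoot ζ L) {k l : ℕ} (hk : k < L)
    (hl : l < L) : ∑ j : Fin L, (ζ ^ (j : ℕ)) ^ k * (ζ⁻¹ ^ (j : ℕ)) ^ l = if k = l then (L : ℂ) else 0 := by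
  have h0 : ζ ≠ 0 := hζ.ne_zero (by omega)
  have h1 : ∀ j : ℕ, (ζ ^ j) ^ k * (ζ⁻¹ ^ j) ^ l = (ζ ^ k * ζ⁻¹ ^ l) ^ j := by
    intro j
    rw [mul_pow, pow_right_comm, pow_right_comm ζ⁻¹]
  simp only [h1]
  rw [Fin.sum_univ_eq_sum_range fun j => (ζ ^ k * ζ⁻¹ ^ l) ^ j]
  split_ifs with hkl
  · subst hkl
    rw [← mul_pow, mul_inv_cancel₀ h0]
    simp
  · have hr : ζ ^ k * ζ⁻¹ ^ l ≠ 1 := by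
      intro h
      apply hkl
      apply hζ.pow_inj hk hl
      rw [inv_pow, ← div_eq_mul_inv, div_eq_one_iff_eq (pow_ne_zero _ h0)] at h
      exact h
    rw [geom_sum_eq hr, mul_pow, ← pow_mul, ← pow_mul, mul_comm k, mul_comm l, pow_mul, pow_mul,
      inv_pow, hζ.pow_eq_one]
    simp

/-- Small numbers are the first power sums of points in general position. -/
theorem exists_powerSums (m : ℕ) : ∃ L : ℕ, ∃ ε > 0, ∀ q : ℕ+ → ℂ,
    (∀ k : ℕ+, (k : ℕ) ≤ m → ‖q k‖ < ε) →
      ∃ c : Fin L → ℂ, Regular c ∧ ∀ k : ℕ+, (k : ℕ) ≤ m → ∑ j, c j ^ (k : ℕ) = q k := by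
  -- The base point consists of the `L`-th roots of unity. Since `L > m`, their first `m` power sums
  -- vanish; since `L` is prime to `6`, their sixth powers stay distinct.
  set L := 6 * m + 1 with hL
  have hL0 : (L : ℂ) ≠ 0 := Nat.cast_ne_zero.2 (by omega)
  set ζ := Complex.exp (2 * Real.pi * Complex.I / L)
  have hζ : IsPrimitiveRoot ζ L := Complex.isPrimitiveRoot_exp L (by omega)
  have hζ0 : ζ ≠ 0 := Complex.exp_ne_zero _
  let c₀ : Fin L → ℂ := fun j => ζ ^ (j : ℕ)
  have hc₀ : Regular c₀ := by
    refine ⟨fun j => pow_ne_zero _ hζ0, fun i j hij h => hij ?_⟩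
    have h6 : IsPrimitiveRoot (ζ ^ 6) L := hζ.pow_of_coprime 6 (by
      rw [hL]; simp)
    simp only [c₀] at h
    rw [pow_right_comm, pow_right_comm _ (j : ℕ)] at h
    exact Fin.ext (h6.pow_inj i.2 j.2 h)
  let F : (Fin L → ℂ) → Fin m → ℂ := fun c k => ∑ j, c j ^ ((k : ℕ) + 1)
  let F' : (Fin L → ℂ) →L[ℂ] Fin m → ℂ := ContinuousLinearMap.pi fun k =>
    ∑ j, (((k : ℕ) + 1 : ℕ) * c₀ j ^ (k : ℕ) : ℂ) • ContinuousLinearMap.proj (R := ℂ) (φ := fun _ : Fin L => ℂ) j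
  have hF : HasStrictFDerivAt F F' c₀ := by
    refine hasStrictFDerivAt_pi.2 fun k => HasStrictFDerivAt.fun_sum fun j _ => ?_
    have := (hasStrictFDerivAt_apply (𝕜 := ℂ) j c₀).pow ((k : ℕ) + 1)
    simpa using this
  have hF0 : F c₀ = 0 := by
    ext k
    have := sum_pow_primitiveRoot hζ (k := k + 1) (l := 0) (by omega) (by omega)
    simpa [F, c₀] using this
  -- At the roots of unity the derivative is a rescaled part of the discrete Fourier matrix, so
  -- orthogonality of characters gives an explicit preimage.
  have hsurj : F'.range = ⊤ := by
    refine LinearMap.range_eq_top.2 fun t => ⟨fun j => (L : ℂ)⁻¹ * ∑ l : Fin m,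
      t l / ((l : ℕ) + 1) * (ζ⁻¹ ^ (j : ℕ)) ^ (l : ℕ), ?_⟩
    ext k
    have hk1 : ((k : ℕ) + 1 : ℂ) ≠ 0 := Nat.cast_add_one_ne_zero _
    have : ∀ l : Fin m, ∑ j : Fin L, (ζ ^ (j : ℕ)) ^ (k : ℕ) * (ζ⁻¹ ^ (j : ℕ)) ^ (l : ℕ) =
        if k = l then (L : ℂ) else 0 := by
      intro l
      rw [sum_pow_primitiveRoot hζ (by omega) (by omega)]
      simp [Fin.ext_iff]
    calc F' _ k = ∑ j : Fin L, ∑ l : Fin m, ((k : ℕ) + 1 : ℂ) * (L : ℂ)⁻¹ * (t l / ((l : ℕ) + 1)) *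
          ((ζ ^ (j : ℕ)) ^ (k : ℕ) * (ζ⁻¹ ^ (j : ℕ)) ^ (l : ℕ)) := by
          simp [F', c₀, Finset.mul_sum]
          refine Finset.sum_congr rfl fun j _ => Finset.sum_congr rfl fun l _ => ?_
          ring
      _ = t k := by
          rw [Finset.sum_comm]
          simp only [← Finset.mul_sum, this]
          simp
          field_simp
  have key := hF.map_nhds_eq_of_surj hsurj
  rw [hF0] at key
  have him : F '' {x | Regular x} ∈ 𝓝 (0 : Fin m → ℂ) := by
    rw [← key]; exact image_mem_map (regular_mem_nhds hc₀)
  obtain ⟨ε, hε, hball⟩ := Metric.mem_nhds_iff.1 him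
  refine ⟨L, ε, hε, fun q hq => ?_⟩
  have hmem : (fun k : Fin m => q (k : ℕ).succPNat) ∈ Metric.ball (0 : Fin m → ℂ) ε := by
    rw [mem_ball_zero_iff, pi_norm_lt_iff hε]
    exact fun k => hq _ (by simp)
  obtain ⟨c, hc, hcF⟩ := hball hmem
  refine ⟨c, hc, fun k hk => ?_⟩
  have h1 := congrFun hcF ⟨k.natPred, by have := k.natPred_add_one; omega⟩
  simp only [F] at h1
  have h2 : k.natPred.succPNat = k := k.succPNat_natPred
  rw [h2, PNat.natPred_add_one] at h1
  exact h1

end PowerSums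

/-! ### Families of vectors depending polynomially on a parameter -/

section Generic

open Polynomial

theorem span_eq_top_iff_forall_dotProduct {T ι : Type*} [Fintype ι] (f : T → ι → ℂ) :
    Submodule.span ℂ (Set.range f) = ⊤ ↔
      ∀ a : ι → ℂ, (∀ t, ∑ i, a i * f t i = 0) → a = 0 := by
  classical
  constructor
  · intro h a ha
    have h1 : (Fintype.linearCombination ℂ a : (ι → ℂ) →ₗ[ℂ] ℂ) = 0 := by
      refine LinearMap.ext_on_range h fun t => ?_
      rw [Fintype.linearCombination_apply, LinearMap.zero_apply, ← ha t]
      exact Finset.sum_congr rfl fun i _ => mul_comm _ _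
    ext i
    have := LinearMap.congr_fun h1 (Pi.single i 1)
    simpa using this
  · intro h
    by_contra hne
    obtain ⟨φ, hφ, hle⟩ := Submodule.exists_le_ker_of_lt_top _ (lt_top_iff_ne_top.2 hne)
    apply hφ
    have h1 := h (fun i => φ (Pi.single i 1)) fun t => by
      have : φ (f t) = 0 := hle (Submodule.subset_span ⟨t, rfl⟩)
      rw [φ.pi_apply_eq_sum_univ] at this
      rw [← this]
      refine Finset.sum_congr rfl fun i _ => ?_
      rw [smul_eq_mul, mul_comm]
      congr 3
      ext j
      simp [Pi.single_apply, eq_comm]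
    refine LinearMap.pi_ext' fun i => LinearMap.ext_ring ?_
    simpa using congrFun h1 i

/-- A family of vectors with polynomial entries which spans at `0` spans at all but finitely many
values of the parameter. -/
theorem finite_span_ne_top {T ι : Type*} [Fintype ι] (V : T → ι → ℂ[X])
    (h : Submodule.span ℂ (Set.range fun t i => (V t i).eval 0) = ⊤) :
    {v : ℂ | Submodule.span ℂ (Set.range fun t i => (V t i).eval v) ≠ ⊤}.Finite := by
  classical
  -- Members of the family forming a basis at `0` give a square matrix whose determinant is a
  -- polynomial nonzero at `0`. The span can fail only at its roots.
  obtain ⟨κ, a, -, hspan, hli⟩ := exists_linearIndependent' ℂ fun t i => (V t i).eval 0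
  rw [h] at hspan
  let B := Module.Basis.mk hli hspan.ge
  let e : ι ≃ κ := (Pi.basisFun ℂ ι).indexEquiv B
  let M : Matrix ι ι ℂ[X] := fun i j => V (a (e i)) j
  have hM : ∀ v, M.det.eval v = (Matrix.of fun i j => (V (a (e i)) j).eval v).det := by
    intro v
    rw [← Polynomial.coe_evalRingHom, RingHom.map_det]
    rfl
  have h0 : M.det ≠ 0 := by
    intro h0
    have h1 : IsUnit (Matrix.of fun i j => (V (a (e i)) j).eval 0) :=
      Matrix.linearIndependent_rows_iff_isUnit.1 (hli.comp e e.injective)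
    rw [Matrix.isUnit_iff_isUnit_det, ← hM, h0, Polynomial.eval_zero] at h1
    exact not_isUnit_zero h1
  refine (M.det.roots.toFinset.finite_toSet).subset fun v hv => ?_
  rw [Finset.mem_coe, Multiset.mem_toFinset, Polynomial.mem_roots h0, Polynomial.IsRoot]
  by_contra hne
  rw [hM] at hne
  have h1 := Matrix.linearIndependent_rows_iff_isUnit.2
    ((Matrix.isUnit_iff_isUnit_det _).2 (isUnit_iff_ne_zero.2 hne))
  have h2 := h1.span_eq_top_of_card_eq_finrank' (by simp)
  refine hv (top_le_iff.1 (h2.ge.trans (Submodule.span_mono ?_)))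
  rintro _ ⟨i, rfl⟩
  exact ⟨a (e i), rfl⟩

end Generic

/-! ### Sums over signs as polynomials in `v = u⁻¹` -/

/-- The coefficients of the current divided by `u`, as polynomials in `u⁻¹`. -/
def wtPoly (b : ℝ) : SignType → Polynomial ℂ
  | .pos => 1
  | .neg => Polynomial.X ^ 2
  | .zero => Polynomial.C (hConst b : ℂ) * Polynomial.X

/-- A sum over signs with the coefficients of the current, as a polynomial in `u⁻¹`. -/
def signSum (b : ℝ) {N : ℕ} (g : (Fin N → SignType) → ℂ) : Polynomial ℂ :=
  ∑ σ, Polynomial.C (g σ) * ∏ i, wtPoly b (σ i)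

theorem wt_eq_mul_eval (b : ℝ) {u : ℂ} (hu : u ≠ 0) (s : SignType) :
    wt b u s = u * (wtPoly b s).eval u⁻¹ := by
  cases s <;> simp [wt, wtPoly] <;> field_simp

theorem sum_wt_mul (b : ℝ) {u : ℂ} (hu : u ≠ 0) {N : ℕ} (g : (Fin N → SignType) → ℂ) :
    ∑ σ, (∏ i, wt b u (σ i)) * g σ = u ^ N * (signSum b g).eval u⁻¹ := by
  simp only [wt_eq_mul_eval b hu, Finset.prod_mul_distrib, Finset.prod_const, Finset.card_univ,
    Fintype.card_fin, signSum, Polynomial.eval_finsetSum, Polynomial.eval_mul, Polynomial.eval_C,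
    Polynomial.eval_prod, Finset.mul_sum]
  exact Finset.sum_congr rfl fun σ _ => by ring

/-- Relative to `u`, the weights of `λ⁰` and `λ⁻` are of order `u⁻¹` and `u⁻²`. The limit `u → ∞`
therefore keeps only the term with all signs `+`. -/
theorem eval_zero_signSum (b : ℝ) {N : ℕ} (g : (Fin N → SignType) → ℂ) :
    (signSum b g).eval 0 = g fun _ => .pos := by
  have h0 : ∀ s : SignType, s ≠ .pos → (wtPoly b s).eval 0 = 0 := by
    intro s hs
    cases s
    · simp [wtPoly]
    · simp [wtPoly]
    · exact absurd rfl hs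
  rw [signSum, Polynomial.eval_finsetSum, Finset.sum_eq_single fun _ => SignType.pos]
  · simp [wtPoly]
  · intro σ _ hσ
    obtain ⟨i, hi⟩ := Function.ne_iff.1 hσ
    rw [Polynomial.eval_mul, Polynomial.eval_prod,
      Finset.prod_eq_zero (Finset.mem_univ i) (h0 _ hi), mul_zero]
  · simp

theorem pairProd_pos (b : ℝ) {N : ℕ} (x : Fin N → ℂ) : pairProd b (fun _ => .pos) x = 1 := by
  simp [pairProd, contraction]

theorem powR_pos {N : ℕ} (x : Fin N → ℂ) (k : ℕ+) :
    powR (fun _ => .pos) x k = ∑ i, x i ^ (k : ℕ) := by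
  simp [powR, chargeR]

/-! ### Generic nondegeneracy -/

/-- A chiral descendant is determined by its matrix elements. -/
def Nondegenerate (b : ℝ) (u : ℂ) : Prop :=
  ∀ h : A, (∀ (M : ℕ) (x : Fin M → ℂ), Regular x → mel b u x h 1 = 0) → h = 0

/-- The coordinates of the linear functionals given by the matrix elements. -/
def melCoord (b : ℝ) (t : Σ M : ℕ, {x : Fin M → ℂ // Regular x}) (κ : ℕ+ →₀ ℕ) : Polynomial ℂ :=
  signSum b fun σ => pairProd b σ t.2.1 * eval (powR σ t.2.1) (monomial κ 1)

/-- In this limit all contractions are `1` and the matrix element evaluates a polynomial at the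
power sums of `x`. The power sums cover a polydisc, so a polynomial killed by all of them is zero.
-/
theorem span_melCoord (b : ℝ) (T : Finset (ℕ+ →₀ ℕ)) :
    Submodule.span ℂ (Set.range fun t (κ : T) => (melCoord b t κ).eval 0) = ⊤ := by
  rw [span_eq_top_iff_forall_dotProduct]
  intro a ha
  set P : A := ∑ κ : T, monomial (κ : ℕ+ →₀ ℕ) (a κ) with hP
  set m : ℕ := T.sup fun κ => κ.support.sup fun k => (k : ℕ)
  obtain ⟨L, ε, hε, hL⟩ := exists_powerSums m
  have h0 : P = 0 := by
    refine funext_set (fun _ => Metric.ball 0 ε)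
      (fun _ => infinite_of_mem_nhds 0 (Metric.ball_mem_nhds 0 hε)) fun q hq => ?_
    obtain ⟨c, hc, hcq⟩ := hL q fun k _ => mem_ball_zero_iff.1 (hq k trivial)
    rw [map_zero, ← ha ⟨L, c, hc⟩, hP, map_sum]
    refine Finset.sum_congr rfl fun κ _ => ?_
    rw [melCoord, eval_zero_signSum, pairProd_pos, one_mul, eval_monomial, eval_monomial, one_mul]
    congr 1
    refine Finsupp.prod_congr fun k hk => ?_
    have hkm : (k : ℕ) ≤ m :=
      (Finset.le_sup (f := fun k : ℕ+ => (k : ℕ)) hk).trans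
        (Finset.le_sup (f := fun κ : ℕ+ →₀ ℕ => κ.support.sup fun k => (k : ℕ)) κ.2)
    rw [powR_pos, hcq k hkm]
  ext κ
  have h1 : P.coeff κ = a κ := by
    simp [hP, coeff_sum, coeff_monomial]
  rw [← h1, h0, coeff_zero, Pi.zero_apply]

theorem mel_one_right_eq (b : ℝ) (hY : ∀ n, Y b n ≠ 0) {u : ℂ} (hu : u ≠ 0)
    (t : Σ M : ℕ, {x : Fin M → ℂ // Regular x}) (h : A) :
    mel b u t.2.1 h 1 =
      u ^ t.1 * ∑ κ : h.support, h.coeff κ * (melCoord b t κ).eval u⁻¹ := by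
  rw [Finset.mul_sum, mel_one_right b hY]
  have : ∀ κ : h.support, u ^ t.1 * (h.coeff κ * (melCoord b t κ).eval u⁻¹) =
      ∑ σ, (∏ i, wt b u (σ i)) * (pairProd b σ t.2.1 * eval (powR σ t.2.1) (monomial (κ : ℕ+ →₀ ℕ)
        (h.coeff κ))) := by
    intro κ
    rw [mul_left_comm, melCoord, ← sum_wt_mul b hu, Finset.mul_sum]
    refine Finset.sum_congr rfl fun σ _ => ?_
    rw [eval_monomial, eval_monomial]
    ring
  simp only [this]
  rw [Finset.sum_comm]
  refine Finset.sum_congr rfl fun σ _ => ?_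
  rw [← Finset.mul_sum, ← Finset.mul_sum, ← map_sum, Finset.sum_coe_sort h.support
    fun κ => monomial κ (h.coeff κ), ← as_sum, mul_assoc]

theorem nondegenerate_of_span (b : ℝ) (hY : ∀ n, Y b n ≠ 0) {u : ℂ} (hu : u ≠ 0)
    (H : ∀ T : Finset (ℕ+ →₀ ℕ),
      Submodule.span ℂ (Set.range fun t (κ : T) => (melCoord b t κ).eval u⁻¹) = ⊤) :
    Nondegenerate b u := by
  intro h hh
  have h1 := (span_eq_top_iff_forall_dotProduct _).1 (H h.support) (fun κ => h.coeff κ) fun t => by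
    have := hh t.1 t.2.1 t.2.2
    rw [mel_one_right_eq b hY hu] at this
    exact (mul_eq_zero.1 this).resolve_left (pow_ne_zero _ hu)
  ext κ
  by_cases hκ : κ ∈ h.support
  · exact congrFun h1 ⟨κ, hκ⟩
  · rw [notMem_support_iff.1 hκ, coeff_zero]

/-! ### Generic spanning -/

/-- The level of a monomial. -/
def level (κ : ℕ+ →₀ ℕ) : ℕ := κ.sum fun k e => (k : ℕ) * e

theorem finite_level (n : ℕ) : {κ | level κ = n}.Finite := by
  refine (Set.finite_Iic (∑ k ∈ Finset.Icc 1 n.succPNat, Finsupp.single k n)).subset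
    fun κ hκ => Finsupp.le_def.2 fun k => ?_
  rcases Nat.eq_zero_or_pos (κ k) with h0 | h0
  · rw [h0]; exact zero_le
  · have h1 : (k : ℕ) * κ k ≤ n := by
      rw [← show level κ = n from hκ, level, Finsupp.sum]
      exact Finset.single_le_sum (f := fun k : ℕ+ => (k : ℕ) * κ k) (fun _ _ => Nat.zero_le _)
        (Finsupp.mem_support_iff.2 h0.ne')
    have h2 : (k : ℕ) ≤ n := (Nat.le_mul_of_pos_right _ h0).trans h1
    have h3 : κ k ≤ n := (Nat.le_mul_of_pos_left _ k.pos).trans h1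
    have h4 : k ∈ Finset.Icc 1 n.succPNat :=
      Finset.mem_Icc.2 ⟨one_le, by rw [← PNat.coe_le_coe]; exact h2.trans (Nat.le_succ n)⟩
    rw [Finsupp.finsetSum_apply]
    simp only [Finsupp.single_apply, Finset.sum_ite_eq', h4, if_true]
    exact h3

/-- The monomials of a given level. -/
def levelFinset (n : ℕ) : Finset (ℕ+ →₀ ℕ) := (finite_level n).toFinset

theorem mem_levelFinset {n : ℕ} {κ : ℕ+ →₀ ℕ} : κ ∈ levelFinset n ↔ level κ = n := by
  simp [levelFinset]

/-- The norm of a monomial in the bracket. -/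
def monomialNorm (κ : ℕ+ →₀ ℕ) : ℂ :=
  (κ.mapDomain (Sum.inl : ℕ+ → ℕ+ ⊕ ℕ+)).prod fun _ k => (k.factorial : ℂ)

theorem monomialNorm_ne_zero (κ : ℕ+ →₀ ℕ) : monomialNorm κ ≠ 0 :=
  Finset.prod_ne_zero_iff.2 fun _ _ => Nat.cast_ne_zero.2 (Nat.factorial_ne_zero _)

/-- Bracketing with a monomial extracts a coefficient times its norm, and `bracket_expVec` computes
the same number as `β^κ` placed at order `level κ`. -/
theorem coeff_expVec (β : ℕ+ → ℂ) (n : ℕ) (κ : ℕ+ →₀ ℕ) :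
    (expVec β n).coeff κ * monomialNorm κ = if level κ = n then eval β (monomial κ 1) else 0 := by
  have h := bracket_expVec (physical (monomial κ 1)) β n
  rw [physical, rename_monomial, bracket_monomial, one_mul,
    coeff_rename_mapDomain _ Sum.inl_injective, ← rename_monomial, aeval_rename,
    Sum.elim_comp_inl] at h
  rw [monomialNorm, h, aeval_monomial, map_one, one_mul, eval_monomial, one_mul]
  simp only [mul_pow, ← pow_mul, ← map_pow]
  rw [Finsupp.prod_mul, ← map_finsuppProd]
  have : (κ.prod fun a b => (PowerSeries.X : PowerSeries ℂ) ^ ((a : ℕ) * b)) =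
      PowerSeries.X ^ level κ := Finset.prod_pow_eq_pow_sum _ _ _
  rw [this, PowerSeries.coeff_C_mul, PowerSeries.coeff_X_pow]
  simp [eq_comm]

/-- The coordinates of the vectors of words. -/
def vecCoord (b : ℝ) (w : Word) (κ : ℕ+ →₀ ℕ) : Polynomial ℂ :=
  signSum b fun τ => pairProd b τ w.c * (expVec (w.expo b τ) w.n).coeff κ

/-- In the limit `u → ∞` the vectors become `expVec β n`. Enough exponents `β` occur that a linear
relation between the coordinates would be a polynomial in `β` vanishing on a product of infinite
sets. -/
theorem span_vecCoord (b : ℝ) (hY : ∀ n, Y b n ≠ 0) (n : ℕ) :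
    Submodule.span ℂ (Set.range fun (w : {w : Word // w.n = n}) (κ : levelFinset n) =>
      (vecCoord b w κ).eval 0) = ⊤ := by
  rw [span_eq_top_iff_forall_dotProduct]
  intro a ha
  set P : A := ∑ κ : levelFinset n, monomial (κ : ℕ+ →₀ ℕ) (a κ / monomialNorm κ) with hP
  obtain ⟨L, ε, hε, hL⟩ := exists_powerSums n
  have hlog : ∀ k, logf b k * (omega ^ (k : ℕ)) ^ 3 ≠ 0 := by
    intro k
    have h1 : (Y b k : ℂ) ≠ 0 := by exact_mod_cast hY k
    have h2 : (k : ℂ) ≠ 0 := by exact_mod_cast k.ne_zero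
    exact mul_ne_zero (div_ne_zero (mul_ne_zero (by norm_num) h1) h2)
      (pow_ne_zero _ (pow_ne_zero _ omega_ne_zero))
  have h0 : P = 0 := by
    refine funext_set
      (fun k => (fun z => z * (dFac k / (logf b k * (omega ^ (k : ℕ)) ^ 3))) ⁻¹' Metric.ball 0 ε)
      (fun k => infinite_of_mem_nhds 0 ?_) fun β hβ => ?_
    · refine ContinuousAt.preimage_mem_nhds (by fun_prop) ?_
      rw [zero_mul]
      exact Metric.ball_mem_nhds 0 hε
    · obtain ⟨c, hc, hcq⟩ := hL (fun k => β k * (dFac k / (logf b k * (omega ^ (k : ℕ)) ^ 3)))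
        fun k _ => mem_ball_zero_iff.1 (hβ k trivial)
      -- At ordinary levels the power sum is chosen to produce `β k`. At exceptional ones it is `0`,
      -- as the word requires, and `γ = β` supplies the exponent.
      let w : Word := ⟨L, c, β, n, hc, fun k hk hD => by rw [hcq k hk, hD, zero_div, mul_zero]⟩
      have hexpo : ∀ k : ℕ+, (k : ℕ) ≤ n → w.expo b (fun _ => .pos) k = β k := by
        intro k hk
        have h1 : w.psum k = β k * (dFac k / (logf b k * (omega ^ (k : ℕ)) ^ 3)) := hcq k hk
        rw [Word.expo, h1]
        have h2 := hlog k
        have h3 := left_ne_zero_of_mul h2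
        have h4 : omega ^ (k : ℕ) ≠ 0 := pow_ne_zero _ omega_ne_zero
        by_cases hD : dFac k = 0
        · simp [relCharge, hD, w]
        · simp only [relCharge, zero_mul, Finset.sum_const_zero, sub_zero, if_neg hD, add_zero]
          field_simp
      have hvec : expVec (w.expo b fun _ => .pos) n = expVec β n :=
        coeff_pexp_congr fun k hk => by rw [hexpo k hk]
      rw [map_zero, ← ha ⟨w, rfl⟩, hP, map_sum]
      refine Finset.sum_congr rfl fun κ _ => ?_
      have h1 := coeff_expVec β n κ
      rw [if_pos (mem_levelFinset.1 κ.2), eval_monomial, one_mul] at h1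
      rw [vecCoord, eval_zero_signSum, pairProd_pos, one_mul, eval_monomial, ← h1]
      change _ = a κ * coeff (κ : ℕ+ →₀ ℕ) (expVec (w.expo b fun _ => .pos) n)
      rw [hvec]
      have := monomialNorm_ne_zero κ
      field_simp
  ext κ
  have h1 : P.coeff κ = a κ / monomialNorm κ := by
    simp [hP, coeff_sum, coeff_monomial]
  rw [h0, coeff_zero, eq_comm, div_eq_zero_iff] at h1
  exact h1.resolve_right (monomialNorm_ne_zero κ)

theorem vec_eq_sum (b : ℝ) {u : ℂ} (hu : u ≠ 0) (w : Word) :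
    w.vec b u = u ^ w.L • ∑ κ : levelFinset w.n, (vecCoord b w κ).eval u⁻¹ •
      (monomial (κ : ℕ+ →₀ ℕ) 1 : A) := by
  rw [Finset.sum_coe_sort (levelFinset w.n) fun κ => (vecCoord b w κ).eval u⁻¹ • (monomial κ 1 : A)]
  ext κ
  simp only [Word.vec, coeff_sum, coeff_smul, smul_eq_mul, coeff_monomial, mul_assoc]
  rw [sum_wt_mul b hu]
  simp only [mul_ite, mul_one, mul_zero, Finset.sum_ite_eq', mem_levelFinset]
  split_ifs with h
  · rfl
  · have : ∀ τ : Fin w.L → SignType, (expVec (w.expo b τ) w.n).coeff κ = 0 := by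
      intro τ
      have := coeff_expVec (w.expo b τ) w.n κ
      rw [if_neg h] at this
      exact (mul_eq_zero.1 this).resolve_right (monomialNorm_ne_zero κ)
    simp [signSum, this]

theorem span_vec_of_span (b : ℝ) {u : ℂ} (hu : u ≠ 0)
    (H : ∀ n, Submodule.span ℂ (Set.range fun (w : {w : Word // w.n = n}) (κ : levelFinset n) =>
      (vecCoord b w κ).eval u⁻¹) = ⊤) :
    Submodule.span ℂ (Set.range fun w : Word => w.vec b u) = ⊤ := by
  classical
  have key : ∀ κ : ℕ+ →₀ ℕ, (monomial κ 1 : A) ∈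
      Submodule.span ℂ (Set.range fun w : Word => w.vec b u) := by
    intro κ
    obtain ⟨n, hn⟩ : ∃ n, level κ = n := ⟨_, rfl⟩
    let ψ : (levelFinset n → ℂ) →ₗ[ℂ] A :=
      Fintype.linearCombination ℂ fun κ : levelFinset n => (monomial (κ : ℕ+ →₀ ℕ) 1 : A)
    have h1 : Submodule.map ψ ⊤ ≤ Submodule.span ℂ (Set.range fun w : Word => w.vec b u) := by
      rw [← H n, Submodule.map_span, Submodule.span_le]
      rintro _ ⟨_, ⟨⟨w, hw⟩, rfl⟩, rfl⟩
      have h2 := vec_eq_sum b hu w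
      have h3 : ψ (fun κ => (vecCoord b w κ).eval u⁻¹) = (u ^ w.L)⁻¹ • w.vec b u := by
        subst hw
        rw [h2, inv_smul_smul₀ (pow_ne_zero _ hu), Fintype.linearCombination_apply]
      rw [SetLike.mem_coe, h3]
      exact Submodule.smul_mem _ _ (Submodule.subset_span ⟨w, rfl⟩)
    have h4 : ψ (Pi.single ⟨κ, mem_levelFinset.2 hn⟩ 1) = monomial κ 1 := by
      simp [ψ]
    rw [← h4]
    exact h1 ⟨_, trivial, rfl⟩
  rw [eq_top_iff]
  intro h _
  rw [h.as_sum]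
  refine Submodule.sum_mem _ fun κ _ => ?_
  have : (monomial κ (h.coeff κ) : A) = h.coeff κ • monomial κ 1 := by simp [smul_monomial]
  rw [this]
  exact Submodule.smul_mem _ _ (key κ)

/-- For generic `u`, the matrix elements separate the chiral descendants, and the vectors of words
span. -/
theorem exists_countable_generic (b : ℝ) (hY : ∀ n, Y b n ≠ 0) :
    ∃ B : Set ℂ, B.Countable ∧ ∀ u ≠ 0, u⁻¹ ∉ B → Nondegenerate b u ∧
      Submodule.span ℂ (Set.range fun w : Word => w.vec b u) = ⊤ := by
  refine ⟨(⋃ T : Finset (ℕ+ →₀ ℕ), {v : ℂ | Submodule.span ℂ (Set.range fun t (κ : T) =>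
      (melCoord b t κ).eval v) ≠ ⊤}) ∪ ⋃ n, {v : ℂ | Submodule.span ℂ (Set.range fun
      (w : {w : Word // w.n = n}) (κ : levelFinset n) => (vecCoord b w κ).eval v) ≠ ⊤}, ?_, ?_⟩
  · exact (Set.countable_iUnion fun T => (finite_span_ne_top _ (span_melCoord b T)).countable).union
      (Set.countable_iUnion fun n => (finite_span_ne_top _ (span_vecCoord b hY n)).countable)
  · intro u hu h
    simp only [Set.mem_union, Set.mem_iUnion, Set.mem_ofPred_eq, not_or, not_exists, not_not] at h
    exact ⟨nondegenerate_of_span b hY hu h.1, span_vec_of_span b hu h.2⟩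

/-! ### The reflection of the descendants -/

theorem bracket_smul_left (u v : Fock) (c : ℂ) : bracket (c • u) v = c * bracket u v := by
  rw [bracket_eq_sum (support_smul (a := c) (f := u)), bracket, Finset.mul_sum]
  exact Finset.sum_congr rfl fun m _ => by rw [coeff_smul, smul_eq_mul]; ring

/-- The matrix elements as bilinear functions of the descendants. -/
def melBilin (b : ℝ) (u : ℂ) {N : ℕ} (x : Fin N → ℂ) : A →ₗ[ℂ] A →ₗ[ℂ] ℂ :=
  LinearMap.mk₂ ℂ (mel b u x)
    (fun h₁ h₂ h => by
      simp only [mel, NormalExp.matrixElement, pairing, map_add, bracket_add_left, mul_add,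
        Finset.sum_add_distrib])
    (fun c h₁ h => by
      simp only [mel, NormalExp.matrixElement, pairing, map_smul, bracket_smul_left, Finset.mul_sum,
        smul_eq_mul]
      exact Finset.sum_congr rfl fun σ _ => by ring)
    (mel_add_right b u x) (fun c h h₁ => mel_smul_right b u x h h₁ c)

/-- The conditions on `u` under which the reflection is well defined. -/
def Generic (b : ℝ) (u : ℂ) : Prop :=
  u ≠ 0 ∧ ∀ v, v = u ∨ v = u⁻¹ → Nondegenerate b v ∧
    Submodule.span ℂ (Set.range fun w : Word => w.vec b v) = ⊤

theorem Generic.inv {b : ℝ} {u : ℂ} (h : Generic b u) : Generic b u⁻¹ :=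
  ⟨inv_ne_zero h.1, fun v hv => h.2 v (by rw [inv_inv] at hv; exact hv.symm)⟩

/-- The vectors at `u⁻¹` span, so only consistency is at stake. By `mel_vec_one`, a relation between
them makes the same combination of vectors at `u` have zero matrix elements at parameter `u⁻¹`.
Nondegeneracy there forces that combination to vanish. -/
theorem exists_reflection (b : ℝ) (hY : ∀ n, Y b n ≠ 0) {u : ℂ} (hu : Generic b u) :
    ∃ R : A →ₗ[ℂ] A, ∀ w : Word, R (w.vec b u⁻¹) = w.vec b u := by
  let Φ : ℂ → (Word →₀ ℂ) →ₗ[ℂ] A := fun v => Finsupp.linearCombination ℂ fun w : Word => w.vec b v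
  have hker : ∀ κ, Φ u⁻¹ κ = 0 → Φ u κ = 0 := by
    intro κ hκ
    refine (hu.2 u⁻¹ (Or.inr rfl)).1 _ fun M x hx => ?_
    have h1 : ((melBilin b u x).flip 1).comp (Φ u⁻¹) = ((melBilin b u⁻¹ x).flip 1).comp (Φ u) := by
      refine Finsupp.lhom_ext' fun w => LinearMap.ext_ring ?_
      simp only [Φ, LinearMap.comp_apply, Finsupp.lsingle_apply, Finsupp.linearCombination_single,
        one_smul]
      exact mel_vec_one b hY hu.1 hx w
    have h2 := LinearMap.congr_fun h1 κ
    simp only [LinearMap.comp_apply, hκ, map_zero] at h2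
    exact h2.symm
  have hsurj : LinearMap.range (Φ u⁻¹) = ⊤ := by
    rw [Finsupp.range_linearCombination]
    exact (hu.2 u⁻¹ (Or.inr rfl)).2
  obtain ⟨s, hs⟩ := (Φ u⁻¹).exists_rightInverse_of_surjective hsurj
  refine ⟨(Φ u).comp s, fun w => ?_⟩
  have h1 : Φ u⁻¹ (s (w.vec b u⁻¹) - Finsupp.single w 1) = 0 := by
    rw [map_sub, ← LinearMap.comp_apply, hs]
    simp [Φ]
  have h2 := hker _ h1
  rw [map_sub, sub_eq_zero] at h2
  rw [LinearMap.comp_apply, h2]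
  simp [Φ]

open Classical in
/-- The reflection map on the descendants. -/
def reflection (b : ℝ) (u : ℂ) : A →ₗ[ℂ] A :=
  if h : ∃ R : A →ₗ[ℂ] A, ∀ w : Word, R (w.vec b u⁻¹) = w.vec b u then h.choose else 0

theorem reflection_vec (b : ℝ) (hY : ∀ n, Y b n ≠ 0) {u : ℂ} (hu : Generic b u) (w : Word) :
    reflection b u (w.vec b u⁻¹) = w.vec b u := by
  have h := exists_reflection b hY hu
  rw [reflection, dif_pos h]
  exact h.choose_spec w

theorem reflection_comp_reflection (b : ℝ) (hY : ∀ n, Y b n ≠ 0) {u : ℂ} (hu : Generic b u) :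
    reflection b u⁻¹ ∘ₗ reflection b u = LinearMap.id := by
  refine LinearMap.ext_on_range (hu.2 u⁻¹ (Or.inr rfl)).2 fun w => ?_
  have h := reflection_vec b hY hu.inv w
  rw [inv_inv] at h
  rw [LinearMap.comp_apply, reflection_vec b hY hu, h, LinearMap.id_apply]

/-- Both sides are bilinear and agree on spanning vectors by `mel_vec_vec`. The inverse parameter
for `h'` is the origin of `Q_L - a` in the theorem. -/
theorem mel_reflection (b : ℝ) (hY : ∀ n, Y b n ≠ 0) {u : ℂ} (hu : Generic b u) {N : ℕ}
    {x : Fin N → ℂ} (hx : Regular x) (h h' : A) :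
    mel b u x h h' = mel b u⁻¹ x (reflection b u h) (reflection b u⁻¹ h') := by
  have key : melBilin b u x = (melBilin b u⁻¹ x).compl₁₂ (reflection b u) (reflection b u⁻¹) := by
    refine LinearMap.ext_on_range (hu.2 u⁻¹ (Or.inr rfl)).2 fun w =>
      LinearMap.ext_on_range (hu.2 u (Or.inl rfl)).2 fun w' => ?_
    have h1 := reflection_vec b hY hu.inv w'
    rw [inv_inv] at h1
    rw [LinearMap.compl₁₂_apply, reflection_vec b hY hu, h1]
    exact mel_vec_vec b hY hu.1 hx w w'
  exact LinearMap.congr_fun (LinearMap.congr_fun key h) h'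

/-! ### The reflection group -/

/-- Equality of the two cosines would make `(b² - 1)/(b² + 1)` rational, and hence `b²` too. -/
theorem Y_ne_zero {b : ℝ} (hb : 0 < b) (hirr : Irrational (b ^ 2)) (n : ℕ+) : Y b n ≠ 0 := by
  intro h
  rw [Y, sub_eq_zero, Real.cos_eq_cos_iff] at h
  have hn : (n : ℝ) ≠ 0 := by exact_mod_cast n.ne_zero
  have hb2 : b ^ 2 + 1 ≠ 0 := by positivity
  have hρ : Real.pi * (b - b⁻¹) * n / (3 * Q b) = Real.pi * n / 3 * ((b ^ 2 - 1) / (b ^ 2 + 1)) := by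
    have : Q b ≠ 0 := by have := inv_pos.2 hb; rw [Q]; positivity
    have hQ : Q b = (b ^ 2 + 1) / b := by rw [Q]; field_simp
    rw [hQ]
    field_simp
  have key : ∀ q : ℚ, (b ^ 2 - 1) / (b ^ 2 + 1) = q → False := by
    intro q hq
    rw [div_eq_iff hb2] at hq
    have hq1 : (1 - q : ℝ) ≠ 0 := by
      intro h1
      have : (q : ℝ) = 1 := by linarith
      rw [this] at hq
      linarith
    refine hirr ⟨(1 + q) / (1 - q), ?_⟩
    push_cast
    rw [div_eq_iff hq1]
    linarith
  have hpi := Real.pi_ne_zero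
  obtain ⟨k, h | h⟩ := h <;> rw [hρ] at h
  · refine key (1 - 6 * k / n) ?_
    push_cast
    field_simp at h ⊢
    linarith
  · refine key (6 * k / n - 1) ?_
    push_cast
    field_simp at h ⊢
    linarith

theorem p_injective {b : ℝ} (hb : 0 < b) : Function.Injective (p b) := by
  intro a a' h
  have hQ : (Q b : ℂ) ≠ 0 := by
    have := inv_pos.2 hb
    have : Q b ≠ 0 := by rw [Q]; positivity
    exact_mod_cast this
  have h2 : ((√2 : ℝ) : ℂ) ≠ 0 := by
    have : (√2 : ℝ) ≠ 0 := by positivity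
    exact_mod_cast this
  simp only [p] at h
  field_simp at h
  have h3 : ((√2 : ℝ) : ℂ) * a = (√2 : ℝ) * a' := by linear_combination h / 8
  exact mul_left_cancel₀ h2 h3

theorem p_QL_sub {b : ℝ} (hb : 0 < b) (a : ℂ) : p b (QL b - a) = -p b a := by
  have hQ : (b : ℂ) + (b : ℂ)⁻¹ ≠ 0 := by
    have h := inv_pos.2 hb
    have : b + b⁻¹ ≠ 0 := by positivity
    exact_mod_cast this
  have hb0 : (b : ℂ) ≠ 0 := by exact_mod_cast hb.ne'
  have h2 : ((√2 : ℝ) : ℂ) ≠ 0 := by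
    have : (√2 : ℝ) ≠ 0 := by positivity
    exact_mod_cast this
  have hs : ((√2 : ℝ) : ℂ) ^ 2 = 2 := by
    rw [← Complex.ofReal_pow, Real.sq_sqrt (by norm_num)]; norm_num
  have e : 4 * ((√2 : ℝ) : ℂ) * (QL b : ℂ) = 4 * (b : ℂ)⁻¹ + 8 * b := by
    rw [QL]
    push_cast
    field_simp
    linear_combination 4 * (b : ℂ) ^ 2 * hs
  have e2 : (4 * ((√2 : ℝ) : ℂ) * (QL b - a) - b + (b : ℂ)⁻¹) =
      6 * ((b : ℂ) + (b : ℂ)⁻¹) - (4 * ((√2 : ℝ) : ℂ) * a - b + (b : ℂ)⁻¹) := by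
    linear_combination e
  rw [p, p, e2, Q, Complex.ofReal_add, Complex.ofReal_inv, sub_div,
    div_self (mul_ne_zero (by norm_num) hQ)]
  ring

theorem p_neg_QL'_sub {b : ℝ} (hb : 0 < b) (a : ℂ) : p b (-QL' b - a) = -p b a - 2 := by
  have hQ : (b : ℂ) + (b : ℂ)⁻¹ ≠ 0 := by
    have h := inv_pos.2 hb
    have : b + b⁻¹ ≠ 0 := by positivity
    exact_mod_cast this
  have hb0 : (b : ℂ) ≠ 0 := by exact_mod_cast hb.ne'
  have h2 : ((√2 : ℝ) : ℂ) ≠ 0 := by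
    have : (√2 : ℝ) ≠ 0 := by positivity
    exact_mod_cast this
  have hs : ((√2 : ℝ) : ℂ) ^ 2 = 2 := by
    rw [← Complex.ofReal_pow, Real.sq_sqrt (by norm_num)]; norm_num
  have e : 4 * ((√2 : ℝ) : ℂ) * (QL' b : ℂ) = 8 * (b : ℂ)⁻¹ + 4 * b := by
    rw [QL']
    push_cast
    field_simp
    linear_combination 4 * hs
  have e2 : (4 * ((√2 : ℝ) : ℂ) * (-QL' b - a) - b + (b : ℂ)⁻¹) =
      -(6 * ((b : ℂ) + (b : ℂ)⁻¹)) - (4 * ((√2 : ℝ) : ℂ) * a - b + (b : ℂ)⁻¹) := by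
    linear_combination -e
  rw [p, p, e2, Q, Complex.ofReal_add, Complex.ofReal_inv, sub_div, neg_div,
    div_self (mul_ne_zero (by norm_num) hQ)]
  ring

/-- The translations in the reflection group, in terms of the parameter `p`. -/
def IsTranslation (b : ℝ) (w : Equiv.Perm ℂ) : Prop := ∃ k : ℤ, ∀ a, p b (w a) = p b a + 2 * k

/-- The reflections in the reflection group, in terms of the parameter `p`. -/
def IsReflection (b : ℝ) (w : Equiv.Perm ℂ) : Prop := ∃ k : ℤ, ∀ a, p b (w a) = -p b a + 2 * k

theorem IsTranslation.mul {b : ℝ} {w w' : Equiv.Perm ℂ} (h' : IsTranslation b w')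
    (h : IsTranslation b w) : IsTranslation b (w' * w) := by
  obtain ⟨k, hk⟩ := h
  obtain ⟨l, hl⟩ := h'
  exact ⟨k + l, fun a => by rw [Equiv.Perm.mul_apply, hl, hk]; push_cast; ring⟩

theorem IsTranslation.mul_isReflection {b : ℝ} {w w' : Equiv.Perm ℂ} (h' : IsTranslation b w')
    (h : IsReflection b w) : IsReflection b (w' * w) := by
  obtain ⟨k, hk⟩ := h
  obtain ⟨l, hl⟩ := h'
  exact ⟨k + l, fun a => by rw [Equiv.Perm.mul_apply, hl, hk]; push_cast; ring⟩

theorem IsReflection.mul_isTranslation {b : ℝ} {w w' : Equiv.Perm ℂ} (h' : IsReflection b w')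
    (h : IsTranslation b w) : IsReflection b (w' * w) := by
  obtain ⟨k, hk⟩ := h
  obtain ⟨l, hl⟩ := h'
  exact ⟨l - k, fun a => by rw [Equiv.Perm.mul_apply, hl, hk]; push_cast; ring⟩

theorem IsReflection.mul {b : ℝ} {w w' : Equiv.Perm ℂ} (h' : IsReflection b w')
    (h : IsReflection b w) : IsTranslation b (w' * w) := by
  obtain ⟨k, hk⟩ := h
  obtain ⟨l, hl⟩ := h'
  exact ⟨l - k, fun a => by rw [Equiv.Perm.mul_apply, hl, hk]; push_cast; ring⟩

theorem isTranslation_one (b : ℝ) : IsTranslation b 1 := ⟨0, fun a => by simp⟩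

theorem isTranslation_or_isReflection {b : ℝ} (hb : 0 < b) {w : Equiv.Perm ℂ} (hw : w ∈ W b) :
    IsTranslation b w ∨ IsReflection b w := by
  induction hw using Subgroup.closure_induction with
  | mem w hw =>
    right
    rcases hw with rfl | rfl
    · exact ⟨0, fun a => by simp [p_QL_sub hb]⟩
    · exact ⟨-1, fun a => by simp [p_neg_QL'_sub hb]; ring⟩
  | one => exact Or.inl (isTranslation_one b)
  | mul w w' _ _ h h' =>
    rcases h with h | h <;> rcases h' with h' | h'
    · exact Or.inl (h.mul h')
    · exact Or.inr (h.mul_isReflection h')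
    · exact Or.inr (h.mul_isTranslation h')
    · exact Or.inl (h.mul h')
  | inv w _ h =>
    rcases h with ⟨k, h⟩ | ⟨k, h⟩
    · refine Or.inl ⟨-k, fun a => ?_⟩
      have := h (w⁻¹ a)
      rw [Equiv.Perm.inv_def, Equiv.apply_symm_apply] at this
      rw [Equiv.Perm.inv_def]
      push_cast
      linear_combination -this
    · refine Or.inr ⟨k, fun a => ?_⟩
      have := h (w⁻¹ a)
      rw [Equiv.Perm.inv_def, Equiv.apply_symm_apply] at this
      rw [Equiv.Perm.inv_def]
      linear_combination this

theorem IsReflection.not_isTranslation {b : ℝ} (hb : 0 < b) {w : Equiv.Perm ℂ}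
    (h : IsReflection b w) : ¬ IsTranslation b w := by
  rintro ⟨l, hl⟩
  obtain ⟨k, hk⟩ := h
  have h0 := (hk 0).symm.trans (hl 0)
  have h1 := (hk 1).symm.trans (hl 1)
  exact zero_ne_one (p_injective hb (by linear_combination (h1 - h0) / 2))

/-- The parameter `u = e^{iπp}`. -/
def uParam (b : ℝ) (a : ℂ) : ℂ := Complex.exp (Complex.I * Real.pi * p b a)

theorem exp_I_pi_add (z : ℂ) (k : ℤ) :
    Complex.exp (Complex.I * Real.pi * (z + 2 * k)) = Complex.exp (Complex.I * Real.pi * z) := by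
  rw [Complex.exp_eq_exp_iff_exists_int]
  exact ⟨k, by ring⟩

theorem IsTranslation.uParam_apply {b : ℝ} {w : Equiv.Perm ℂ} (h : IsTranslation b w) (a : ℂ) :
    uParam b (w a) = uParam b a := by
  obtain ⟨k, hk⟩ := h
  rw [uParam, uParam, hk, exp_I_pi_add]

theorem IsReflection.uParam_apply {b : ℝ} {w : Equiv.Perm ℂ} (h : IsReflection b w) (a : ℂ) :
    uParam b (w a) = (uParam b a)⁻¹ := by
  obtain ⟨k, hk⟩ := h
  rw [uParam, uParam, hk, exp_I_pi_add, ← Complex.exp_neg]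
  congr 1
  ring

theorem uParam_QL_sub {b : ℝ} (hb : 0 < b) (a : ℂ) : uParam b (QL b - a) = (uParam b a)⁻¹ := by
  rw [uParam, uParam, p_QL_sub hb, ← Complex.exp_neg]
  congr 1
  ring

theorem countable_uParam_preimage {b : ℝ} (hb : 0 < b) {B : Set ℂ} (hB : B.Countable) :
    {a | uParam b a ∈ B}.Countable := by
  have : {a | uParam b a ∈ B} = ⋃ v ∈ B, {a | uParam b a = v} := by ext; simp
  rw [this]
  refine hB.biUnion fun v _ => ?_
  rcases Set.eq_empty_or_nonempty {a | uParam b a = v} with h | ⟨a₀, ha₀⟩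
  · rw [h]; exact Set.countable_empty
  · refine Set.countable_of_injective_of_countable_image (p_injective hb).injOn
      ((Set.countable_range fun n : ℤ => p b a₀ + 2 * n).mono ?_)
    rintro _ ⟨a, ha, rfl⟩
    have h1 : uParam b a = uParam b a₀ := Eq.trans ha (Eq.symm ha₀)
    rw [uParam, uParam, Complex.exp_eq_exp_iff_exists_int] at h1
    obtain ⟨n, hn⟩ := h1
    refine ⟨n, ?_⟩
    have hpi : (Complex.I * Real.pi : ℂ) ≠ 0 :=
      mul_ne_zero Complex.I_ne_zero (by exact_mod_cast Real.pi_ne_zero)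
    refine mul_left_cancel₀ hpi ?_
    linear_combination -hn

open Classical in
/-- The representation of the reflection group on the descendants. -/
def reflectionRep (b : ℝ) (a : ℂ) (w : Equiv.Perm ℂ) : A →ₗ[ℂ] A :=
  if IsTranslation b w then LinearMap.id else reflection b (uParam b a)

/-- The maps depend on `a` only through `u`, which translations fix. The one case with content is
two reflections, where the second acts at `u⁻¹` and undoes the first. -/
theorem reflectionRep_mul {b : ℝ} (hb : 0 < b) (hY : ∀ n, Y b n ≠ 0) {a : ℂ}
    (ha : Generic b (uParam b a)) {w w' : Equiv.Perm ℂ} (hw : w ∈ W b) (hw' : w' ∈ W b) :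
    reflectionRep b a (w' * w) = reflectionRep b (w a) w' ∘ₗ reflectionRep b a w := by
  rcases isTranslation_or_isReflection hb hw with h | h <;>
    rcases isTranslation_or_isReflection hb hw' with h' | h' <;>
    simp only [reflectionRep]
  · rw [if_pos (h'.mul h), if_pos h, if_pos h', LinearMap.comp_id]
  · rw [if_neg ((h'.mul_isTranslation h).not_isTranslation hb), if_pos h,
      if_neg (h'.not_isTranslation hb), h.uParam_apply, LinearMap.comp_id]
  · rw [if_neg ((h'.mul_isReflection h).not_isTranslation hb), if_pos h',
      if_neg (h.not_isTranslation hb), LinearMap.id_comp]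
  · rw [if_pos (h'.mul h), if_neg (h.not_isTranslation hb), if_neg (h'.not_isTranslation hb),
      h.uParam_apply, reflection_comp_reflection b hY ha]

theorem Jtilde_reflectionRep {b : ℝ} (hb : 0 < b) (hY : ∀ n, Y b n ≠ 0) {a : ℂ}
    (ha : Generic b (uParam b a)) {w : Equiv.Perm ℂ} (hw : w ∈ W b) {N : ℕ} {x : Fin N → ℂ}
    (hx : Regular x) (h h' : A) :
    Jtilde b a x h h' =
      Jtilde b (w a) x (reflectionRep b a w h) (reflectionRep b (QL b - a) w h') := by
  rw [Jtilde_eq_mel, Jtilde_eq_mel]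
  change mel b (uParam b a) x h h' = mel b (uParam b (w a)) x _ _
  rcases isTranslation_or_isReflection hb hw with hw | hw
  · rw [hw.uParam_apply, reflectionRep, reflectionRep, if_pos hw, if_pos hw, LinearMap.id_apply,
      LinearMap.id_apply]
  · rw [hw.uParam_apply, reflectionRep, reflectionRep, if_neg (hw.not_isTranslation hb),
      if_neg (hw.not_isTranslation hb), uParam_QL_sub hb, mel_reflection b hY ha hx]

end BulloughDodd

end

theorem theorem2 (b : ℝ) (hb : 0 < b) (hirr : Irrational (b ^ 2)) :
    ∃ S : Set ℂ, S.Countable ∧ (∀ w ∈ BulloughDodd.W b, ∀ a ∈ S, w a ∈ S) ∧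
      ∃ r : ℂ → BulloughDodd.W b → (BulloughDodd.A →ₗ[ℂ] BulloughDodd.A),
        (∀ a ∉ S, r a 1 = LinearMap.id) ∧
        (∀ a ∉ S, ∀ w w' : BulloughDodd.W b,
          r a (w' * w) = r ((w : Equiv.Perm ℂ) a) w' ∘ₗ r a w) ∧
        ∀ a ∉ S, ∀ w : BulloughDodd.W b, ∀ (N : ℕ) (x : Fin N → ℂ),
          (∀ i, x i ≠ 0) → (∀ i j, i ≠ j → x i ^ 6 ≠ x j ^ 6) →
          ∀ h h' : BulloughDodd.A,
            BulloughDodd.Jtilde b a x h h' =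
              BulloughDodd.Jtilde b ((w : Equiv.Perm ℂ) a) x
                (r a w h) (r ((BulloughDodd.QL b : ℂ) - a) w h') := by
  have hY := BulloughDodd.Y_ne_zero hb hirr
  obtain ⟨B, hB, hgen⟩ := BulloughDodd.exists_countable_generic b hY
  -- The exceptional set is symmetrized under inversion. Excluding it makes both `u` and `u⁻¹`
  -- generic, and its preimage is stable under `𝒲`.
  have hS : ∀ a, ¬(BulloughDodd.uParam b a ∈ B ∪ B⁻¹) →
      BulloughDodd.Generic b (BulloughDodd.uParam b a) := by
    intro a ha
    rw [Set.mem_union, Set.mem_inv, not_or] at ha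
    have hu : BulloughDodd.uParam b a ≠ 0 := Complex.exp_ne_zero _
    refine ⟨hu, ?_⟩
    rintro v (rfl | rfl)
    · exact hgen _ hu ha.2
    · exact hgen _ (inv_ne_zero hu) (by rw [inv_inv]; exact ha.1)
  refine ⟨{a | BulloughDodd.uParam b a ∈ B ∪ B⁻¹},
    BulloughDodd.countable_uParam_preimage hb (hB.union (hB.preimage inv_injective)), ?_,
    fun a w => BulloughDodd.reflectionRep b a w, ?_, ?_, ?_⟩
  · intro w hw a ha
    rcases BulloughDodd.isTranslation_or_isReflection hb hw with hw | hw
    · rwa [Set.mem_ofPred_eq, hw.uParam_apply]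
    · rw [Set.mem_ofPred_eq, hw.uParam_apply, Set.mem_union, Set.mem_inv, inv_inv]
      exact Or.symm ha
  · intro a _
    exact if_pos (BulloughDodd.isTranslation_one b)
  · intro a ha w w'
    exact BulloughDodd.reflectionRep_mul hb hY (hS a ha) w.2 w'.2
  · intro a ha w N x hx hx' h h'
    exact BulloughDodd.Jtilde_reflectionRep hb hY (hS a ha) w.2 ⟨hx, hx'⟩ h h'
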